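/- Let $0<y_2<y_1$ be real. For $z\in\mathbb{C}$ put $\sqrt{\mathcal R(z)}=\sqrt{z}\,\sqrt{z-y_2}\,\sqrt{z-y_1}$ (principal branch of each square root), so that $\sqrt{\mathcal R(z)}>0$ for $z>y_1$. Let $X$ be the compact genus one Riemann surface of $w^2=z(z-y_2)(z-y_1)$, consisting of the finite points $(z,w)$ and one point $\infty$. Over $\mathbb{C}\setminus(-\infty,y_1]$ the first sheet is $w=\sqrt{\mathcal R(z)}$ and the second sheet is $w=-\sqrt{\mathcal R(z)}$. Put $$c_0=\Big(\int_0^{y_2}\frac{2\,dx}{|\sqrt{\mathcal R(x)}|}\Big)^{-1}>0,\qquad \tau=\int_{y_2}^{y_1}\frac{2ic_0\,dx}{|\sqrt{\mathcal R(x)}|}\in i\mathbb{R}^+,\qquad \theta(u)=\sum_{m\in\mathbb{Z}}e^{2\pi imu}e^{\pi im^2\tau}.$$ For a point $p=(z,w)$ of either sheet with $z\in\mathbb{C}\setminus(-\infty,y_1]$ let $\varphi(p)=\int_{y_1}^{p}\frac{c_0\,dz}{w}$, the path staying in the sheet of $p$ and not crossing $(-\infty,y_1]$. The Abel map $\varphi_A:X\to\mathbb{C}/(\mathbb{Z}+\tau\mathbb{Z})$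 is $\varphi$ modulo $\mathbb{Z}+\tau\mathbb{Z}$, extended to all of $X$ by continuity. Then, for all points of $X$, with $z$ denoting the projection of the point to $\mathbb{C}\cup\{\infty\}$ and $\varphi_A$ denoting any representative in $\mathbb{C}$ of the value of the Abel map at that point, $$\frac{e^{2\pi i\varphi_A}\,\theta(\varphi_A+\frac{\tau}{2})^2}{\theta(\varphi_A)^2}=\frac{D_1^2}{z},\qquad \frac{e^{2\pi i\varphi_A}\,\theta(\varphi_A+\frac{1+\tau}{2})^2}{\theta(\varphi_A)^2}=\frac{D_2^2(z-y_1)}{z},\qquad \frac{\theta(\varphi_A+\frac12)^2}{\theta(\varphi_A)^2}=\frac{D_3^2(z-y_2)}{z},$$ where $$D_1=(y_1y_2)^{1/4}e^{-\pi i\tau/4},\qquad D_2=i\,\frac{y_2^{1/4}e^{-\pi i\tau/4}}{(y_1-y_2)^{1/4}},\qquad D_3=\frac{y_1^{1/4}}{(y_1-y_2)^{1/4}}.$$ These are equalities of values in $\mathbb{C}\cup\{\infty\}$. At the finite points with $z\neq0$ the denominator $\theta(\varphi_A)$ is nonzero; at $\infty$ it is also nonzero and the three quotients equal $0$, $D_2^2$,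 $D_3^2$; at the point over $z=0$ one has $\theta(\varphi_A)=0$ while the three numerators are nonzero, so that both sides of each identity are infinite. -/

import Mathlib

open Filter Topology
open scoped Real

noncomputable section

namespace AbelTheta

/-- The polynomial `R(x) = x (x - y₂) (x - y₁)` on the real line. -/
def realR (y₁ y₂ x : ℝ) : ℝ := x * (x - y₂) * (x - y₁)

/-- The branch of `√R(z)`, `R(z) = z (z - y₂) (z - y₁)`, obtained by taking the principal branch of
each square root; it is positive for `z > y₁`. -/
def sqrtR (y₁ y₂ : ℝ) (z : ℂ) : ℂ :=
  z ^ (1 / 2 : ℂ) * (z - y₂) ^ (1 / 2 : ℂ) * (z - y₁) ^ (1 / 2 : ℂ)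

/-- The normalizing constant `c₀ = (∫_A dz / √R(z))⁻¹`, the cycle `A` being collapsed onto
`[0, y₂]`. -/
def c₀ (y₁ y₂ : ℝ) : ℝ :=
  (∫ x in (0 : ℝ)..y₂, 2 / √|realR y₁ y₂ x|)⁻¹

/-- The lattice parameter `τ = ∫_B ω ∈ i ℝ⁺`, with `ω = c₀ dz / √R(z)`; the period is collapsed onto
`[y₂, y₁]`. -/
def tau (y₁ y₂ : ℝ) : ℂ :=
  Complex.I * ((∫ x in y₂..y₁, 2 * c₀ y₁ y₂ / √|realR y₁ y₂ x| : ℝ) : ℂ)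

/-- `θ(u) = ∑ₘ exp (2 π i m u + π i m² τ)`. -/
def theta (y₁ y₂ : ℝ) (u : ℂ) : ℂ := jacobiTheta₂ u (tau y₁ y₂)

/-- The affine curve `w² = z (z - y₂) (z - y₁)`, with points `(z, w)`. -/
def affineCurve (y₁ y₂ : ℝ) : Set (ℂ × ℂ) :=
  {p | p.2 ^ 2 = p.1 * (p.1 - y₂) * (p.1 - y₁)}

/-- The compact Riemann surface `X` (as a topological space): the affine curve together with its
single point at infinity. -/
abbrev Surface (y₁ y₂ : ℝ) : Type := OnePoint (affineCurve y₁ y₂)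

/-- The branch point `(0, 0)` of `X` lying over `z = 0`. -/
def origin (y₁ y₂ : ℝ) : affineCurve y₁ y₂ :=
  ⟨(0, 0), by simp [affineCurve]⟩

/-- The points of the two sheets whose projection does not lie on `(-∞, y₁]`. -/
def slitPart (y₁ y₂ : ℝ) : Set (affineCurve y₁ y₂) :=
  {p | ¬ (p.1.1.im = 0 ∧ p.1.1.re ≤ y₁)}

open Classical in
/-- The function `φ(p) = ∫_{y₁}^{p} ω` for `p = (z, w)` in `slitPart`, integrated along the straight
segment from `y₁` to `z` in the sheet of `p`; this segment does not meet `(-∞, y₁]` except at its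
initial point. On the first sheet `w = √R(z)` and `ω = c₀ dz / √R(z)`; on the second sheet
`w = -√R(z)` and `ω = - c₀ dz / √R(z)`. (Only used on `slitPart`.) -/
def phi (y₁ y₂ : ℝ) (p : affineCurve y₁ y₂) : ℂ :=
  ∫ t in (0 : ℝ)..1,
    (if p.1.2 = sqrtR y₁ y₂ p.1.1 then (1 : ℂ) else -1) * c₀ y₁ y₂
      / sqrtR y₁ y₂ (y₁ + t * (p.1.1 - y₁)) * (p.1.1 - y₁)

/-- The lattice `ℤ + τ ℤ`. -/
def lattice (y₁ y₂ : ℝ) : AddSubgroup ℂ := AddSubgroup.closure {1, tau y₁ y₂}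

/-- The Abel map `φ_A : X → ℂ / (ℤ + τ ℤ)`: the class of `φ`, extended by continuity from the slit
sheets to all of `X`. -/
def abelMap (y₁ y₂ : ℝ) (P : Surface y₁ y₂) : ℂ ⧸ lattice y₁ y₂ :=
  limUnder (comap ((↑) : affineCurve y₁ y₂ → Surface y₁ y₂) (𝓝 P) ⊓ 𝓟 (slitPart y₁ y₂))
    (fun p => (phi y₁ y₂ p : ℂ ⧸ lattice y₁ y₂))

/-- `D₁ = (y₁ y₂)^{1/4} exp (- π i τ / 4)`. -/
def D₁ (y₁ y₂ : ℝ) : ℂ :=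
  (((y₁ * y₂) ^ (1 / 4 : ℝ) : ℝ) : ℂ) * Complex.exp (-(π * Complex.I * tau y₁ y₂ / 4))

/-- `D₂ = i y₂^{1/4} exp (- π i τ / 4) / (y₁ - y₂)^{1/4}`. -/
def D₂ (y₁ y₂ : ℝ) : ℂ :=
  Complex.I * (((y₂ ^ (1 / 4 : ℝ) : ℝ) : ℂ) * Complex.exp (-(π * Complex.I * tau y₁ y₂ / 4))
    / (((y₁ - y₂) ^ (1 / 4 : ℝ) : ℝ) : ℂ))

/-- `D₃ = y₁^{1/4} / (y₁ - y₂)^{1/4}`. -/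
def D₃ (y₁ y₂ : ℝ) : ℂ :=
  ((y₁ ^ (1 / 4 : ℝ) : ℝ) : ℂ) / (((y₁ - y₂) ^ (1 / 4 : ℝ) : ℝ) : ℂ)

/-- `exp (2 π i u) θ(u + τ/2)²`, the numerator of the first quotient. -/
def num₁ (y₁ y₂ : ℝ) (u : ℂ) : ℂ :=
  Complex.exp (2 * π * Complex.I * u) * theta y₁ y₂ (u + tau y₁ y₂ / 2) ^ 2

/-- `exp (2 π i u) θ(u + (1 + τ)/2)²`, the numerator of the second quotient. -/
def num₂ (y₁ y₂ : ℝ) (u : ℂ) : ℂ :=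
  Complex.exp (2 * π * Complex.I * u) * theta y₁ y₂ (u + (1 + tau y₁ y₂) / 2) ^ 2

/-- `θ(u + 1/2)²`, the numerator of the third quotient. -/
def num₃ (y₁ y₂ : ℝ) (u : ℂ) : ℂ :=
  theta y₁ y₂ (u + 1 / 2) ^ 2

end AbelTheta

end

namespace AbelTheta

open MeasureTheory Complex

/-! ### Square roots on the closed upper half plane -/

/-! On the closed upper half plane, φ is the integral `abelInt` from y₁. The phase of √R is constant
on each of the four intervals cut out by y₁, y₂, 0, so φ maps the real line into the sides of a
rectangle, with φ = 0, τ/2, (1+τ)/2 at y₁, y₂, 0, and φ → 1/2 at infinity. Complex conjugation acts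
on the boundary values by u ↦ u, -u, u-τ, 1-u in turn (`conj_abelInt_of_ge` and its companions).

θ² and the three numerators are even, real on conjugate arguments, and share one automorphy factor
(`SecondOrder`), so a quotient of two such functions composed with φ is real on the real line. The
reference function is σ² (`sigmaSq`), an infinite product whose zeros are visible. Since Re φ
increases strictly along half circles about 0, φ meets the lattice only at y₁
(`abelInt_mem_region`), so a quotient N/σ² along φ is singular only there, like a simple pole in z.
After subtracting a multiple of σ² from N to make it vanish at 1/2, and multiplying the quotient by
z - y₁, the result is continuous up to the real line, real there, and bounded near infinity. By
Phragmén–Lindelöf it is constant. Hence (z - y₁)N(φ)/σ²(φ) is affine in z, with coefficients given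
by N(1/2) and N(0) (`exists_forall_secondOrder_abelInt`).

The constants come from evaluating this at z = 0 and z = y₂, where θ² and the third numerator vanish
because θ((1+τ)/2) = 0 (`theta_constants`). This fixes fourth powers of theta constants; positivity
selects the roots (`D_sq_mul_theta`).

In the homogeneous form `ThetaValues` the identities are invariant under sign change and lattice
translation, and compatible with conjugation. They therefore pass to both sheets, both half planes
and any representative of the Abel map, whose limits are computed at each point of X. -/

lemma csqrt_sq (z : ℂ) : (z ^ (1 / 2 : ℂ)) ^ 2 = z := by
  rw [← Complex.cpow_nat_mul]; norm_num

lemma norm_csqrt (z : ℂ) : ‖z ^ (1 / 2 : ℂ)‖ = √‖z‖ := by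
  rw [eq_comm, Real.sqrt_eq_iff_mul_self_eq (norm_nonneg _) (norm_nonneg _), ← norm_mul, ← sq,
    csqrt_sq]

lemma csqrt_re (z : ℂ) : (z ^ (1 / 2 : ℂ)).re = √((‖z‖ + z.re) / 2) := by
  rw [one_div, Complex.cpow_inv_two_re]

lemma csqrt_im {z : ℂ} (hz : 0 ≤ z.im) : (z ^ (1 / 2 : ℂ)).im = √((‖z‖ - z.re) / 2) := by
  rw [one_div, Complex.cpow_inv_two_im_eq_sqrt hz]

/-- The principal root jumps across the negative axis, but from above it agrees with an expression
in ‖z‖ and Re z that is continuous everywhere. This is what allows boundary values on the cut. -/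
lemma continuousOn_csqrt : ContinuousOn (fun z : ℂ => z ^ (1 / 2 : ℂ)) {z | 0 ≤ z.im} := by
  have h : Continuous fun z : ℂ =>
      ((√((‖z‖ + z.re) / 2) : ℝ) : ℂ) + ((√((‖z‖ - z.re) / 2) : ℝ) : ℂ) * I := by fun_prop
  refine h.continuousOn.congr fun z hz => ?_
  beta_reduce
  rw [← csqrt_re, ← csqrt_im hz, Complex.re_add_im]

lemma csqrt_re_pos {z : ℂ} (hz : 0 < z.im) : 0 < (z ^ (1 / 2 : ℂ)).re := by
  rw [csqrt_re, Real.sqrt_pos]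
  have := Complex.abs_re_lt_norm.2 hz.ne'
  have := neg_abs_le z.re
  linarith

lemma csqrt_im_pos {z : ℂ} (hz : 0 < z.im) : 0 < (z ^ (1 / 2 : ℂ)).im := by
  rw [csqrt_im hz.le, Real.sqrt_pos]
  have := Complex.abs_re_lt_norm.2 hz.ne'
  have := le_abs_self z.re
  linarith

lemma csqrt_ofReal_of_nonneg {x : ℝ} (hx : 0 ≤ x) : (x : ℂ) ^ (1 / 2 : ℂ) = (√x : ℝ) := by
  apply Complex.ext
  · rw [csqrt_re]; simp [abs_of_nonneg hx]
  · rw [csqrt_im (by simp)]; simp [abs_of_nonneg hx]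

lemma csqrt_ofReal_of_nonpos {x : ℝ} (hx : x ≤ 0) : (x : ℂ) ^ (1 / 2 : ℂ) = I * (√|x| : ℝ) := by
  apply Complex.ext
  · rw [csqrt_re]; simp [abs_of_nonpos hx]
  · rw [csqrt_im (by simp), norm_real, ofReal_re, Real.norm_eq_abs,
      show (|x| - x) / 2 = |x| by rw [abs_of_nonpos hx]; ring]
    simp

lemma csqrt_conj {z : ℂ} (hz : z ∈ slitPlane) :
    (starRingEnd ℂ z) ^ (1 / 2 : ℂ) = starRingEnd ℂ (z ^ (1 / 2 : ℂ)) := by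
  have := Complex.conj_cpow z (1 / 2) (Complex.mem_slitPlane_iff_arg.1 hz).1
  rwa [map_div₀, map_one, show starRingEnd ℂ 2 = 2 from conj_ofReal 2] at this

variable {y₁ y₂ : ℝ}

lemma sqrtR_sq (z : ℂ) : sqrtR y₁ y₂ z ^ 2 = z * (z - y₂) * (z - y₁) := by
  simp only [sqrtR, mul_pow, csqrt_sq]

lemma norm_sqrtR (z : ℂ) : ‖sqrtR y₁ y₂ z‖ = √‖z‖ * √‖z - y₂‖ * √‖z - y₁‖ := by
  simp only [sqrtR, norm_mul, norm_csqrt]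

lemma sqrtR_eq_zero_iff (z : ℂ) : sqrtR y₁ y₂ z = 0 ↔ z = 0 ∨ z = y₂ ∨ z = y₁ := by
  rw [← sq_eq_zero_iff, sqrtR_sq]
  simp [sub_eq_zero, or_assoc]

lemma continuousOn_sqrtR : ContinuousOn (sqrtR y₁ y₂) {z | 0 ≤ z.im} := by
  have h (a : ℝ) : ContinuousOn (fun z : ℂ => (z - a) ^ (1 / 2 : ℂ)) {z | 0 ≤ z.im} :=
    continuousOn_csqrt.comp (by fun_prop) (fun z hz => by simpa using (hz : 0 ≤ z.im))
  exact (continuousOn_csqrt.mul (h y₂)).mul (h y₁)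

/-- The slit plane `ℂ ∖ (-∞, y₁]`. -/
def cutPlane (y₁ : ℝ) : Set ℂ := {z | ¬ (z.im = 0 ∧ z.re ≤ y₁)}

lemma sub_mem_slitPlane {z : ℂ} (hz : z ∈ cutPlane y₁) {a : ℝ} (ha : a ≤ y₁) :
    z - a ∈ slitPlane := by
  rw [Complex.mem_slitPlane_iff]
  by_contra! h
  simp at h
  exact hz ⟨h.2, by linarith [h.1]⟩

lemma differentiableAt_sqrtR (h₂ : 0 < y₂) (h₁ : y₂ < y₁) {z : ℂ} (hz : z ∈ cutPlane y₁) :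
    DifferentiableAt ℂ (sqrtR y₁ y₂) z := by
  have h0 : z ∈ slitPlane := by simpa using sub_mem_slitPlane hz (a := 0) (by linarith)
  have h (a : ℝ) (ha : a ≤ y₁) : DifferentiableAt ℂ (fun z : ℂ => (z - a) ^ (1 / 2 : ℂ)) z :=
    (differentiableAt_id.sub_const _).cpow_const (sub_mem_slitPlane hz ha)
  exact ((differentiableAt_id.cpow_const h0).mul (h y₂ h₁.le)).mul (h y₁ le_rfl)

lemma sqrtR_ne_zero (h₂ : 0 < y₂) (h₁ : y₂ < y₁) {z : ℂ} (hz : z ∈ cutPlane y₁) :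
    sqrtR y₁ y₂ z ≠ 0 := by
  rw [Ne, sqrtR_eq_zero_iff]
  rintro (rfl | rfl | rfl) <;> apply hz <;> simp <;> linarith

lemma sqrtR_conj (h₂ : 0 < y₂) (h₁ : y₂ < y₁) {z : ℂ} (hz : z ∈ cutPlane y₁) :
    sqrtR y₁ y₂ (starRingEnd ℂ z) = starRingEnd ℂ (sqrtR y₁ y₂ z) := by
  have h0 : z ∈ slitPlane := by simpa using sub_mem_slitPlane hz (a := 0) (by linarith)
  have h (a : ℝ) (ha : a ≤ y₁) := csqrt_conj (sub_mem_slitPlane hz ha)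
  have e2 := h y₂ h₁.le
  have e1 := h y₁ le_rfl
  simp only [map_sub, conj_ofReal] at e1 e2
  simp only [sqrtR, map_mul, csqrt_conj h0, e1, e2]

lemma mem_cutPlane_of_im_pos {z : ℂ} (hz : 0 < z.im) : z ∈ cutPlane y₁ := fun h => hz.ne' h.1

/-! ### Bounds for `1 / √R` along segments -/

lemma inv_sqrt_mul_le {a b c d : ℝ} (hd : 0 < d) (hb : d ≤ b) (hc : d ≤ c) :
    (√a * √b * √c)⁻¹ ≤ d⁻¹ * (√a)⁻¹ := by
  have h1 : d ≤ √b * √c := by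
    calc d = √d * √d := (Real.mul_self_sqrt hd.le).symm
      _ ≤ √b * √c := by gcongr
  rw [mul_assoc, mul_inv, mul_comm]
  gcongr

/-- The sum `∑ₐ |ζ - a|^{-1/2}` over the three finite branch points. -/
noncomputable def branchSum (y₁ y₂ : ℝ) (ζ : ℂ) : ℝ := (√‖ζ‖)⁻¹ + (√‖ζ - y₂‖)⁻¹ + (√‖ζ - y₁‖)⁻¹

/-- The branch points are pairwise at distance at least 2d, so at most one lies within d of ζ; the
other two factors of R are bounded below and only one singular term survives. -/
lemma norm_inv_sqrtR_le (h₂ : 0 < y₂) (h₁ : y₂ < y₁) :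
    ∃ M : ℝ, 0 < M ∧ ∀ ζ : ℂ, ‖(sqrtR y₁ y₂ ζ)⁻¹‖ ≤ M * branchSum y₁ y₂ ζ := by
  obtain ⟨d, hd, hd2, hd1⟩ : ∃ d : ℝ, 0 < d ∧ 2 * d ≤ y₂ ∧ 2 * d ≤ y₁ - y₂ :=
    ⟨min y₂ (y₁ - y₂) / 2, by have := lt_min h₂ (sub_pos.2 h₁); linarith,
      by have := min_le_left y₂ (y₁ - y₂); linarith, by have := min_le_right y₂ (y₁ - y₂); linarith⟩
  refine ⟨d⁻¹, inv_pos.2 hd, fun ζ => ?_⟩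
  have e02 : y₂ ≤ ‖ζ‖ + ‖ζ - y₂‖ := by
    have := norm_sub_le ζ (ζ - y₂)
    simpa [abs_of_pos h₂] using this
  have e21 : y₁ - y₂ ≤ ‖ζ - y₂‖ + ‖ζ - y₁‖ := by
    have := norm_sub_le (ζ - y₂) (ζ - y₁)
    rw [show ζ - y₂ - (ζ - y₁) = ((y₁ - y₂ : ℝ) : ℂ) by push_cast; ring, norm_real,
      Real.norm_eq_abs, abs_of_pos (by linarith)] at this
    exact this
  have e01 : y₁ ≤ ‖ζ‖ + ‖ζ - y₁‖ := by
    have := norm_sub_le ζ (ζ - y₁)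
    simpa [abs_of_pos (h₂.trans h₁)] using this
  have p0 : 0 ≤ d⁻¹ * (√‖ζ‖)⁻¹ := by positivity
  have p2 : 0 ≤ d⁻¹ * (√‖ζ - y₂‖)⁻¹ := by positivity
  have p1 : 0 ≤ d⁻¹ * (√‖ζ - y₁‖)⁻¹ := by positivity
  rw [norm_inv, norm_sqrtR, branchSum, mul_add, mul_add]
  rcases le_or_gt d ‖ζ - y₂‖ with h2 | h2
  · rcases le_or_gt d ‖ζ - y₁‖ with h1 | h1
    · linarith [inv_sqrt_mul_le (a := ‖ζ‖) hd h2 h1]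
    · have := inv_sqrt_mul_le (a := ‖ζ - y₁‖) hd h2 (show d ≤ ‖ζ‖ by linarith)
      rw [show √‖ζ - y₁‖ * √‖ζ - y₂‖ * √‖ζ‖ = √‖ζ‖ * √‖ζ - y₂‖ * √‖ζ - y₁‖ by ring] at this
      linarith
  · have := inv_sqrt_mul_le (a := ‖ζ - y₂‖) hd (show d ≤ ‖ζ‖ by linarith)
      (show d ≤ ‖ζ - y₁‖ by linarith)
    rw [show √‖ζ - y₂‖ * √‖ζ‖ * √‖ζ - y₁‖ = √‖ζ‖ * √‖ζ - y₂‖ * √‖ζ - y₁‖ by ring] at this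
    linarith

lemma integrable_indicator_inv_sqrt :
    Integrable (Set.indicator (Set.Icc (-1 : ℝ) 1) fun x => (√|x|)⁻¹) := by
  rw [integrable_indicator_iff measurableSet_Icc, ← intervalIntegrable_iff_integrableOn_Icc_of_le
    (by norm_num)]
  have h (a : ℝ) (ha : 0 ≤ a) : IntervalIntegrable (fun x : ℝ => (√|x|)⁻¹) volume 0 a := by
    refine (intervalIntegral.intervalIntegrable_rpow' (r := -(1 / 2)) (by norm_num)).congr_ae ?_
    refine (ae_restrict_mem measurableSet_uIoc).mono fun x hx => ?_
    rw [Set.uIoc_of_le ha] at hx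
    simp only
    rw [Real.rpow_neg hx.1.le, ← Real.sqrt_eq_rpow, abs_of_pos hx.1]
  refine IntervalIntegrable.trans (b := 0) ?_ (h 1 zero_le_one)
  have := (h 1 zero_le_one).comp_sub_left 0
  simpa using this.symm

/-- There is a uniform bound for the integrals of `|z + t (w - z) - a|^{-1/2}`. -/
lemma exists_integral_inv_sqrt_norm_le : ∃ K : ℝ, 0 < K ∧ ∀ z w a : ℂ, z ≠ w →
    IntervalIntegrable (fun t : ℝ => (√‖z + t * (w - z) - a‖)⁻¹) volume 0 1 ∧
    ∫ t in (0 : ℝ)..1, (√‖z + t * (w - z) - a‖)⁻¹ ≤ K * (√‖w - z‖)⁻¹ := by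
  set h : ℝ → ℝ := Set.indicator (Set.Icc (-1 : ℝ) 1) fun x => (√|x|)⁻¹ with hh
  have hi : Integrable h := integrable_indicator_inv_sqrt
  have hn : ∀ x, 0 ≤ h x := fun x => Set.indicator_nonneg (fun _ _ => by positivity) x
  refine ⟨(∫ x, h x) + 1, by have := integral_nonneg (μ := volume) (f := h) hn; linarith,
    fun z w a hzw => ?_⟩
  have hwz : 0 < ‖w - z‖ := norm_pos_iff.2 (sub_ne_zero.2 hzw.symm)
  -- Parameter of the orthogonal projection of a on the line through z and w, so the distance from a
  -- to the point with parameter t is at least |t - s| ‖w - z‖.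
  set s : ℝ := ((a - z) / (w - z)).re
  have hle : ∀ t : ℝ, t ≠ s →
      (√‖z + t * (w - z) - a‖)⁻¹ ≤ (h (t - s) + 1) * (√‖w - z‖)⁻¹ := by
    intro t ht
    have hts : 0 < |t - s| := abs_pos.2 (sub_ne_zero.2 ht)
    have e : z + t * (w - z) - a = (w - z) * (t - (a - z) / (w - z)) := by
      have : w - z ≠ 0 := sub_ne_zero.2 hzw.symm
      field_simp
      ring
    have h1 : |t - s| ≤ ‖(t : ℂ) - (a - z) / (w - z)‖ := by
      have := Complex.abs_re_le_norm ((t : ℂ) - (a - z) / (w - z))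
      simpa [s] using this
    have h2 : (√|t - s|)⁻¹ ≤ h (t - s) + 1 := by
      by_cases hm : t - s ∈ Set.Icc (-1 : ℝ) 1
      · rw [hh, Set.indicator_of_mem hm]; linarith
      · rw [hh, Set.indicator_of_notMem hm, zero_add]
        apply inv_le_one_of_one_le₀
        rw [Real.one_le_sqrt]
        rw [Set.mem_Icc, ← abs_le] at hm
        linarith
    rw [e, norm_mul, Real.sqrt_mul hwz.le, mul_inv, mul_comm]
    gcongr
    refine le_trans ?_ h2
    have : 0 < √|t - s| := Real.sqrt_pos.2 hts
    gcongr
  -- The parameter t = s must be left out: there `h 0 = 0` by the convention on inverses, and the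
  -- bound can fail.
  have hae : ∀ᵐ t : ℝ ∂volume.restrict (Set.uIoc 0 1),
      (√‖z + t * (w - z) - a‖)⁻¹ ≤ (h (t - s) + 1) * (√‖w - z‖)⁻¹ :=
    ae_restrict_of_ae ((measure_eq_zero_iff_ae_notMem.1 (measure_singleton s)).mono
      fun t ht => hle t (by simpa using ht))
  have hi' : IntervalIntegrable (fun t => (h (t - s) + 1) * (√‖w - z‖)⁻¹) volume 0 1 :=
    ((hi.comp_sub_right s).intervalIntegrable.add intervalIntegrable_const).mul_const _
  have hi'' : IntervalIntegrable (fun t : ℝ => (√‖z + t * (w - z) - a‖)⁻¹) volume 0 1 := by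
    refine hi'.mono_fun ?_ ?_
    · exact (Measurable.aestronglyMeasurable (by fun_prop))
    · filter_upwards [hae] with t ht
      rw [Real.norm_of_nonneg (by positivity)]
      exact ht.trans (le_abs_self _)
  refine ⟨hi'', ?_⟩
  calc ∫ t in (0 : ℝ)..1, (√‖z + t * (w - z) - a‖)⁻¹
      ≤ ∫ t in (0 : ℝ)..1, (h (t - s) + 1) * (√‖w - z‖)⁻¹ := by
        refine intervalIntegral.integral_mono_ae_restrict zero_le_one hi'' hi' ?_
        rw [Set.uIoc_of_le zero_le_one] at hae
        rwa [← restrict_Ioc_eq_restrict_Icc]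
    _ ≤ ((∫ x, h x) + 1) * (√‖w - z‖)⁻¹ := by
        rw [intervalIntegral.integral_mul_const, intervalIntegral.integral_add
          (hi.comp_sub_right s).intervalIntegrable intervalIntegrable_const]
        gcongr
        · rw [intervalIntegral.integral_of_le zero_le_one, ← integral_sub_right_eq_self h s]
          exact setIntegral_le_integral (hi.comp_sub_right s) (ae_of_all _ fun x => hn _)
        · simp

/-! ### The Abel integral on the closed upper half plane -/

/-- The integral of `c₀ dz / √R(z)` along the segment from `z` to `w`. -/
noncomputable def segInt (y₁ y₂ : ℝ) (z w : ℂ) : ℂ :=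
  ∫ t in (0 : ℝ)..1, c₀ y₁ y₂ / sqrtR y₁ y₂ (z + t * (w - z)) * (w - z)

/-- The integral of `c₀ dz / √R(z)` along the segment from `y₁` to `z`. -/
noncomputable def abelInt (y₁ y₂ : ℝ) (z : ℂ) : ℂ := segInt y₁ y₂ y₁ z

lemma ae_segment_ne {z w : ℂ} (hzw : z ≠ w) (a : ℂ) : ∀ᵐ t : ℝ, z + t * (w - z) ≠ a := by
  refine (measure_eq_zero_iff_ae_notMem.1 (measure_singleton (((a - z) / (w - z)).re))).mono
    fun t ht h => ht ?_
  rw [← h]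
  have : w - z ≠ 0 := sub_ne_zero.2 hzw.symm
  simp [this]

lemma ae_segment_sqrtR_ne_zero {z w : ℂ} (hzw : z ≠ w) :
    ∀ᵐ t : ℝ, sqrtR y₁ y₂ (z + t * (w - z)) ≠ 0 := by
  filter_upwards [ae_segment_ne hzw 0, ae_segment_ne hzw y₂, ae_segment_ne hzw y₁] with t h0 h2 h1
  rw [Ne, sqrtR_eq_zero_iff]
  tauto

lemma segment_im_nonneg {z w : ℂ} (hz : 0 ≤ z.im) (hw : 0 ≤ w.im) {t : ℝ}
    (ht : t ∈ Set.Icc (0 : ℝ) 1) : 0 ≤ (z + t * (w - z)).im := by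
  have : (z + t * (w - z)).im = (1 - t) * z.im + t * w.im := by simp; ring
  rw [this]
  exact add_nonneg (mul_nonneg (by linarith [ht.2]) hz) (mul_nonneg ht.1 hw)

lemma aestronglyMeasurable_inv_sqrtR_segment {z w : ℂ} (hz : 0 ≤ z.im) (hw : 0 ≤ w.im) :
    AEStronglyMeasurable (fun t : ℝ => (sqrtR y₁ y₂ (z + t * (w - z)))⁻¹)
      (volume.restrict (Set.uIoc 0 1)) := by
  have h : AEMeasurable (fun t : ℝ => sqrtR y₁ y₂ (z + t * (w - z)))
      (volume.restrict (Set.uIoc 0 1)) := by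
    refine ContinuousOn.aemeasurable ?_ measurableSet_uIoc
    refine continuousOn_sqrtR.comp (by fun_prop) fun t ht => segment_im_nonneg hz hw ?_
    rw [Set.uIoc_of_le zero_le_one] at ht
    exact Set.Ioc_subset_Icc_self ht
  exact h.inv.aestronglyMeasurable

/-- A uniform bound for `∫ |dζ| / |√R(ζ)|` over segments in the closed upper half plane. -/
lemma exists_segment_bound (h₂ : 0 < y₂) (h₁ : y₂ < y₁) : ∃ K : ℝ, 0 < K ∧ ∀ z w : ℂ,
    0 ≤ z.im → 0 ≤ w.im → z ≠ w →
    IntervalIntegrable (fun t : ℝ => (sqrtR y₁ y₂ (z + t * (w - z)))⁻¹) volume 0 1 ∧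
    ∫ t in (0 : ℝ)..1, ‖(sqrtR y₁ y₂ (z + t * (w - z)))⁻¹‖ ≤ K * (√‖w - z‖)⁻¹ := by
  obtain ⟨M, hM, hMb⟩ := norm_inv_sqrtR_le h₂ h₁
  obtain ⟨K, hK, hKb⟩ := exists_integral_inv_sqrt_norm_le
  refine ⟨M * (K + K + K), by positivity, fun z w hz hw hzw => ?_⟩
  obtain ⟨i0, b0⟩ := hKb z w 0 hzw
  obtain ⟨i2, b2⟩ := hKb z w y₂ hzw
  obtain ⟨i1, b1⟩ := hKb z w y₁ hzw
  simp only [sub_zero] at i0 b0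
  have hi : IntervalIntegrable (fun t : ℝ => M * branchSum y₁ y₂ (z + t * (w - z))) volume 0 1 :=
    ((i0.add i2).add i1).const_mul M
  have hi' : IntervalIntegrable (fun t : ℝ => (sqrtR y₁ y₂ (z + t * (w - z)))⁻¹) volume 0 1 :=
    hi.mono_fun (aestronglyMeasurable_inv_sqrtR_segment hz hw)
      (ae_of_all _ fun t => (hMb _).trans (le_abs_self _))
  refine ⟨hi', ?_⟩
  calc _ ≤ ∫ t in (0 : ℝ)..1, M * branchSum y₁ y₂ (z + t * (w - z)) :=
        intervalIntegral.integral_mono_on zero_le_one hi'.norm hi fun t _ => hMb _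
    _ ≤ _ := by
        rw [intervalIntegral.integral_const_mul]
        unfold branchSum
        rw [intervalIntegral.integral_add (i0.add i2) i1, intervalIntegral.integral_add i0 i2,
          mul_assoc, add_mul, add_mul]
        gcongr

lemma intervalIntegrable_segment (h₂ : 0 < y₂) (h₁ : y₂ < y₁) {z w : ℂ} (hz : 0 ≤ z.im)
    (hw : 0 ≤ w.im) :
    IntervalIntegrable (fun t : ℝ => c₀ y₁ y₂ / sqrtR y₁ y₂ (z + t * (w - z)) * (w - z))
      volume 0 1 := by
  rcases eq_or_ne z w with rfl | hzw
  · simp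
  obtain ⟨K, -, hK⟩ := exists_segment_bound h₂ h₁
  simpa only [div_eq_mul_inv] using ((hK z w hz hw hzw).1.const_mul _).mul_const _

/-- The length ‖w - z‖ is played against the bound K‖w - z‖^{-1/2}, which leaves Hölder exponent 1/2
even when the segment runs through branch points. -/
lemma norm_segInt_le (h₂ : 0 < y₂) (h₁ : y₂ < y₁) : ∃ K : ℝ, 0 < K ∧ ∀ z w : ℂ,
    0 ≤ z.im → 0 ≤ w.im → ‖segInt y₁ y₂ z w‖ ≤ K * √‖w - z‖ := by
  obtain ⟨K, hK0, hK⟩ := exists_segment_bound h₂ h₁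
  refine ⟨(|c₀ y₁ y₂| + 1) * K, by positivity, fun z w hz hw => ?_⟩
  rcases eq_or_ne z w with rfl | hzw
  · simp [segInt]
  obtain ⟨hi, hb⟩ := hK z w hz hw hzw
  have hn : 0 < ‖w - z‖ := norm_pos_iff.2 (sub_ne_zero.2 hzw.symm)
  calc ‖segInt y₁ y₂ z w‖
      = ‖(c₀ y₁ y₂ : ℂ) * (∫ t in (0 : ℝ)..1, (sqrtR y₁ y₂ (z + t * (w - z)))⁻¹) * (w - z)‖ := by
        rw [segInt, ← intervalIntegral.integral_const_mul, ← intervalIntegral.integral_mul_const]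
        simp only [div_eq_mul_inv]
    _ = |c₀ y₁ y₂| * ‖∫ t in (0 : ℝ)..1, (sqrtR y₁ y₂ (z + t * (w - z)))⁻¹‖ * ‖w - z‖ := by
        simp
    _ ≤ (|c₀ y₁ y₂| + 1) * (K * (√‖w - z‖)⁻¹) * ‖w - z‖ := by
        gcongr
        · linarith
        · exact (intervalIntegral.norm_integral_le_integral_norm zero_le_one).trans hb
    _ = _ := by
        have : ‖w - z‖ = √‖w - z‖ * √‖w - z‖ := (Real.mul_self_sqrt hn.le).symm
        have h' : √‖w - z‖ ≠ 0 := (Real.sqrt_pos.2 hn).ne'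
        conv_lhs => rw [this]
        rw [Real.sqrt_mul_self (Real.sqrt_nonneg _)]
        field_simp

lemma exists_primitive (h₂ : 0 < y₂) (h₁ : y₂ < y₁) : ∃ f : ℂ → ℂ, ∀ z : ℂ, 0 < z.im →
    HasDerivAt f (c₀ y₁ y₂ / sqrtR y₁ y₂ z) z := by
  have hd : DifferentiableOn ℂ (fun z => c₀ y₁ y₂ / sqrtR y₁ y₂ z) {z | 0 < z.im} := fun z hz =>
    ((differentiableAt_const _).div (differentiableAt_sqrtR h₂ h₁ (mem_cutPlane_of_im_pos hz))
      (sqrtR_ne_zero h₂ h₁ (mem_cutPlane_of_im_pos hz))).differentiableWithinAt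
  obtain ⟨f, hf⟩ := (convex_halfSpace_im_gt 0).exists_forall_hasDerivWithinAt hd
  exact ⟨f, fun z hz => (hf z hz).hasDerivAt
    ((isOpen_lt continuous_const Complex.continuous_im).mem_nhds hz)⟩

lemma norm_le_norm_add_I_mul {z : ℂ} (hz : 0 ≤ z.im) {ε : ℝ} (hε : 0 ≤ ε) : ‖z‖ ≤ ‖z + ε * I‖ := by
  rw [Complex.norm_eq_sqrt_sq_add_sq, Complex.norm_eq_sqrt_sq_add_sq]
  have : 0 ≤ z.im * ε := mul_nonneg hz hε
  simp only [add_re, add_im, mul_re, mul_im, ofReal_re, ofReal_im, I_re, I_im]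
  gcongr Real.sqrt ?_
  nlinarith

/-- Moving upwards increases the distance to every real branch point. This provides the dominating
function when a segment is pushed off the real line and brought back. -/
lemma norm_inv_sqrtR_add_le {z : ℂ} (hz : 0 ≤ z.im) {ε : ℝ} (hε : 0 ≤ ε)
    (h : sqrtR y₁ y₂ z ≠ 0) :
    ‖(sqrtR y₁ y₂ (z + ε * I))⁻¹‖ ≤ ‖(sqrtR y₁ y₂ z)⁻¹‖ := by
  rw [norm_inv, norm_inv]
  refine inv_anti₀ (norm_pos_iff.2 h) ?_
  rw [norm_sqrtR, norm_sqrtR, show z + ε * I - y₂ = z - y₂ + ε * I by ring,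
    show z + ε * I - y₁ = z - y₁ + ε * I by ring]
  gcongr
  · exact norm_le_norm_add_I_mul hz hε
  · exact norm_le_norm_add_I_mul (by simpa using hz) hε
  · exact norm_le_norm_add_I_mul (by simpa using hz) hε

/-- The primitive lives only on the open half plane, whereas the segment may lie on the real line
and meet branch points. The fundamental theorem is applied to the segment raised by iε, followed by
dominated convergence. -/
lemma tendsto_primitive_sub (h₂ : 0 < y₂) (h₁ : y₂ < y₁) {f : ℂ → ℂ}
    (hf : ∀ z : ℂ, 0 < z.im → HasDerivAt f (c₀ y₁ y₂ / sqrtR y₁ y₂ z) z) {z w : ℂ}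
    (hz : 0 ≤ z.im) (hw : 0 ≤ w.im) :
    Tendsto (fun ε : ℝ => f (w + ε * I) - f (z + ε * I)) (𝓝[>] 0) (𝓝 (segInt y₁ y₂ z w)) := by
  rcases eq_or_ne z w with rfl | hzw
  · simp [segInt]
  have key : ∀ ε : ℝ, 0 < ε → f (w + ε * I) - f (z + ε * I) =
      ∫ t in (0 : ℝ)..1, c₀ y₁ y₂ / sqrtR y₁ y₂ (z + t * (w - z) + ε * I) * (w - z) := by
    intro ε hε
    have him : ∀ t ∈ Set.uIcc (0 : ℝ) 1, 0 < (z + t * (w - z) + ε * I).im := fun t ht => by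
      rw [Set.uIcc_of_le zero_le_one] at ht
      have := segment_im_nonneg hz hw ht
      rw [add_im]
      simp only [mul_im, I_re, I_im, ofReal_re, ofReal_im] at *
      linarith
    have hd : ∀ t ∈ Set.uIcc (0 : ℝ) 1, HasDerivAt (fun t : ℝ => f (z + t * (w - z) + ε * I))
        (c₀ y₁ y₂ / sqrtR y₁ y₂ (z + t * (w - z) + ε * I) * (w - z)) t := fun t ht => by
      have h := (((hasDerivAt_id (t : ℂ)).mul_const (w - z)).const_add z).add_const (ε * I)
      have := ((hf _ (him t ht)).comp (t : ℂ) h).comp_ofReal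
      simpa using this
    rw [intervalIntegral.integral_eq_sub_of_hasDerivAt hd]
    · simp
    · refine ContinuousOn.intervalIntegrable ?_
      refine (continuousOn_const.div ?_ ?_).mul continuousOn_const
      · exact continuousOn_sqrtR.comp (by fun_prop) fun t ht => (him t ht).le
      · exact fun t ht => sqrtR_ne_zero h₂ h₁ (mem_cutPlane_of_im_pos (him t ht))
  have hev : ∀ᶠ ε : ℝ in 𝓝[>] 0, 0 < ε := eventually_mem_nhdsWithin
  refine Tendsto.congr' (hev.mono fun ε hε => (key ε hε).symm) ?_
  have hIcc : ∀ t : ℝ, t ∈ Set.uIoc (0 : ℝ) 1 → t ∈ Set.Icc (0 : ℝ) 1 := fun t ht => by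
    rw [Set.uIoc_of_le zero_le_one] at ht
    exact Set.Ioc_subset_Icc_self ht
  refine intervalIntegral.tendsto_integral_filter_of_dominated_convergence
    (fun t : ℝ => ‖c₀ y₁ y₂ / sqrtR y₁ y₂ (z + t * (w - z)) * (w - z)‖) ?_ ?_ ?_ ?_
  · refine hev.mono fun ε hε => ?_
    have h := aestronglyMeasurable_inv_sqrtR_segment (y₁ := y₁) (y₂ := y₂) (z := z + ε * I)
      (w := w + ε * I) (by simpa using by linarith) (by simpa using by linarith)
    refine (h.const_mul (c₀ y₁ y₂ * (w - z))).congr (ae_of_all _ fun t => ?_)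
    beta_reduce
    rw [show z + ε * I + t * (w + ε * I - (z + ε * I)) = z + t * (w - z) + ε * I by ring]
    ring
  · refine hev.mono fun ε hε => ?_
    filter_upwards [ae_segment_sqrtR_ne_zero (y₁ := y₁) (y₂ := y₂) hzw] with t ht ht'
    rw [norm_mul, norm_mul, div_eq_mul_inv, div_eq_mul_inv, norm_mul, norm_mul]
    gcongr
    exact norm_inv_sqrtR_add_le (segment_im_nonneg hz hw (hIcc t ht')) hε.le ht
  · exact (intervalIntegrable_segment h₂ h₁ hz hw).norm
  · filter_upwards [ae_segment_sqrtR_ne_zero (y₁ := y₁) (y₂ := y₂) hzw] with t ht ht'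
    refine Tendsto.mul_const _ (Tendsto.div tendsto_const_nhds ?_ ht)
    refine Tendsto.comp (continuousOn_sqrtR _ (segment_im_nonneg hz hw (hIcc t ht'))) ?_
    refine tendsto_nhdsWithin_iff.2 ⟨?_, hev.mono fun ε hε => ?_⟩
    · refine Tendsto.mono_left ?_ nhdsWithin_le_nhds
      have : Continuous fun ε : ℝ => z + t * (w - z) + ε * I := by fun_prop
      simpa using this.tendsto 0
    · have := segment_im_nonneg hz hw (hIcc t ht')
      show 0 ≤ (z + t * (w - z) + ε * I).im
      rw [add_im]
      simp only [mul_im, I_re, I_im, ofReal_re, ofReal_im] at *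
      linarith

/-- Path independence in the closed upper half plane. -/
lemma abelInt_sub (h₂ : 0 < y₂) (h₁ : y₂ < y₁) {z w : ℂ} (hz : 0 ≤ z.im) (hw : 0 ≤ w.im) :
    abelInt y₁ y₂ w - abelInt y₁ y₂ z = segInt y₁ y₂ z w := by
  obtain ⟨f, hf⟩ := exists_primitive h₂ h₁
  have h := (tendsto_primitive_sub h₂ h₁ hf (z := y₁) (by simp) hw).sub
    (tendsto_primitive_sub h₂ h₁ hf (z := y₁) (by simp) hz)
  refine tendsto_nhds_unique h ((tendsto_primitive_sub h₂ h₁ hf hz hw).congr fun ε => ?_)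
  ring

lemma norm_abelInt_sub_le (h₂ : 0 < y₂) (h₁ : y₂ < y₁) : ∃ K : ℝ, 0 < K ∧ ∀ z w : ℂ,
    0 ≤ z.im → 0 ≤ w.im → ‖abelInt y₁ y₂ w - abelInt y₁ y₂ z‖ ≤ K * √‖w - z‖ := by
  obtain ⟨K, hK, h⟩ := norm_segInt_le h₂ h₁
  exact ⟨K, hK, fun z w hz hw => by rw [abelInt_sub h₂ h₁ hz hw]; exact h z w hz hw⟩

lemma continuousOn_abelInt (h₂ : 0 < y₂) (h₁ : y₂ < y₁) :
    ContinuousOn (abelInt y₁ y₂) {z | 0 ≤ z.im} := by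
  obtain ⟨K, hK, h⟩ := norm_abelInt_sub_le h₂ h₁
  intro z hz
  rw [ContinuousWithinAt, tendsto_iff_norm_sub_tendsto_zero]
  have hlim : Tendsto (fun w => K * √‖w - z‖) (𝓝[{z | 0 ≤ z.im}] z) (𝓝 0) := by
    have : Continuous fun w => K * √‖w - z‖ := by fun_prop
    have := this.tendsto z
    simp only [sub_self, norm_zero, Real.sqrt_zero, mul_zero] at this
    exact this.mono_left nhdsWithin_le_nhds
  exact squeeze_zero' (Eventually.of_forall fun _ => norm_nonneg _)
    (eventually_mem_nhdsWithin.mono fun w hw => h z w hz hw) hlim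

lemma hasDerivAt_abelInt (h₂ : 0 < y₂) (h₁ : y₂ < y₁) {z : ℂ} (hz : 0 < z.im) :
    HasDerivAt (abelInt y₁ y₂) (c₀ y₁ y₂ / sqrtR y₁ y₂ z) z := by
  obtain ⟨f, hf⟩ := exists_primitive h₂ h₁
  have hlim : ∀ w : ℂ, 0 < w.im → Tendsto (fun ε : ℝ => f (w + ε * I)) (𝓝[>] 0) (𝓝 (f w)) := by
    intro w hw
    refine Tendsto.comp (hf w hw).continuousAt (Tendsto.mono_left ?_ nhdsWithin_le_nhds)
    have : Continuous fun ε : ℝ => w + ε * I := by fun_prop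
    simpa using this.tendsto 0
  have heq : ∀ w : ℂ, 0 < w.im → abelInt y₁ y₂ w = f w - f z + abelInt y₁ y₂ z := by
    intro w hw
    have := tendsto_nhds_unique (tendsto_primitive_sub h₂ h₁ hf hz.le hw.le)
      ((hlim w hw).sub (hlim z hz))
    rw [← this, ← abelInt_sub h₂ h₁ hz.le hw.le]
    ring
  refine (((hf z hz).sub_const (f z)).add_const (abelInt y₁ y₂ z)).congr_of_eventuallyEq ?_
  filter_upwards [(isOpen_lt continuous_const Complex.continuous_im).mem_nhds hz] with w hw
  exact heq w hw

/-! ### Boundary values on the real line -/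

/-- The density `c₀ / √|R(x)|` on the real line. -/
noncomputable def weight (y₁ y₂ x : ℝ) : ℝ := c₀ y₁ y₂ / √|realR y₁ y₂ x|

lemma norm_sqrtR_ofReal (x : ℝ) : ‖sqrtR y₁ y₂ x‖ = √|realR y₁ y₂ x| := by
  rw [norm_sqrtR, realR, abs_mul, abs_mul, Real.sqrt_mul (by positivity),
    Real.sqrt_mul (by positivity)]
  simp only [← ofReal_sub, norm_real, Real.norm_eq_abs]

lemma intervalIntegrable_inv_sqrtR (h₂ : 0 < y₂) (h₁ : y₂ < y₁) (a b : ℝ) :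
    IntervalIntegrable (fun x : ℝ => (sqrtR y₁ y₂ x)⁻¹) volume a b := by
  rcases eq_or_ne a b with rfl | hab
  · simp
  obtain ⟨K, -, hK⟩ := exists_segment_bound h₂ h₁
  have h := (hK a b (by simp) (by simp) (by exact_mod_cast hab)).1
  have hne : b - a ≠ 0 := sub_ne_zero.2 hab.symm
  have h' := (h.comp_mul_right (c := (b - a)⁻¹) ).comp_sub_right a
  have e0 : 0 / (b - a)⁻¹ + a = a := by simp
  have e1 : 1 / (b - a)⁻¹ + a = b := by simp
  rw [e0, e1] at h'
  refine h'.congr (fun x _ => ?_)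
  have hne' : (b : ℂ) - a ≠ 0 := by exact_mod_cast hne
  simp only [ofReal_mul, ofReal_sub, ofReal_inv]
  congr 2
  field_simp
  ring

lemma intervalIntegrable_inv_sqrt_realR (h₂ : 0 < y₂) (h₁ : y₂ < y₁) (a b : ℝ) :
    IntervalIntegrable (fun x : ℝ => (√|realR y₁ y₂ x|)⁻¹) volume a b := by
  refine (intervalIntegrable_inv_sqrtR h₂ h₁ a b).norm.congr fun x _ => ?_
  simp only [norm_inv, norm_sqrtR_ofReal]

lemma intervalIntegrable_weight (h₂ : 0 < y₂) (h₁ : y₂ < y₁) (a b : ℝ) :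
    IntervalIntegrable (weight y₁ y₂) volume a b :=
  (intervalIntegrable_inv_sqrt_realR h₂ h₁ a b).const_mul _

lemma sqrt_abs_realR_pos {x : ℝ} (h0 : x ≠ 0) (h2 : x ≠ y₂) (h1 : x ≠ y₁) :
    0 < √|realR y₁ y₂ x| := by
  rw [Real.sqrt_pos, abs_pos, realR]
  exact mul_ne_zero (mul_ne_zero h0 (sub_ne_zero.2 h2)) (sub_ne_zero.2 h1)

lemma integral_inv_sqrt_pos (h₂ : 0 < y₂) (h₁ : y₂ < y₁) {a b : ℝ} (hab : a < b)
    (h : ∀ x ∈ Set.Ioo a b, x ≠ 0 ∧ x ≠ y₂ ∧ x ≠ y₁) :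
    0 < ∫ x in a..b, (√|realR y₁ y₂ x|)⁻¹ :=
  intervalIntegral.intervalIntegral_pos_of_pos_on (intervalIntegrable_inv_sqrt_realR h₂ h₁ a b)
    (fun _ hx => inv_pos.2 (sqrt_abs_realR_pos (h _ hx).1 (h _ hx).2.1 (h _ hx).2.2)) hab

lemma integral_weight (a b : ℝ) : ∫ x in a..b, weight y₁ y₂ x =
    c₀ y₁ y₂ * ∫ x in a..b, (√|realR y₁ y₂ x|)⁻¹ := by
  simp only [weight, div_eq_mul_inv, intervalIntegral.integral_const_mul]

lemma c₀_eq : c₀ y₁ y₂ = (2 * ∫ x in (0 : ℝ)..y₂, (√|realR y₁ y₂ x|)⁻¹)⁻¹ := by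
  simp only [c₀, div_eq_mul_inv, intervalIntegral.integral_const_mul]

lemma integral_inv_sqrt_zero_y₂_pos (h₂ : 0 < y₂) (h₁ : y₂ < y₁) :
    0 < ∫ x in (0 : ℝ)..y₂, (√|realR y₁ y₂ x|)⁻¹ :=
  integral_inv_sqrt_pos h₂ h₁ h₂ fun _ hx => ⟨hx.1.ne', hx.2.ne, (hx.2.trans h₁).ne⟩

lemma c₀_pos (h₂ : 0 < y₂) (h₁ : y₂ < y₁) : 0 < c₀ y₁ y₂ := by
  have := integral_inv_sqrt_zero_y₂_pos h₂ h₁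
  rw [c₀_eq]
  positivity

/-- The cycle A covers [0, y₂] twice, which explains the factor 2 in `c₀`; one passage contributes
half a period. -/
lemma integral_weight_zero_y₂ (h₂ : 0 < y₂) (h₁ : y₂ < y₁) :
    ∫ x in (0 : ℝ)..y₂, weight y₁ y₂ x = 1 / 2 := by
  have := integral_inv_sqrt_zero_y₂_pos h₂ h₁
  rw [integral_weight, c₀_eq, mul_inv, mul_assoc, inv_mul_cancel₀ this.ne']
  norm_num

lemma integral_weight_pos (h₂ : 0 < y₂) (h₁ : y₂ < y₁) {a b : ℝ} (hab : a < b)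
    (h : ∀ x ∈ Set.Ioo a b, x ≠ 0 ∧ x ≠ y₂ ∧ x ≠ y₁) : 0 < ∫ x in a..b, weight y₁ y₂ x := by
  rw [integral_weight]
  exact mul_pos (c₀_pos h₂ h₁) (integral_inv_sqrt_pos h₂ h₁ hab h)

lemma tau_eq : tau y₁ y₂ = I * ((2 * ∫ x in y₂..y₁, weight y₁ y₂ x : ℝ) : ℂ) := by
  simp only [tau, weight, ← intervalIntegral.integral_const_mul, mul_div_assoc]

lemma tau_re : (tau y₁ y₂).re = 0 := by rw [tau_eq]; simp

lemma tau_im : (tau y₁ y₂).im = 2 * ∫ x in y₂..y₁, weight y₁ y₂ x := by rw [tau_eq]; simp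

lemma tau_im_pos (h₂ : 0 < y₂) (h₁ : y₂ < y₁) : 0 < (tau y₁ y₂).im := by
  rw [tau_im]
  have := integral_weight_pos h₂ h₁ h₁ fun x hx =>
    ⟨(h₂.trans hx.1).ne', hx.1.ne', hx.2.ne⟩
  positivity

lemma tau_eq_I_mul : tau y₁ y₂ = I * ((tau y₁ y₂).im : ℂ) := by
  rw [tau_im, ← tau_eq]

lemma segInt_ofReal (a b : ℝ) :
    segInt y₁ y₂ a b = ∫ x in a..b, c₀ y₁ y₂ / sqrtR y₁ y₂ (x : ℝ) := by
  have := intervalIntegral.smul_integral_comp_add_mul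
    (fun x : ℝ => c₀ y₁ y₂ / sqrtR y₁ y₂ (x : ℝ)) (a := 0) (b := 1) (b - a) a
  simp only [mul_zero, add_zero, mul_one, add_sub_cancel] at this
  rw [← this, segInt, intervalIntegral.integral_mul_const, mul_comm, real_smul]
  push_cast
  simp only [mul_comm]

/-- Here κ⁻¹ is the constant phase of √R between two neighbouring branch points, and κ is the
direction in which φ moves as x increases. -/
lemma segInt_of_sqrtR_eq {a b : ℝ} (hab : a ≤ b) {κ : ℂ}
    (h : ∀ x ∈ Set.Icc a b, sqrtR y₁ y₂ x = κ⁻¹ * (√|realR y₁ y₂ x| : ℝ)) :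
    segInt y₁ y₂ a b = κ * (∫ x in a..b, weight y₁ y₂ x : ℝ) := by
  rw [segInt_ofReal, ← intervalIntegral.integral_ofReal, ← intervalIntegral.integral_const_mul]
  refine intervalIntegral.integral_congr fun x hx => ?_
  rw [Set.uIcc_of_le hab] at hx
  simp only [h x hx, weight]
  push_cast
  rw [div_mul_eq_div_div, div_inv_eq_mul]
  ring

lemma sqrt_abs_realR (x : ℝ) : √|realR y₁ y₂ x| = √|x| * √|x - y₂| * √|x - y₁| := by
  rw [realR, abs_mul, abs_mul, Real.sqrt_mul (by positivity), Real.sqrt_mul (by positivity)]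

lemma csqrt_ofReal_sub_of_nonneg {x a : ℝ} (hx : a ≤ x) :
    ((x : ℂ) - a) ^ (1 / 2 : ℂ) = (√|x - a| : ℝ) := by
  rw [← ofReal_sub, csqrt_ofReal_of_nonneg (sub_nonneg.2 hx), abs_of_nonneg (sub_nonneg.2 hx)]

lemma csqrt_ofReal_sub_of_nonpos {x a : ℝ} (hx : x ≤ a) :
    ((x : ℂ) - a) ^ (1 / 2 : ℂ) = I * (√|x - a| : ℝ) := by
  rw [← ofReal_sub, csqrt_ofReal_of_nonpos (sub_nonpos.2 hx)]

/-- From right to left, each branch point passed from above turns one more factor into i times its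
modulus, so the phases on the four intervals are 1, i, -1, -i. -/
lemma sqrtR_of_ge (h₂ : 0 < y₂) (h₁ : y₂ < y₁) {x : ℝ} (hx : y₁ ≤ x) :
    sqrtR y₁ y₂ x = (√|realR y₁ y₂ x| : ℝ) := by
  rw [sqrtR, csqrt_ofReal_of_nonneg (by linarith), csqrt_ofReal_sub_of_nonneg (by linarith),
    csqrt_ofReal_sub_of_nonneg hx, sqrt_abs_realR, abs_of_nonneg (show 0 ≤ x by linarith)]
  push_cast; ring

lemma sqrtR_of_mid (h₂ : 0 < y₂) {x : ℝ} (hx : y₂ ≤ x) (hx' : x ≤ y₁) :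
    sqrtR y₁ y₂ x = I * (√|realR y₁ y₂ x| : ℝ) := by
  rw [sqrtR, csqrt_ofReal_of_nonneg (by linarith), csqrt_ofReal_sub_of_nonneg (by linarith),
    csqrt_ofReal_sub_of_nonpos hx', sqrt_abs_realR, abs_of_nonneg (show 0 ≤ x by linarith)]
  push_cast; ring

lemma sqrtR_of_low (h₁ : y₂ < y₁) {x : ℝ} (hx : 0 ≤ x) (hx' : x ≤ y₂) :
    sqrtR y₁ y₂ x = -(√|realR y₁ y₂ x| : ℝ) := by
  rw [sqrtR, csqrt_ofReal_of_nonneg hx, csqrt_ofReal_sub_of_nonpos hx',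
    csqrt_ofReal_sub_of_nonpos (by linarith), sqrt_abs_realR, abs_of_nonneg hx]
  push_cast
  linear_combination ((√x : ℝ) : ℂ) * (√|x - y₂| : ℝ) * (√|x - y₁| : ℝ) * I_sq

lemma sqrtR_of_neg (h₂ : 0 < y₂) (h₁ : y₂ < y₁) {x : ℝ} (hx : x ≤ 0) :
    sqrtR y₁ y₂ x = -I * (√|realR y₁ y₂ x| : ℝ) := by
  rw [sqrtR, csqrt_ofReal_of_nonpos hx, csqrt_ofReal_sub_of_nonpos (by linarith),
    csqrt_ofReal_sub_of_nonpos (by linarith), sqrt_abs_realR]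
  push_cast
  linear_combination I * ((√|x| : ℝ) : ℂ) * (√|x - y₂| : ℝ) * (√|x - y₁| : ℝ) * I_sq

lemma abelInt_y₁ : abelInt y₁ y₂ y₁ = 0 := by simp [abelInt, segInt]

lemma abelInt_of_ge (h₂ : 0 < y₂) (h₁ : y₂ < y₁) {x : ℝ} (hx : y₁ ≤ x) :
    abelInt y₁ y₂ x = (∫ s in y₁..x, weight y₁ y₂ s : ℝ) := by
  rw [abelInt, segInt_of_sqrtR_eq (κ := 1) hx, one_mul]
  intro s hs
  rw [sqrtR_of_ge h₂ h₁ hs.1]; simp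

lemma abelInt_of_mid (h₂ : 0 < y₂) (h₁ : y₂ < y₁) {x : ℝ} (hx : y₂ ≤ x) (hx' : x ≤ y₁) :
    abelInt y₁ y₂ x = I * (∫ s in x..y₁, weight y₁ y₂ s : ℝ) := by
  have h := abelInt_sub h₂ h₁ (z := x) (w := y₁) (by simp) (by simp)
  rw [segInt_of_sqrtR_eq hx' (κ := -I), abelInt_y₁] at h
  · linear_combination -h
  · intro s hs
    rw [sqrtR_of_mid h₂ (hx.trans hs.1) hs.2]; simp

lemma abelInt_y₂ (h₂ : 0 < y₂) (h₁ : y₂ < y₁) : abelInt y₁ y₂ y₂ = tau y₁ y₂ / 2 := by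
  rw [abelInt_of_mid h₂ h₁ le_rfl h₁.le, tau_eq]
  push_cast; ring

lemma abelInt_of_low (h₂ : 0 < y₂) (h₁ : y₂ < y₁) {x : ℝ} (hx : 0 ≤ x) (hx' : x ≤ y₂) :
    abelInt y₁ y₂ x = tau y₁ y₂ / 2 + (∫ s in x..y₂, weight y₁ y₂ s : ℝ) := by
  have h := abelInt_sub h₂ h₁ (z := x) (w := y₂) (by simp) (by simp)
  rw [segInt_of_sqrtR_eq hx' (κ := -1), abelInt_y₂ h₂ h₁] at h
  · linear_combination -h
  · intro s hs
    rw [sqrtR_of_low h₁ (hx.trans hs.1) hs.2]; norm_num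

lemma abelInt_zero (h₂ : 0 < y₂) (h₁ : y₂ < y₁) : abelInt y₁ y₂ 0 = 1 / 2 + tau y₁ y₂ / 2 := by
  have := abelInt_of_low h₂ h₁ le_rfl h₂.le
  rw [integral_weight_zero_y₂ h₂ h₁] at this
  push_cast at this
  rw [this, add_comm]

/-- This is the last side of the rectangle: the real part stays at exactly 1/2, which serves as the
fixed endpoint value for the arcs below. -/
lemma abelInt_of_neg (h₂ : 0 < y₂) (h₁ : y₂ < y₁) {x : ℝ} (hx : x ≤ 0) :
    abelInt y₁ y₂ x = 1 / 2 + tau y₁ y₂ / 2 - I * (∫ s in x..0, weight y₁ y₂ s : ℝ) := by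
  have h := abelInt_sub h₂ h₁ (z := x) (w := (0 : ℝ)) (by simp) (by simp)
  rw [segInt_of_sqrtR_eq hx (κ := I), ofReal_zero, abelInt_zero h₂ h₁] at h
  · linear_combination -h
  · intro s hs
    rw [sqrtR_of_neg h₂ h₁ hs.2]; simp

/-! ### Monotonicity along circular arcs -/

/-- Up to the factor c₀ this is the angular derivative of φ. With p, q, r the roots of z, z - y₂, z
- y₁, it has the argument of i p q̄ r̄. All three lie in the open first quadrant and arg p < arg q,
so p q̄ and r̄ have arguments in (-π/2, 0), and multiplication by i brings the product into the
right half plane. -/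
lemma re_I_mul_div_sqrtR_pos (h₂ : 0 < y₂) {z : ℂ} (hz : 0 < z.im) :
    0 < (I * z / sqrtR y₁ y₂ z).re := by
  have hz' (a : ℝ) : 0 < (z - a).im := by simpa using hz
  set p := z ^ (1 / 2 : ℂ) with hp
  set q := (z - y₂) ^ (1 / 2 : ℂ) with hq
  set r := (z - y₁) ^ (1 / 2 : ℂ) with hr
  have hpp : p ^ 2 = z := csqrt_sq z
  have hqq : q ^ 2 = z - y₂ := csqrt_sq _
  have p1 : 0 < p.re := csqrt_re_pos hz
  have p2 : 0 < p.im := csqrt_im_pos hz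
  have q1 : 0 < q.re := csqrt_re_pos (hz' _)
  have q2 : 0 < q.im := csqrt_im_pos (hz' _)
  have r1 : 0 < r.re := csqrt_re_pos (hz' _)
  have r2 : 0 < r.im := csqrt_im_pos (hz' _)
  have hpn : p ≠ 0 := fun h => by simp [h] at p1
  have hqn : q ≠ 0 := fun h => by simp [h] at q1
  have hrn : r ≠ 0 := fun h => by simp [h] at r1
  -- z and z - y₂ share their imaginary part and differ in real part by y₂ > 0; in terms of p and q
  -- this gives the comparison of arguments.
  have e1 : p.re * p.im = q.re * q.im := by
    have a1 := congrArg Complex.im hpp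
    have a2 := congrArg Complex.im hqq
    simp [sq] at a1 a2
    linarith
  have e2 : q.re ^ 2 - q.im ^ 2 < p.re ^ 2 - p.im ^ 2 := by
    have a1 := congrArg Complex.re hpp
    have a2 := congrArg Complex.re hqq
    simp [sq] at a1 a2
    nlinarith
  have e3 : q.re < p.re := by
    by_contra! h
    have : p.im ≥ q.im := by
      by_contra! h'
      nlinarith [mul_lt_mul'' h' (lt_of_le_of_ne h fun hh => by
        rw [hh] at e1; exact h'.ne (mul_left_cancel₀ q1.ne' e1)) p2.le p1.le]
    nlinarith
  have e4 : p.im < q.im := by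
    by_contra! h
    nlinarith
  have hrew : I * z / sqrtR y₁ y₂ z = I * p * (starRingEnd ℂ q * starRingEnd ℂ r) *
      ((normSq q * normSq r : ℝ) : ℂ)⁻¹ := by
    have n1 : (normSq q : ℂ) = starRingEnd ℂ q * q := normSq_eq_conj_mul_self
    have n2 : (normSq r : ℂ) = starRingEnd ℂ r * r := normSq_eq_conj_mul_self
    have hq' : starRingEnd ℂ q ≠ 0 := by simpa using hqn
    have hr' : starRingEnd ℂ r ≠ 0 := by simpa using hrn
    rw [sqrtR, ← hp, ← hq, ← hr, ofReal_mul, n1, n2, ← hpp]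
    field_simp
  rw [hrew, ← ofReal_inv, re_mul_ofReal]
  refine mul_pos ?_ (inv_pos.2 (mul_pos (normSq_pos.2 hqn) (normSq_pos.2 hrn)))
  simp only [mul_re, mul_im, I_re, I_im, conj_re, conj_im]
  have f1 : 0 < p.re * q.re + p.im * q.im := by positivity
  have f2 : 0 < p.re * q.im - p.im * q.re := by nlinarith
  nlinarith [mul_pos f1 r2, mul_pos f2 r1]

/-- The point `r e^{iθ}`. -/
noncomputable def arc (r θ : ℝ) : ℂ := r * exp (θ * I)

lemma arc_im (r θ : ℝ) : (arc r θ).im = r * Real.sin θ := by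
  rw [arc, im_ofReal_mul, exp_ofReal_mul_I_im]

lemma arc_zero (r : ℝ) : arc r 0 = r := by simp [arc]

lemma arc_pi (r : ℝ) : arc r π = ((-r : ℝ) : ℂ) := by simp [arc]

lemma norm_arc {r : ℝ} (hr : 0 ≤ r) (θ : ℝ) : ‖arc r θ‖ = r := by
  rw [arc, norm_mul, norm_exp_ofReal_mul_I, norm_real, Real.norm_of_nonneg hr, mul_one]

lemma arc_im_nonneg {r θ : ℝ} (hr : 0 ≤ r) (hθ : θ ∈ Set.Icc 0 π) : 0 ≤ (arc r θ).im := by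
  rw [arc_im]; exact mul_nonneg hr (Real.sin_nonneg_of_mem_Icc hθ)

lemma arc_im_pos {r θ : ℝ} (hr : 0 < r) (hθ : θ ∈ Set.Ioo 0 π) : 0 < (arc r θ).im := by
  rw [arc_im]; exact mul_pos hr (Real.sin_pos_of_mem_Ioo hθ)

lemma arc_norm_arg (z : ℂ) : arc ‖z‖ z.arg = z := norm_mul_exp_arg_mul_I z

lemma continuousOn_abelInt_arc (h₂ : 0 < y₂) (h₁ : y₂ < y₁) {r : ℝ} (hr : 0 ≤ r) :
    ContinuousOn (fun θ => abelInt y₁ y₂ (arc r θ)) (Set.Icc 0 π) :=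
  (continuousOn_abelInt h₂ h₁).comp (by unfold arc; fun_prop) fun _ hθ => arc_im_nonneg hr hθ

lemma hasDerivAt_abelInt_arc (h₂ : 0 < y₂) (h₁ : y₂ < y₁) {r θ : ℝ} (hr : 0 < r)
    (hθ : θ ∈ Set.Ioo 0 π) : HasDerivAt (fun θ => abelInt y₁ y₂ (arc r θ))
      (c₀ y₁ y₂ * (I * arc r θ / sqrtR y₁ y₂ (arc r θ))) θ := by
  have h : HasDerivAt (arc r) (I * arc r θ) θ := by
    have h0 : HasDerivAt (fun θ : ℝ => (θ : ℂ) * I) I θ := by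
      simpa using (hasDerivAt_id (θ : ℂ)).comp_ofReal.mul_const I
    exact (h0.cexp.const_mul (r : ℂ)).congr_deriv (by unfold arc; ring)
  refine ((hasDerivAt_abelInt h₂ h₁ (arc_im_pos hr hθ)).comp θ h).congr_deriv ?_
  ring

lemma strictMonoOn_re_abelInt_arc (h₂ : 0 < y₂) (h₁ : y₂ < y₁) {r : ℝ} (hr : 0 < r) :
    StrictMonoOn (fun θ => (abelInt y₁ y₂ (arc r θ)).re) (Set.Icc 0 π) := by
  refine strictMonoOn_of_deriv_pos (convex_Icc 0 π)
    (Complex.continuous_re.comp_continuousOn (continuousOn_abelInt_arc h₂ h₁ hr.le)) ?_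
  intro θ hθ
  rw [interior_Icc] at hθ
  have := (reCLM.hasFDerivAt.comp_hasDerivAt θ (hasDerivAt_abelInt_arc h₂ h₁ hr hθ)).deriv
  simp only [Function.comp_def, reCLM_apply] at this
  rw [this, re_ofReal_mul]
  exact mul_pos (c₀_pos h₂ h₁) (re_I_mul_div_sqrtR_pos h₂ (arc_im_pos hr hθ))

lemma re_abelInt_of_nonpos (h₂ : 0 < y₂) (h₁ : y₂ < y₁) {x : ℝ} (hx : x ≤ 0) :
    (abelInt y₁ y₂ x).re = 1 / 2 := by
  rw [abelInt_of_neg h₂ h₁ hx]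
  simp [tau_re]

lemma re_abelInt_nonneg (h₂ : 0 < y₂) (h₁ : y₂ < y₁) {x : ℝ} (hx : 0 ≤ x) :
    0 ≤ (abelInt y₁ y₂ x).re := by
  have hc := c₀_pos h₂ h₁
  have hw (s : ℝ) : 0 ≤ weight y₁ y₂ s := div_nonneg hc.le (Real.sqrt_nonneg _)
  rcases le_total y₁ x with h | h
  · rw [abelInt_of_ge h₂ h₁ h, ofReal_re]
    exact intervalIntegral.integral_nonneg h fun s _ => hw s
  rcases le_total y₂ x with h' | h'
  · rw [abelInt_of_mid h₂ h₁ h' h]; simp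
  · rw [abelInt_of_low h₂ h₁ hx h', add_re, ofReal_re]
    have := intervalIntegral.integral_nonneg (μ := volume) h' fun s _ => hw s
    simpa [tau_re] using this

lemma arg_mem_Ioo {z : ℂ} (hz : 0 < z.im) : z.arg ∈ Set.Ioo 0 π := by
  have h0 := Complex.arg_nonneg_iff.2 hz.le
  refine ⟨lt_of_le_of_ne h0 fun h => ?_, lt_of_le_of_ne (arg_le_pi z) fun h => ?_⟩
  · exact hz.ne' (Complex.arg_eq_zero_iff.1 h.symm).2
  · exact hz.ne' (Complex.arg_eq_pi_iff.1 h).2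

/-- The half circle through z starts at ‖z‖, where Re φ is nonnegative, and ends at -‖z‖, where it
equals 1/2; strict monotonicity keeps the interior values strictly between. -/
lemma re_abelInt_mem_Ioo (h₂ : 0 < y₂) (h₁ : y₂ < y₁) {z : ℂ} (hz : 0 < z.im) :
    (abelInt y₁ y₂ z).re ∈ Set.Ioo 0 (1 / 2) := by
  have hr : 0 < ‖z‖ := norm_pos_iff.2 fun h => by simp [h] at hz
  have hm := strictMonoOn_re_abelInt_arc h₂ h₁ hr
  have ha := arg_mem_Ioo hz
  have l := hm ⟨le_rfl, Real.pi_pos.le⟩ (Set.Ioo_subset_Icc_self ha) ha.1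
  have u := hm (Set.Ioo_subset_Icc_self ha) ⟨Real.pi_pos.le, le_rfl⟩ ha.2
  simp only [arc_norm_arg, arc_zero, arc_pi] at l u
  rw [re_abelInt_of_nonpos h₂ h₁ (x := -‖z‖) (by linarith)] at u
  exact ⟨(re_abelInt_nonneg h₂ h₁ hr.le).trans_lt l, u⟩

lemma re_abelInt_lt (h₂ : 0 < y₂) (h₁ : y₂ < y₁) {x : ℝ} (hx : 0 < x) :
    (abelInt y₁ y₂ x).re < 1 / 2 := by
  have := strictMonoOn_re_abelInt_arc h₂ h₁ hx (Set.left_mem_Icc.2 Real.pi_pos.le)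
    (Set.right_mem_Icc.2 Real.pi_pos.le) Real.pi_pos
  simp only [arc_zero, arc_pi] at this
  rwa [re_abelInt_of_nonpos h₂ h₁ (x := -x) (by linarith)] at this

/-- On the closed upper half plane, `φ` avoids the lattice except at `y₁`. -/
lemma abelInt_mem_region (h₂ : 0 < y₂) (h₁ : y₂ < y₁) {z : ℂ} (hz : 0 ≤ z.im) (hne : z ≠ y₁) :
    (abelInt y₁ y₂ z).re ∈ Set.Ioo 0 1 ∨
    (abelInt y₁ y₂ z).re = 0 ∧ (abelInt y₁ y₂ z).im ∈ Set.Ioo 0 (tau y₁ y₂).im := by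
  rcases hz.lt_or_eq with h | h
  · have := re_abelInt_mem_Ioo h₂ h₁ h
    exact Or.inl ⟨this.1, by linarith [this.2]⟩
  obtain ⟨x, rfl⟩ : ∃ x : ℝ, z = x := ⟨z.re, Complex.ext rfl (by simp [← h])⟩
  have hxne : x ≠ y₁ := by exact_mod_cast hne
  rcases le_or_gt x 0 with h0 | h0
  · left; rw [re_abelInt_of_nonpos h₂ h₁ h0]; norm_num
  rcases lt_or_ge x y₂ with hx2 | hx2
  · left
    refine ⟨?_, (re_abelInt_lt h₂ h₁ h0).trans (by norm_num)⟩
    rw [abelInt_of_low h₂ h₁ h0.le hx2.le]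
    have := integral_weight_pos h₂ h₁ hx2 fun s hs =>
      ⟨(h0.trans hs.1).ne', hs.2.ne, (hs.2.trans h₁).ne⟩
    simpa [tau_re] using this
  rcases hxne.lt_or_gt with hx1 | hx1
  · right
    have hpos := integral_weight_pos h₂ h₁ hx1 fun s hs =>
      ⟨(h0.trans hs.1).ne', (hx2.trans_lt hs.1).ne', hs.2.ne⟩
    -- Im φ(x) is part of the integral over [y₂, y₁], hence at most half of Im τ.
    have hadd := intervalIntegral.integral_add_adjacent_intervals
      (intervalIntegrable_weight h₂ h₁ y₂ x) (intervalIntegrable_weight h₂ h₁ x y₁)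
    have hnn := intervalIntegral.integral_nonneg (μ := volume) hx2 fun s _ =>
      div_nonneg (c₀_pos h₂ h₁).le (Real.sqrt_nonneg |realR y₁ y₂ s|)
    change 0 ≤ ∫ s in y₂..x, weight y₁ y₂ s at hnn
    rw [abelInt_of_mid h₂ h₁ hx2 hx1.le, tau_im]
    simp only [I_mul_re, I_mul_im, ofReal_re, ofReal_im, neg_zero, true_and]
    exact ⟨hpos, by linarith⟩
  · left
    refine ⟨?_, (re_abelInt_lt h₂ h₁ h0).trans (by norm_num)⟩
    rw [abelInt_of_ge h₂ h₁ hx1.le, ofReal_re]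
    exact integral_weight_pos h₂ h₁ hx1 fun s hs =>
      ⟨((h₂.trans h₁).trans hs.1).ne', (h₁.trans hs.1).ne', hs.1.ne'⟩

/-! ### Behaviour at infinity -/

/-- The mean value theorem is a real statement, and differentiability along the arc is known only at
interior angles; real and imaginary parts of φ are therefore treated separately. -/
lemma abs_sub_le_of_abs_deriv_le {h h' : ℝ → ℝ} {B : ℝ} (hc : ContinuousOn h (Set.Icc 0 π))
    (hd : ∀ θ ∈ Set.Ioo 0 π, HasDerivAt h (h' θ) θ) (hB : ∀ θ ∈ Set.Ioo 0 π, |h' θ| ≤ B)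
    {a b : ℝ} (ha : 0 ≤ a) (hab : a ≤ b) (hb : b ≤ π) : |h b - h a| ≤ B * π := by
  have hB0 : 0 ≤ B := (abs_nonneg _).trans (hB (π / 2) ⟨by positivity, by linarith [Real.pi_pos]⟩)
  rcases hab.eq_or_lt with rfl | hab
  · simpa using mul_nonneg hB0 Real.pi_pos.le
  obtain ⟨c, hc', he⟩ := exists_hasDerivAt_eq_slope h h' hab
    (hc.mono (Set.Icc_subset_Icc ha hb))
    fun x hx => hd x ⟨ha.trans_lt hx.1, hx.2.trans_le hb⟩
  have : h b - h a = h' c * (b - a) := by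
    rw [he, div_mul_cancel₀ _ (sub_pos.2 hab).ne']
  rw [this, abs_mul, abs_of_pos (sub_pos.2 hab)]
  gcongr
  · exact hB c ⟨ha.trans_lt hc'.1, hc'.2.trans_le hb⟩
  · linarith

lemma norm_div_sqrtR_le (h₂ : 0 < y₂) (h₁ : y₂ < y₁) {z : ℂ} (hz : 2 * y₁ ≤ ‖z‖) :
    ‖I * z / sqrtR y₁ y₂ z‖ ≤ 2 * (√‖z‖)⁻¹ := by
  have hpos : 0 < ‖z‖ := by linarith
  have hh (a : ℝ) (ha : 0 < a) (ha' : a ≤ y₁) : ‖z‖ / 2 ≤ ‖z - a‖ := by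
    have := norm_sub_norm_le z a
    rw [norm_real, Real.norm_of_nonneg ha.le] at this
    linarith
  rw [norm_div, norm_mul, norm_I, one_mul, norm_sqrtR, mul_assoc, ← Real.sqrt_mul (norm_nonneg _)]
  have h : ‖z‖ / 2 ≤ √(‖z - y₂‖ * ‖z - y₁‖) := by
    apply Real.le_sqrt_of_sq_le
    rw [sq]
    exact mul_le_mul (hh _ h₂ h₁.le) (hh _ (h₂.trans h₁) le_rfl) (by positivity) (norm_nonneg _)
  have hs : 0 < √‖z‖ := Real.sqrt_pos.2 hpos
  calc ‖z‖ / (√‖z‖ * √(‖z - y₂‖ * ‖z - y₁‖)) ≤ ‖z‖ / (√‖z‖ * (‖z‖ / 2)) := by gcongr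
    _ = 2 * (√‖z‖)⁻¹ := by field_simp

/-- `φ(z) = 1/2 + O(|z|^{-1/2})` at infinity. -/
lemma norm_abelInt_sub_half_le (h₂ : 0 < y₂) (h₁ : y₂ < y₁) : ∃ K : ℝ, 0 < K ∧
    ∀ z : ℂ, 0 ≤ z.im → 2 * y₁ ≤ ‖z‖ → ‖abelInt y₁ y₂ z - 1 / 2‖ ≤ K * (√‖z‖)⁻¹ := by
  have hc := c₀_pos h₂ h₁
  refine ⟨2 * (c₀ y₁ y₂ * 2 * π), by positivity, fun z hz hn => ?_⟩
  set r := ‖z‖ with hr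
  have hr0 : 0 < r := by linarith
  set B := c₀ y₁ y₂ * (2 * (√r)⁻¹)
  have hB : ∀ θ : ℝ, ‖c₀ y₁ y₂ * (I * arc r θ / sqrtR y₁ y₂ (arc r θ))‖ ≤ B := by
    intro θ
    rw [norm_mul, norm_real, Real.norm_of_nonneg hc.le]
    have := norm_div_sqrtR_le h₂ h₁ (z := arc r θ) (by rwa [norm_arc hr0.le])
    rw [norm_arc hr0.le] at this
    exact mul_le_mul_of_nonneg_left this hc.le
  have hcont := continuousOn_abelInt_arc h₂ h₁ hr0.le
  have a0 : 0 ≤ z.arg := Complex.arg_nonneg_iff.2 hz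
  have a1 := arg_le_pi z
  -- The real part is compared with angle π, where it equals 1/2, and the imaginary part with angle
  -- 0, where φ is real.
  have ere := abs_sub_le_of_abs_deriv_le (Complex.continuous_re.comp_continuousOn hcont)
    (fun θ hθ => reCLM.hasFDerivAt.comp_hasDerivAt θ (hasDerivAt_abelInt_arc h₂ h₁ hr0 hθ))
    (fun θ _ => (abs_re_le_norm _).trans (hB θ)) a0 a1 le_rfl
  have eim := abs_sub_le_of_abs_deriv_le (Complex.continuous_im.comp_continuousOn hcont)
    (fun θ hθ => imCLM.hasFDerivAt.comp_hasDerivAt θ (hasDerivAt_abelInt_arc h₂ h₁ hr0 hθ))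
    (fun θ _ => (abs_im_le_norm _).trans (hB θ)) le_rfl a0 a1
  simp only [Function.comp_apply, hr, arc_norm_arg, arc_zero, arc_pi] at ere eim
  rw [re_abelInt_of_nonpos h₂ h₁ (x := -‖z‖) (by linarith)] at ere
  rw [abelInt_of_ge h₂ h₁ (by linarith), ofReal_im, sub_zero] at eim
  calc ‖abelInt y₁ y₂ z - 1 / 2‖
      ≤ |(abelInt y₁ y₂ z - 1 / 2).re| + |(abelInt y₁ y₂ z - 1 / 2).im| := norm_le_abs_re_add_abs_im _
    _ ≤ B * π + B * π := by
        refine add_le_add ?_ ?_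
        · rw [abs_sub_comm] at ere
          simpa using ere
        · simpa using eim
    _ = _ := by simp only [B]; ring

/-! ### Behaviour at `y₁` -/

lemma csqrt_real_mul {t : ℝ} (ht : 0 ≤ t) {z : ℂ} (hz : 0 ≤ z.im) :
    ((t : ℂ) * z) ^ (1 / 2 : ℂ) = (√t : ℝ) * z ^ (1 / 2 : ℂ) := by
  have h : 0 ≤ ((t : ℂ) * z).im := by rw [im_ofReal_mul]; positivity
  have hn : ‖(t : ℂ) * z‖ = t * ‖z‖ := by rw [norm_mul, norm_real, Real.norm_of_nonneg ht]
  apply Complex.ext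
  · rw [csqrt_re, re_ofReal_mul, re_ofReal_mul, csqrt_re, hn, ← Real.sqrt_mul ht]
    congr 1; ring
  · rw [csqrt_im h, re_ofReal_mul, im_ofReal_mul, csqrt_im hz, hn, ← Real.sqrt_mul ht]
    congr 1; ring

/-- On the segment from y₁ to z the factor (ζ - y₁)^{1/2} equals √t (z - y₁)^{1/2}. Pulling out the
root of z - y₁ leaves an integral F(z) with limit F(y₁) > 0, and the square of c₀F is the quotient
in question. -/
lemma tendsto_abelInt_sq_div (h₂ : 0 < y₂) (h₁ : y₂ < y₁) : ∃ ℓ : ℝ, 0 < ℓ ∧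
    Tendsto (fun z => abelInt y₁ y₂ z ^ 2 / (z - y₁)) (𝓝[{z | 0 ≤ z.im} \ {(y₁ : ℂ)}] y₁)
      (𝓝 ℓ) := by
  set q : ℂ → ℂ := fun ζ => ζ ^ (1 / 2 : ℂ) * (ζ - y₂) ^ (1 / 2 : ℂ) with hq
  have hy1 : 0 < y₁ := h₂.trans h₁
  have hqc : ContinuousOn q {z | 0 ≤ z.im} := by
    refine continuousOn_csqrt.mul (continuousOn_csqrt.comp (by fun_prop) (fun z hz => ?_))
    simpa using (hz : 0 ≤ z.im)
  set F : ℂ → ℂ := fun z => ∫ t in (0 : ℝ)..1, (q (y₁ + t * (z - y₁)))⁻¹ * ((√t)⁻¹ : ℝ) with hF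
  have hS : ∀ z : ℂ, 0 ≤ z.im → z ≠ y₁ →
      abelInt y₁ y₂ z ^ 2 / (z - y₁) = (c₀ y₁ y₂ * F z) ^ 2 := by
    intro z hz hne
    have hne' : z - y₁ ≠ 0 := sub_ne_zero.2 hne
    have hs : ((z - y₁) ^ (1 / 2 : ℂ)) ^ 2 = z - y₁ := csqrt_sq _
    have hs0 : (z - y₁) ^ (1 / 2 : ℂ) ≠ 0 := fun h => hne' (by rw [← hs, h]; simp)
    have : abelInt y₁ y₂ z = (z - y₁) ^ (1 / 2 : ℂ) * (c₀ y₁ y₂ * F z) := by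
      rw [abelInt, segInt, hF]
      simp only
      rw [← intervalIntegral.integral_const_mul, ← intervalIntegral.integral_const_mul]
      refine intervalIntegral.integral_congr fun t ht => ?_
      rw [Set.uIcc_of_le zero_le_one] at ht
      rw [sqrtR, show (y₁ : ℂ) + t * (z - y₁) - y₁ = t * (z - y₁) by ring,
        csqrt_real_mul ht.1 (by simpa using hz)]
      change _ / (q _ * _) * _ = _
      conv_lhs => rw [← hs]
      rw [div_eq_mul_inv, mul_inv, mul_inv, hs]
      conv_lhs => enter [2]; rw [← hs]
      rw [ofReal_inv]
      field_simp
      rw [hq]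
      ring
    rw [this, mul_pow, hs, mul_div_cancel_left₀ _ hne']
  -- Half the distance from y₁ to the nearer of the other two branch points, so that both stay at
  -- distance at least δ from the δ-ball about y₁.
  set δ : ℝ := min (y₁ - y₂) y₁ / 2 with hδ
  have hδ0 : 0 < δ := by have := lt_min (sub_pos.2 h₁) hy1; positivity
  have hδ2 : 2 * δ ≤ y₁ - y₂ := by have := min_le_left (y₁ - y₂) y₁; linarith
  have hδ1 : 2 * δ ≤ y₁ := by have := min_le_right (y₁ - y₂) y₁; linarith
  have hqb : ∀ ζ : ℂ, ‖ζ - y₁‖ ≤ δ → δ ≤ ‖q ζ‖ := by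
    intro ζ hζ
    have e0 : δ ≤ ‖ζ‖ := by
      have := norm_sub_norm_le (y₁ : ℂ) ((y₁ : ℂ) - ζ)
      rw [norm_real, Real.norm_of_nonneg hy1.le, norm_sub_rev, sub_sub_cancel] at this
      linarith
    have e2 : δ ≤ ‖ζ - y₂‖ := by
      have := norm_sub_norm_le ((y₁ - y₂ : ℝ) : ℂ) ((y₁ : ℂ) - ζ)
      rw [norm_real, Real.norm_of_nonneg (sub_pos.2 h₁).le, norm_sub_rev (y₁ : ℂ),
        show ((y₁ - y₂ : ℝ) : ℂ) - (y₁ - ζ) = ζ - y₂ by push_cast; ring] at this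
      linarith
    rw [hq]
    simp only [norm_mul, norm_csqrt]
    calc δ = √δ * √δ := (Real.mul_self_sqrt hδ0.le).symm
      _ ≤ _ := by gcongr
  have hint : IntervalIntegrable (fun t : ℝ => (√t)⁻¹) volume 0 1 := by
    refine (intervalIntegral.intervalIntegrable_rpow' (r := -(1 / 2)) (by norm_num)).congr
      fun x hx => ?_
    rw [Set.uIoc_of_le zero_le_one] at hx
    rw [Real.rpow_neg hx.1.le, ← Real.sqrt_eq_rpow]
  have hFlim : Tendsto F (𝓝[{z : ℂ | 0 ≤ z.im} \ {(y₁ : ℂ)}] (y₁ : ℂ)) (𝓝 (F y₁)) := by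
    have hnear : ∀ᶠ z : ℂ in 𝓝[{z : ℂ | 0 ≤ z.im} \ {(y₁ : ℂ)}] (y₁ : ℂ),
        0 ≤ z.im ∧ ‖z - y₁‖ ≤ δ := by
      refine (eventually_mem_nhdsWithin.mono fun z hz => hz.1).and
        (Filter.Eventually.filter_mono nhdsWithin_le_nhds ?_)
      filter_upwards [Metric.closedBall_mem_nhds (y₁ : ℂ) hδ0] with z hz
      simpa [dist_eq_norm] using hz
    have hseg : ∀ z : ℂ, 0 ≤ z.im → ‖z - y₁‖ ≤ δ → ∀ t ∈ Set.uIoc (0 : ℝ) 1,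
        0 ≤ ((y₁ : ℂ) + t * (z - y₁)).im ∧ δ ≤ ‖q (y₁ + t * (z - y₁))‖ := by
      intro z hz hzn t ht
      rw [Set.uIoc_of_le zero_le_one] at ht
      refine ⟨segment_im_nonneg (by simp) hz (Set.Ioc_subset_Icc_self ht), hqb _ ?_⟩
      rw [add_sub_cancel_left, norm_mul, norm_real, Real.norm_of_nonneg ht.1.le]
      exact (mul_le_of_le_one_left (norm_nonneg _) ht.2).trans hzn
    refine intervalIntegral.tendsto_integral_filter_of_dominated_convergence
      (fun t => δ⁻¹ * (√t)⁻¹) ?_ ?_ (hint.const_mul _) ?_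
    · refine hnear.mono fun z hz => AEStronglyMeasurable.mul ?_ ?_
      · refine AEMeasurable.aestronglyMeasurable (AEMeasurable.inv ?_)
        refine ContinuousOn.aemeasurable ?_ measurableSet_uIoc
        exact hqc.comp (by fun_prop) fun t ht => (hseg z hz.1 hz.2 t ht).1
      · exact Measurable.aestronglyMeasurable (by fun_prop)
    · refine hnear.mono fun z hz => ae_of_all _ fun t ht => ?_
      have := (hseg z hz.1 hz.2 t ht).2
      rw [norm_mul, norm_inv, norm_real, Real.norm_of_nonneg (by positivity)]
      gcongr
    · refine ae_of_all _ fun t ht => ?_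
      have h0 := hseg y₁ (by simp) (by simpa using hδ0.le) t ht
      refine Tendsto.mul_const _ (Tendsto.inv₀ ?_ fun h => ?_)
      · refine (hqc _ h0.1).tendsto.comp (tendsto_nhdsWithin_iff.2 ⟨?_, ?_⟩)
        · have : Continuous fun z : ℂ => (y₁ : ℂ) + t * (z - y₁) := by fun_prop
          exact (this.tendsto y₁).mono_left nhdsWithin_le_nhds
        · exact hnear.mono fun z hz => (hseg z hz.1 hz.2 t ht).1
      · rw [h, norm_zero] at h0
        linarith [h0.2]
  have hF1 : F y₁ = (((√y₁ * √(y₁ - y₂))⁻¹ * ∫ t in (0 : ℝ)..1, (√t)⁻¹ : ℝ) : ℂ) := by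
    rw [hF, ofReal_mul, ← intervalIntegral.integral_ofReal, ← intervalIntegral.integral_const_mul]
    have : q y₁ = ((√y₁ * √(y₁ - y₂) : ℝ) : ℂ) := by
      simp only [hq]
      rw [csqrt_ofReal_of_nonneg hy1.le, csqrt_ofReal_sub_of_nonneg h₁.le,
        abs_of_pos (sub_pos.2 h₁)]
      push_cast; ring
    simp only [sub_self, mul_zero, add_zero, this, ofReal_inv]
  have hpos : 0 < ∫ t in (0 : ℝ)..1, (√t)⁻¹ :=
    intervalIntegral.intervalIntegral_pos_of_pos_on hint
      (fun x hx => inv_pos.2 (Real.sqrt_pos.2 hx.1)) one_pos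
  have hc := c₀_pos h₂ h₁
  have hs1 : 0 < √y₁ := Real.sqrt_pos.2 hy1
  have hs2 : 0 < √(y₁ - y₂) := Real.sqrt_pos.2 (sub_pos.2 h₁)
  refine ⟨(c₀ y₁ y₂ * ((√y₁ * √(y₁ - y₂))⁻¹ * ∫ t in (0 : ℝ)..1, (√t)⁻¹)) ^ 2, by positivity, ?_⟩
  have hlim := (hFlim.const_mul (c₀ y₁ y₂ : ℂ)).pow 2
  rw [hF1, ← ofReal_mul, ← ofReal_pow] at hlim
  refine hlim.congr' (eventually_mem_nhdsWithin.mono fun z hz => (hS z hz.1 hz.2).symm)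

/-! ### Theta functions of second order -/

/-- Entire functions with the periodicity of `θ²` which are even and real. -/
structure SecondOrder (τ : ℂ) (N : ℂ → ℂ) : Prop where
  differentiable : Differentiable ℂ N
  add_one : ∀ u, N (u + 1) = N u
  add_tau : ∀ u, N (u + τ) = exp (-2 * π * I * (τ + 2 * u)) * N u
  even : ∀ u, N (-u) = N u
  conj : ∀ u, starRingEnd ℂ (N u) = N (starRingEnd ℂ u)

section Theta

variable {τ : ℂ}

lemma conj_eq_neg_of_re_eq_zero (hre : τ.re = 0) : starRingEnd ℂ τ = -τ :=
  Complex.ext (by simp [hre]) (by simp)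

lemma conj_jacobiTheta₂ (hre : τ.re = 0) (u : ℂ) :
    starRingEnd ℂ (jacobiTheta₂ u τ) = jacobiTheta₂ (starRingEnd ℂ u) τ := by
  rw [jacobiTheta₂_conj, conj_eq_neg_of_re_eq_zero hre, neg_neg]

lemma differentiable_jacobiTheta₂ (hτ : 0 < τ.im) : Differentiable ℂ fun u => jacobiTheta₂ u τ :=
  fun u => differentiableAt_jacobiTheta₂_fst u hτ

lemma jacobiTheta₂_add_half_tau (u : ℂ) :
    jacobiTheta₂ (u + τ / 2) τ = exp (-2 * π * I * u) * jacobiTheta₂ (u - τ / 2) τ := by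
  have := jacobiTheta₂_add_left' (u - τ / 2) τ
  rw [show u - τ / 2 + τ = u + τ / 2 by ring] at this
  rw [this]
  congr 2
  ring

lemma exp_neg_two_pi_sq (u : ℂ) (v : ℂ) :
    exp (-π * I * (τ + 2 * (u + v))) ^ 2 = exp (-2 * π * I * (τ + 2 * u)) * exp (-4 * π * I * v) := by
  rw [sq, ← exp_add, ← exp_add]
  congr 1; ring

/-- `θ(u + h)²` is a second order theta function if `2h` is an integer. -/
lemma secondOrder_sq (hτ : 0 < τ.im) (hre : τ.re = 0) {h : ℝ}
    (hh : ∀ u, jacobiTheta₂ (u - h) τ = jacobiTheta₂ (u + h) τ)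
    (he : exp (-4 * π * I * h) = 1) :
    SecondOrder τ fun u => jacobiTheta₂ (u + h) τ ^ 2 where
  differentiable := ((differentiable_jacobiTheta₂ hτ).comp
    (differentiable_id.add_const _)).pow 2
  add_one u := by rw [add_right_comm, jacobiTheta₂_add_left]
  add_tau u := by rw [add_right_comm, jacobiTheta₂_add_left', mul_pow, exp_neg_two_pi_sq, he, mul_one]
  even u := by
    rw [← jacobiTheta₂_neg_left, neg_add, neg_neg, ← sub_eq_add_neg, hh]
  conj u := by rw [map_pow, conj_jacobiTheta₂ hre, map_add, conj_ofReal]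

/-- `exp (2πiu) θ(u + h + τ/2)²` is a second order theta function if `2h` is an integer. -/
lemma secondOrder_exp_mul_sq (hτ : 0 < τ.im) (hre : τ.re = 0) {h : ℝ}
    (hh : ∀ u, jacobiTheta₂ (u - h) τ = jacobiTheta₂ (u + h) τ)
    (he : exp (-4 * π * I * h) = 1) :
    SecondOrder τ fun u => exp (2 * π * I * u) * jacobiTheta₂ (u + (h + τ / 2)) τ ^ 2 := by
  -- The same function written with -τ/2 in place of τ/2 and the inverse exponential. The maps u ↦
  -- -u and conjugation exchange the two expressions, which gives evenness and reality.
  have hsym : ∀ u, exp (-(2 * π * I * u)) * jacobiTheta₂ (u + (h - τ / 2)) τ ^ 2 =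
      exp (2 * π * I * u) * jacobiTheta₂ (u + (h + τ / 2)) τ ^ 2 := by
    intro u
    rw [← add_assoc, jacobiTheta₂_add_half_tau, mul_pow, ← exp_nat_mul, ← mul_assoc, ← exp_add,
      add_sub_assoc]
    congr 1
    rw [show 2 * π * I * u + (2 : ℕ) * (-2 * π * I * (u + h)) =
      -(2 * π * I * u) + -4 * π * I * h by push_cast; ring, exp_add, he, mul_one]
  refine ⟨?_, fun u => ?_, fun u => ?_, fun u => ?_, fun u => ?_⟩
  · refine Differentiable.mul (by fun_prop) (((differentiable_jacobiTheta₂ hτ).comp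
      (differentiable_id.add_const _)).pow 2)
  · rw [add_right_comm, jacobiTheta₂_add_left, mul_add, exp_add, mul_one, exp_two_pi_mul_I, mul_one]
  · rw [add_right_comm, jacobiTheta₂_add_left', mul_pow, exp_neg_two_pi_sq, ← mul_assoc, ← mul_assoc,
      ← exp_add, ← exp_add, show 2 * π * I * (u + τ) + -2 * π * I * (τ + 2 * u) + -4 * π * I * (h + τ / 2) =
      -2 * π * I * (τ + 2 * u) + 2 * π * I * u + -4 * π * I * h by ring, exp_add, he, mul_one,
      exp_add, mul_assoc]
  · rw [← hsym u, ← jacobiTheta₂_neg_left, show -(-u + (h + τ / 2)) = u - τ / 2 - h by ring, hh,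
      mul_neg, show u - τ / 2 + h = u + (h - τ / 2) by ring]
  · rw [← hsym, map_mul, map_pow, conj_jacobiTheta₂ hre, ← exp_conj, map_add, map_sub, map_div₀,
      conj_eq_neg_of_re_eq_zero hre, conj_ofReal, show starRingEnd ℂ 2 = 2 from conj_ofReal 2]
    simp only [map_neg, map_mul, conj_I, conj_ofReal, show starRingEnd ℂ 2 = 2 from conj_ofReal 2]
    rw [show (h : ℂ) - -τ / 2 = h + τ / 2 by ring]
    congr 2
    ring

lemma jacobiTheta₂_sub_half (u : ℂ) :
    jacobiTheta₂ (u - ((1 / 2 : ℝ) : ℂ)) τ = jacobiTheta₂ (u + ((1 / 2 : ℝ) : ℂ)) τ := by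
  rw [← jacobiTheta₂_add_left]
  congr 1
  push_cast; ring

lemma exp_half_period : exp (-4 * π * I * ((1 / 2 : ℝ) : ℂ)) = 1 := by
  rw [show -4 * π * I * ((1 / 2 : ℝ) : ℂ) = -(2 * π * I) by push_cast; ring, exp_neg,
    exp_two_pi_mul_I, inv_one]

lemma secondOrder_theta_sq (hτ : 0 < τ.im) (hre : τ.re = 0) :
    SecondOrder τ fun u => jacobiTheta₂ u τ ^ 2 := by
  simpa using secondOrder_sq hτ hre (h := 0) (by simp) (by simp)

/-! ### The infinite product -/

/-- The product `∏ₙ (1 - qⁿ w)`, `n ≥ 0`. -/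
noncomputable def qProd (q w : ℂ) : ℂ := ∏' n : ℕ, (1 - q ^ n * w)

variable {q : ℂ}

lemma summable_norm_pow_mul (hq : ‖q‖ < 1) (w : ℂ) : Summable fun n : ℕ => ‖-(q ^ n * w)‖ := by
  simpa using (summable_geometric_of_lt_one (norm_nonneg _) hq).mul_right ‖w‖

lemma multipliable_qProd (hq : ‖q‖ < 1) (w : ℂ) : Multipliable fun n : ℕ => 1 - q ^ n * w := by
  simpa [sub_eq_add_neg] using multipliable_one_add_of_summable (summable_norm_pow_mul hq w)

/-- Splitting off the factor n = 0 gives the functional equation from which all symmetries and zeros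
of σ² are derived. -/
lemma qProd_eq_mul (hq : ‖q‖ < 1) (w : ℂ) : qProd q w = (1 - w) * qProd q (q * w) := by
  have h : ∀ n : ℕ, q ^ n * (q * w) = q ^ (n + 1) * w := fun n => by ring
  have hm : Multipliable fun n : ℕ => 1 - q ^ (n + 1) * w :=
    (multipliable_qProd hq (q * w)).congr fun n => by rw [h]
  have := tprod_eq_zero_mul' (f := fun n : ℕ => 1 - q ^ n * w) hm
  simp only [qProd, h]
  rw [this, pow_zero, one_mul]

lemma qProd_ne_zero (hq : ‖q‖ < 1) {w : ℂ} (hw : ∀ n : ℕ, q ^ n * w ≠ 1) : qProd q w ≠ 0 := by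
  have := tprod_one_add_ne_zero_of_summable (f := fun n : ℕ => -(q ^ n * w))
    (fun n => by rw [← sub_eq_add_neg]; exact sub_ne_zero.2 (hw n).symm) (summable_norm_pow_mul hq w)
  simpa only [qProd, sub_eq_add_neg] using this

lemma differentiable_qProd (hq : ‖q‖ < 1) : Differentiable ℂ (qProd q) := by
  intro w
  have hs : Summable fun n : ℕ => ‖q‖ ^ n * (‖w‖ + 1) :=
    (summable_geometric_of_lt_one (norm_nonneg _) hq).mul_right _
  have h := hs.hasProdLocallyUniformlyOn_nat_one_add (f := fun n x => -(q ^ n * x))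
    (K := Metric.ball (0 : ℂ) (‖w‖ + 1)) Metric.isOpen_ball
    (Eventually.of_forall fun n x hx => by
      rw [norm_neg, norm_mul, norm_pow]
      have : ‖x‖ < ‖w‖ + 1 := by simpa using hx
      gcongr) (fun n => by fun_prop)
  have hd : DifferentiableOn ℂ (fun x => ∏' n : ℕ, (1 + -(q ^ n * x)))
      (Metric.ball (0 : ℂ) (‖w‖ + 1)) :=
    h.differentiableOn (.of_forall fun _ ↦ by fun_prop) Metric.isOpen_ball
  have := hd.differentiableAt (Metric.isOpen_ball.mem_nhds (by simp : w ∈ Metric.ball 0 (‖w‖ + 1)))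
  simp only [← sub_eq_add_neg] at this
  exact this

lemma qProd_conj (hq : ‖q‖ < 1) (hq' : starRingEnd ℂ q = q) (w : ℂ) :
    starRingEnd ℂ (qProd q w) = qProd q (starRingEnd ℂ w) := by
  rw [qProd, (multipliable_qProd hq w).map_tprod (starRingEnd ℂ) continuous_conj, qProd]
  simp [hq']

/-- The even second order theta function with double zeros precisely at the lattice points, as an
infinite product. -/
noncomputable def sigmaSq (τ u : ℂ) : ℂ :=
  exp (-(2 * π * I * u)) * qProd (exp (2 * π * I * τ)) (exp (2 * π * I * u)) ^ 2 *
    qProd (exp (2 * π * I * τ)) (exp (2 * π * I * (τ - u))) ^ 2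

lemma norm_nome_lt_one (hτ : 0 < τ.im) : ‖exp (2 * π * I * τ)‖ < 1 := by
  rw [Complex.norm_exp, Real.exp_lt_one_iff]
  have : (2 * π * I * τ).re = -(2 * π * τ.im) := by simp
  rw [this]
  have := Real.pi_pos
  simp only [neg_lt_zero]
  positivity

lemma exp_two_pi_I_add (a b : ℂ) :
    exp (2 * π * I * (a + b)) = exp (2 * π * I * a) * exp (2 * π * I * b) := by
  rw [mul_add, exp_add]

/-- With x = exp(2πiu), q = exp(2πiτ) and P = `qProd q`, the function is x⁻¹ P(x)² P(q/x)². Using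
P(x) = (1 - x) P(qx), the translation by τ, evenness and reality reduce to (1 - x)² x⁻¹ = (1 - x⁻¹)²
x. -/
lemma secondOrder_sigmaSq (hτ : 0 < τ.im) (hre : τ.re = 0) : SecondOrder τ (sigmaSq τ) := by
  have hq := norm_nome_lt_one hτ
  have hT := differentiable_qProd hq
  have hqc : starRingEnd ℂ (exp (2 * π * I * τ)) = exp (2 * π * I * τ) := by
    rw [← exp_conj]
    simp only [map_mul, conj_I, conj_ofReal, show starRingEnd ℂ 2 = 2 from conj_ofReal 2,
      conj_eq_neg_of_re_eq_zero hre]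
    congr 1; ring
  have step (u : ℂ) : qProd (exp (2 * π * I * τ)) (exp (2 * π * I * u)) =
      (1 - exp (2 * π * I * u)) * qProd (exp (2 * π * I * τ)) (exp (2 * π * I * (τ + u))) := by
    rw [qProd_eq_mul hq, exp_two_pi_I_add]
  have hone (u : ℂ) : exp (2 * π * I * (u + 1)) = exp (2 * π * I * u) := by
    rw [exp_two_pi_I_add, mul_one, exp_two_pi_mul_I, mul_one]
  have hinv (u : ℂ) : exp (-(2 * π * I * u)) * exp (2 * π * I * u) = 1 := by
    rw [← exp_add, neg_add_cancel, exp_zero]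
  refine ⟨?_, fun u => ?_, fun u => ?_, fun u => ?_, fun u => ?_⟩
  · refine Differentiable.mul (Differentiable.mul (by fun_prop) ?_) ?_
    · exact (hT.comp (by fun_prop : Differentiable ℂ fun u : ℂ => exp (2 * π * I * u))).pow 2
    · exact (hT.comp (by fun_prop : Differentiable ℂ fun u : ℂ => exp (2 * π * I * (τ - u)))).pow 2
  · have e : exp (-(2 * π * I * (u + 1))) = exp (-(2 * π * I * u)) := by
      rw [exp_neg, hone, ← exp_neg]
    have e' : exp (2 * π * I * (τ - (u + 1))) = exp (2 * π * I * (τ - u)) := by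
      rw [← hone (τ - (u + 1))]; congr 2; ring
    rw [sigmaSq, sigmaSq, hone, e, e']
  · have h1 := step u
    have h2 := step (-u)
    rw [← sub_eq_add_neg, add_comm τ u] at *
    have e1 : τ - (u + τ) = -u := by ring
    rw [sigmaSq, sigmaSq, e1, h1, h2]
    have e2 : exp (2 * π * I * -u) = exp (-(2 * π * I * u)) := by rw [mul_neg]
    have e3 : exp (-(2 * π * I * (u + τ))) =
        exp (-2 * π * I * (τ + 2 * u)) * exp (2 * π * I * u) := by
      rw [← exp_add]; congr 1; ring
    rw [e2, e3]
    have := hinv u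
    set x := exp (2 * π * I * u)
    set y := exp (-(2 * π * I * u))
    set P := qProd (exp (2 * π * I * τ)) (exp (2 * π * I * (u + τ)))
    set R := qProd (exp (2 * π * I * τ)) (exp (2 * π * I * (τ - u)))
    set E := exp (-2 * π * I * (τ + 2 * u))
    linear_combination (E * P ^ 2 * R ^ 2) * (y - x) * this
  · have h1 := step u
    have h2 := step (-u)
    have e2 : exp (2 * π * I * -u) = exp (-(2 * π * I * u)) := by rw [mul_neg]
    rw [sigmaSq, sigmaSq, h1, h2, sub_neg_eq_add, e2, mul_neg, neg_neg, ← sub_eq_add_neg]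
    have := hinv u
    set x := exp (2 * π * I * u)
    set y := exp (-(2 * π * I * u))
    set P := qProd (exp (2 * π * I * τ)) (exp (2 * π * I * (τ + u)))
    set R := qProd (exp (2 * π * I * τ)) (exp (2 * π * I * (τ - u)))
    linear_combination (P ^ 2 * R ^ 2) * (y - x) * this
  · have ec (v : ℂ) : starRingEnd ℂ (exp (2 * π * I * v)) =
        exp (2 * π * I * (-starRingEnd ℂ v)) := by
      rw [← exp_conj]
      simp only [map_mul, conj_I, conj_ofReal, show starRingEnd ℂ 2 = 2 from conj_ofReal 2]
      congr 1; ring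
    have h1 := step (starRingEnd ℂ u)
    have h2 := step (-starRingEnd ℂ u)
    have e0 : starRingEnd ℂ (exp (-(2 * π * I * u))) = exp (2 * π * I * starRingEnd ℂ u) := by
      rw [← mul_neg, ec, map_neg, neg_neg]
    rw [sigmaSq, sigmaSq, map_mul, map_mul, map_pow, map_pow, qProd_conj hq hqc, qProd_conj hq hqc,
      ec, ec, e0, map_sub, conj_eq_neg_of_re_eq_zero hre,
      show -(-τ - starRingEnd ℂ u) = τ + starRingEnd ℂ u by ring, h1, h2, ← sub_eq_add_neg]
    have e2 : exp (2 * π * I * -starRingEnd ℂ u) = exp (-(2 * π * I * starRingEnd ℂ u)) := by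
      rw [mul_neg]
    rw [e2]
    have := hinv (starRingEnd ℂ u)
    set x := exp (2 * π * I * starRingEnd ℂ u)
    set y := exp (-(2 * π * I * starRingEnd ℂ u))
    set P := qProd (exp (2 * π * I * τ)) (exp (2 * π * I * (τ + starRingEnd ℂ u)))
    set R := qProd (exp (2 * π * I * τ)) (exp (2 * π * I * (τ - starRingEnd ℂ u)))
    linear_combination (P ^ 2 * R ^ 2) * (y - x) * this

lemma exists_of_exp_eq_one {v : ℂ} (h : exp (2 * π * I * v) = 1) : ∃ n : ℤ, v = n := by
  obtain ⟨n, hn⟩ := Complex.exp_eq_one_iff.1 h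
  refine ⟨n, ?_⟩
  have : (2 * π * I : ℂ) ≠ 0 := two_pi_I_ne_zero
  rw [mul_comm] at hn
  exact mul_right_cancel₀ this hn

/-- A convergent product vanishes only through one of its factors. This makes σ² a convenient
denominator: its zeros need no triple product identity and no zero count for the series θ. -/
lemma sigmaSq_ne_zero (hτ : 0 < τ.im) {u : ℂ} (h : ∀ m n : ℤ, u ≠ m + n * τ) :
    sigmaSq τ u ≠ 0 := by
  have hq := norm_nome_lt_one hτ
  refine mul_ne_zero (mul_ne_zero (exp_ne_zero _) (pow_ne_zero _ (qProd_ne_zero hq fun n hn => ?_)))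
    (pow_ne_zero _ (qProd_ne_zero hq fun n hn => ?_))
  · rw [← exp_nat_mul, ← exp_add, show (n : ℂ) * (2 * π * I * τ) + 2 * π * I * u =
      2 * π * I * (n * τ + u) by ring] at hn
    obtain ⟨m, hm⟩ := exists_of_exp_eq_one hn
    exact h m (-n) (by push_cast; linear_combination hm)
  · rw [← exp_nat_mul, ← exp_add, show (n : ℂ) * (2 * π * I * τ) + 2 * π * I * (τ - u) =
      2 * π * I * ((n + 1) * τ - u) by ring] at hn
    obtain ⟨m, hm⟩ := exists_of_exp_eq_one hn
    exact h (-m) (n + 1) (by push_cast; linear_combination -hm)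

lemma sigmaSq_ne_zero_of_region (hτ : 0 < τ.im) (hre : τ.re = 0) {u : ℂ}
    (hu : u.re ∈ Set.Ioo 0 1 ∨ u.re = 0 ∧ u.im ∈ Set.Ioo 0 τ.im) : sigmaSq τ u ≠ 0 := by
  refine sigmaSq_ne_zero hτ fun m n h => ?_
  have e1 : u.re = m := by rw [h]; simp [hre]
  have e2 : u.im = n * τ.im := by rw [h]; simp
  rcases hu with ⟨h0, h1⟩ | ⟨-, h0, h1⟩
  · rw [e1] at h0 h1
    have h0' : 0 < m := by exact_mod_cast h0
    have h1' : m < 1 := by exact_mod_cast h1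
    omega
  · rw [e2] at h0 h1
    have h0' : 0 < n := by exact_mod_cast (pos_of_mul_pos_left h0 hτ.le)
    have h1' : n < 1 := by
      have : (n : ℝ) < 1 := by nlinarith
      exact_mod_cast this
    omega

/-- `σ²(u) / u²` has a nonzero limit at `0`. -/
lemma tendsto_sigmaSq_div_sq (hτ : 0 < τ.im) : ∃ κ : ℂ, κ ≠ 0 ∧
    Tendsto (fun u => sigmaSq τ u / u ^ 2) (𝓝[≠] 0) (𝓝 κ) := by
  have hq := norm_nome_lt_one hτ
  have hT := (differentiable_qProd hq).continuous
  -- σ² with the factor (1 - exp(2πiu))², the only one vanishing at 0, removed.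
  set G : ℂ → ℂ := fun u => exp (-(2 * π * I * u)) *
    qProd (exp (2 * π * I * τ)) (exp (2 * π * I * (τ + u))) ^ 2 *
    qProd (exp (2 * π * I * τ)) (exp (2 * π * I * (τ - u))) ^ 2 with hG
  have hGc : Continuous G := by
    refine Continuous.mul (Continuous.mul (by fun_prop) ?_) ?_
    · exact (hT.comp (by fun_prop : Continuous fun u : ℂ => exp (2 * π * I * (τ + u)))).pow 2
    · exact (hT.comp (by fun_prop : Continuous fun u : ℂ => exp (2 * π * I * (τ - u)))).pow 2
  have hP : qProd (exp (2 * π * I * τ)) (exp (2 * π * I * τ)) ≠ 0 := by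
    refine qProd_ne_zero hq fun n hn => ?_
    rw [← pow_succ] at hn
    have : ‖exp (2 * π * I * τ)‖ ^ (n + 1) = 1 := by rw [← norm_pow, hn, norm_one]
    exact (pow_lt_one₀ (norm_nonneg _) hq n.succ_ne_zero).ne this
  have hder : HasDerivAt (fun u : ℂ => 1 - exp (2 * π * I * u)) (-(2 * π * I)) 0 := by
    have h0 : HasDerivAt (fun u : ℂ => 2 * π * I * u) (2 * π * I) 0 := by
      simpa using (hasDerivAt_id (0 : ℂ)).const_mul (2 * π * I)
    simpa using h0.cexp.const_sub 1
  have hsl := (hasDerivAt_iff_tendsto_slope.1 hder)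
  refine ⟨(-(2 * π * I)) ^ 2 * G 0, ?_, ?_⟩
  · refine mul_ne_zero (pow_ne_zero _ (neg_ne_zero.2 two_pi_I_ne_zero)) ?_
    simp only [hG, add_zero, sub_zero]
    exact mul_ne_zero (mul_ne_zero (exp_ne_zero _) (pow_ne_zero _ hP)) (pow_ne_zero _ hP)
  · refine ((hsl.pow 2).mul ((hGc.tendsto 0).mono_left nhdsWithin_le_nhds)).congr fun u => ?_
    rw [slope_def_field, sigmaSq, qProd_eq_mul hq (exp (2 * π * I * u)), ← exp_two_pi_I_add]
    simp only [hG, mul_zero, exp_zero, sub_self, sub_zero]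
    ring

end Theta

/-! ### A Liouville theorem on the upper half plane -/

/-- If `H` is holomorphic in the upper half plane, real on the real line and bounded near infinity,
then `Im H ≥ 0`. -/
lemma im_nonneg_of_real_of_bounded {H : ℂ → ℂ} (hd : DifferentiableOn ℂ H {z | 0 < z.im})
    (hc : ContinuousOn H {z | 0 ≤ z.im}) (hr : ∀ x : ℝ, (H x).im = 0) {M R : ℝ}
    (hb : ∀ z : ℂ, 0 ≤ z.im → R ≤ ‖z‖ → ‖H z‖ ≤ M) {z : ℂ} (hz : 0 ≤ z.im) : 0 ≤ (H z).im := by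
  -- Multiplication by i carries the right half plane to the upper one, and |f| = exp(-Im H). So |f|
  -- = 1 on the imaginary axis, and the claim is |f| ≤ 1.
  set f : ℂ → ℂ := fun w => exp (I * H (I * w)) with hf
  have hfn : ∀ w, ‖f w‖ = Real.exp (-(H (I * w)).im) := fun w => by
    rw [hf, Complex.norm_exp, I_mul_re]
  have hcl : closure {w : ℂ | 0 < w.re} = {w : ℂ | 0 ≤ w.re} := Complex.closure_setOfPred_lt_re 0
  have hfd : DiffContOnCl ℂ f {w | 0 < w.re} := by
    refine ⟨?_, ?_⟩
    · refine ((hd.comp (by fun_prop) fun w hw => ?_).const_mul I).cexp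
      simpa using (hw : 0 < w.re)
    · rw [hcl]
      refine (continuousOn_const.mul (hc.comp (by fun_prop) fun w hw => ?_)).cexp
      simpa using (hw : 0 ≤ w.re)
  have hbd : ∀ w : ℂ, 0 ≤ w.re → R ≤ ‖w‖ → ‖f w‖ ≤ Real.exp M := by
    intro w hw hn
    rw [hfn]
    gcongr
    have := hb (I * w) (by simpa using hw) (by simpa using hn)
    exact (neg_le_abs _).trans ((abs_im_le_norm _).trans this)
  have key := PhragmenLindelof.right_half_plane_of_bounded_on_real (C := 1) hfd ?_ ?_ ?_
    (z := -I * z) (by simpa using hz)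
  · rw [hfn, Real.exp_le_one_iff, ← mul_assoc, mul_neg, I_mul_I, neg_neg, one_mul] at key
    linarith
  -- Any growth exponent below 2 is admissible; f is bounded near infinity, so the coefficient 0
  -- suffices.
  · refine ⟨1, by norm_num, 0, Asymptotics.IsBigO.of_bound (Real.exp M) ?_⟩
    have h1 : ∀ᶠ w : ℂ in Bornology.cobounded ℂ ⊓ 𝓟 {w : ℂ | 0 < w.re}, R ≤ ‖w‖ :=
      (tendsto_norm_cobounded_atTop.eventually_ge_atTop R).filter_mono inf_le_left
    have h2 : ∀ᶠ w : ℂ in Bornology.cobounded ℂ ⊓ 𝓟 {w : ℂ | 0 < w.re}, 0 < w.re :=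
      (eventually_principal.2 fun w hw => hw).filter_mono inf_le_right
    filter_upwards [h1, h2] with w hw1 hw2
    simpa using hbd w hw2.le hw1
  · refine ⟨Real.exp M, ?_⟩
    rw [eventually_map]
    filter_upwards [eventually_ge_atTop R, eventually_ge_atTop 0] with x hx hx0
    refine hbd x (by simpa using hx0) ?_
    rwa [norm_real, Real.norm_of_nonneg hx0]
  · intro x
    rw [hfn, show I * (x * I) = ((-x : ℝ) : ℂ) by push_cast; linear_combination (x : ℂ) * I_sq, hr]
    simp

/-- Applied to H and to -H, the preceding inequality gives Im H = 0. A holomorphic function with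
constant imaginary part is constant, and continuity carries this to the real line. -/
lemma eq_const_of_real_of_bounded {H : ℂ → ℂ} (hd : DifferentiableOn ℂ H {z | 0 < z.im})
    (hc : ContinuousOn H {z | 0 ≤ z.im}) (hr : ∀ x : ℝ, (H x).im = 0) {M R : ℝ}
    (hb : ∀ z : ℂ, 0 ≤ z.im → R ≤ ‖z‖ → ‖H z‖ ≤ M) :
    ∃ c, ∀ z : ℂ, 0 ≤ z.im → H z = c := by
  have him : ∀ z ∈ {z : ℂ | 0 < z.im}, (H z).im = 0 := by
    intro z hz
    refine le_antisymm ?_ (im_nonneg_of_real_of_bounded hd hc hr hb (le_of_lt hz))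
    have := im_nonneg_of_real_of_bounded hd.neg hc.neg (by simpa using hr) (M := M) (R := R)
      (by simpa using hb) (le_of_lt hz)
    simpa using this
  have ho : IsOpen {z : ℂ | 0 < z.im} := isOpen_lt continuous_const Complex.continuous_im
  obtain ⟨c, hcc⟩ := AnalyticOnNhd.eq_const_of_im_eq_const (hd.analyticOnNhd ho) him ho
    ((convex_halfSpace_im_gt 0).isConnected ⟨I, by simp⟩)
  refine ⟨c, fun z hz => ?_⟩
  have hcl : closure {w : ℂ | 0 < w.im} = {w : ℂ | 0 ≤ w.im} := Complex.closure_setOfPred_lt_im 0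
  have : Set.EqOn H (fun _ => c) (closure {w : ℂ | 0 < w.im}) :=
    Set.EqOn.of_subset_closure hcc (by rwa [hcl]) continuousOn_const subset_closure le_rfl
  exact this (by rw [hcl]; exact hz)

/-! ### Quotients of second order theta functions -/

/-- On each of the four intervals conjugation of φ is a translation or reflection under which
quotients of second order theta functions are invariant; hence those quotients are real on the
boundary. -/
lemma conj_abelInt_of_ge (h₂ : 0 < y₂) (h₁ : y₂ < y₁) {x : ℝ} (hx : y₁ ≤ x) :
    starRingEnd ℂ (abelInt y₁ y₂ x) = abelInt y₁ y₂ x := by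
  rw [abelInt_of_ge h₂ h₁ hx, conj_ofReal]

lemma conj_abelInt_of_mid (h₂ : 0 < y₂) (h₁ : y₂ < y₁) {x : ℝ} (hx : y₂ ≤ x) (hx' : x ≤ y₁) :
    starRingEnd ℂ (abelInt y₁ y₂ x) = -abelInt y₁ y₂ x := by
  rw [abelInt_of_mid h₂ h₁ hx hx', map_mul, conj_ofReal, conj_I, neg_mul]

lemma conj_abelInt_of_low (h₂ : 0 < y₂) (h₁ : y₂ < y₁) {x : ℝ} (hx : 0 ≤ x) (hx' : x ≤ y₂) :
    starRingEnd ℂ (abelInt y₁ y₂ x) = abelInt y₁ y₂ x - tau y₁ y₂ := by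
  rw [abelInt_of_low h₂ h₁ hx hx', map_add, conj_ofReal, map_div₀,
    conj_eq_neg_of_re_eq_zero tau_re, show starRingEnd ℂ 2 = 2 from conj_ofReal 2]
  ring

lemma conj_abelInt_of_neg (h₂ : 0 < y₂) (h₁ : y₂ < y₁) {x : ℝ} (hx : x ≤ 0) :
    starRingEnd ℂ (abelInt y₁ y₂ x) = 1 - abelInt y₁ y₂ x := by
  rw [abelInt_of_neg h₂ h₁ hx, map_sub, map_add, map_mul, conj_ofReal, conj_I, map_div₀, map_div₀,
    conj_eq_neg_of_re_eq_zero tau_re, map_one, show starRingEnd ℂ 2 = 2 from conj_ofReal 2]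
  ring

namespace SecondOrder

variable {τ : ℂ} {N D : ℂ → ℂ}

lemma div_add_tau (hN : SecondOrder τ N) (hD : SecondOrder τ D) (u : ℂ) :
    N (u + τ) / D (u + τ) = N u / D u := by
  rw [hN.add_tau, hD.add_tau, mul_div_mul_left _ _ (exp_ne_zero _)]

lemma div_neg (hN : SecondOrder τ N) (hD : SecondOrder τ D) (u : ℂ) :
    N (-u) / D (-u) = N u / D u := by
  rw [hN.even, hD.even]

lemma one_sub (hN : SecondOrder τ N) (u : ℂ) : N (1 - u) = N u := by
  rw [← hN.even, ← hN.add_one]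
  congr 1; ring

lemma sub_const_mul (hN : SecondOrder τ N) (hD : SecondOrder τ D) {ν : ℂ}
    (hν : starRingEnd ℂ ν = ν) : SecondOrder τ fun u => N u - ν * D u where
  differentiable := hN.differentiable.sub (hD.differentiable.const_mul ν)
  add_one u := by rw [hN.add_one, hD.add_one]
  add_tau u := by rw [hN.add_tau, hD.add_tau]; ring
  even u := by rw [hN.even, hD.even]
  conj u := by rw [map_sub, map_mul, hN.conj, hD.conj, hν]

lemma conj_half (hN : SecondOrder τ N) : starRingEnd ℂ (N (1 / 2)) = N (1 / 2) := by
  rw [hN.conj, map_div₀, map_one, show starRingEnd ℂ 2 = 2 from conj_ofReal 2]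

/-- A zero at `1/2` is at least double. -/
lemma norm_le_of_half_eq_zero (hN : SecondOrder τ N) (h0 : N (1 / 2) = 0) :
    ∃ M : ℝ, 0 < M ∧ ∀ u : ℂ, ‖u - 1 / 2‖ ≤ 1 → ‖N u‖ ≤ M * ‖u - 1 / 2‖ ^ 2 := by
  -- The reflection u ↦ 1 - u fixes 1/2 and preserves N, so the derivative there equals its own
  -- negative.
  have hderiv : deriv N (1 / 2) = 0 := by
    have h := deriv_comp_const_sub (f := N) 1 (1 / 2)
    simp only [hN.one_sub] at h
    norm_num at h ⊢
    exact self_eq_neg.1 h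
  set g := dslope N (1 / 2)
  set k := dslope g (1 / 2)
  have hg : DifferentiableOn ℂ g Set.univ :=
    (Complex.differentiableOn_dslope univ_mem).2 hN.differentiable.differentiableOn
  have hk : DifferentiableOn ℂ k Set.univ := (Complex.differentiableOn_dslope univ_mem).2 hg
  have hkc : Continuous k := (differentiableOn_univ.1 hk).continuous
  have e1 (u : ℂ) : N u = (u - 1 / 2) * g u := by
    have := sub_smul_dslope N (1 / 2) u
    rw [h0, sub_zero] at this
    exact this.symm
  have e2 (u : ℂ) : g u = (u - 1 / 2) * k u := by
    have := sub_smul_dslope g (1 / 2) u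
    rw [show g (1 / 2) = 0 by rw [← hderiv]; exact dslope_same _ _, sub_zero] at this
    exact this.symm
  obtain ⟨M, hM⟩ := (isCompact_closedBall (1 / 2 : ℂ) 1).exists_bound_of_continuousOn
    hkc.continuousOn
  refine ⟨|M| + 1, by positivity, fun u hu => ?_⟩
  have := hM u (by simpa [dist_eq_norm] using hu)
  rw [e1, e2, norm_mul, norm_mul, ← mul_assoc, ← sq, mul_comm]
  gcongr
  linarith [le_abs_self M]

/-- Quotients of second order theta functions are real at the boundary values of `φ`. -/
lemma div_abelInt_im (h₂ : 0 < y₂) (h₁ : y₂ < y₁) (hN : SecondOrder (tau y₁ y₂) N)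
    (hD : SecondOrder (tau y₁ y₂) D) (x : ℝ) :
    (N (abelInt y₁ y₂ x) / D (abelInt y₁ y₂ x)).im = 0 := by
  rw [← Complex.conj_eq_iff_im, map_div₀, hN.conj, hD.conj]
  rcases le_total y₁ x with h | h
  · rw [conj_abelInt_of_ge h₂ h₁ h]
  rcases le_total y₂ x with h' | h'
  · rw [conj_abelInt_of_mid h₂ h₁ h' h, hN.div_neg hD]
  rcases le_total 0 x with h'' | h''
  · rw [conj_abelInt_of_low h₂ h₁ h'' h', ← hN.div_add_tau hD, sub_add_cancel]
  · rw [conj_abelInt_of_neg h₂ h₁ h'', hN.one_sub, hD.one_sub]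

end SecondOrder

/-! ### Comparison with σ² along φ -/

lemma sigmaSq_abelInt_ne_zero (h₂ : 0 < y₂) (h₁ : y₂ < y₁) {z : ℂ} (hz : 0 ≤ z.im)
    (hne : z ≠ y₁) : sigmaSq (tau y₁ y₂) (abelInt y₁ y₂ z) ≠ 0 :=
  sigmaSq_ne_zero_of_region (tau_im_pos h₂ h₁) tau_re (abelInt_mem_region h₂ h₁ hz hne)

lemma abelInt_ne_zero (h₂ : 0 < y₂) (h₁ : y₂ < y₁) {z : ℂ} (hz : 0 ≤ z.im)
    (hne : z ≠ y₁) : abelInt y₁ y₂ z ≠ 0 := by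
  intro h
  have := abelInt_mem_region h₂ h₁ hz hne
  simp [h] at this

lemma sigmaSq_half_ne_zero (h₂ : 0 < y₂) (h₁ : y₂ < y₁) : sigmaSq (tau y₁ y₂) (1 / 2) ≠ 0 :=
  sigmaSq_ne_zero_of_region (tau_im_pos h₂ h₁) tau_re (Or.inl (by norm_num))

/-- Near y₁ one has σ²(φ) ~ κφ² and φ² ~ ℓ(z - y₁), so the double zero of σ² in u is a simple zero
in z and L = (κℓ)⁻¹. -/
lemma tendsto_sub_div_sigmaSq (h₂ : 0 < y₂) (h₁ : y₂ < y₁) : ∃ L : ℂ, L ≠ 0 ∧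
    Tendsto (fun z => (z - y₁) / sigmaSq (tau y₁ y₂) (abelInt y₁ y₂ z))
      (𝓝[{z | 0 ≤ z.im} \ {(y₁ : ℂ)}] y₁) (𝓝 L) := by
  obtain ⟨κ, hκ, hκl⟩ := tendsto_sigmaSq_div_sq (tau_im_pos h₂ h₁)
  obtain ⟨ℓ, hℓ, hℓl⟩ := tendsto_abelInt_sq_div h₂ h₁
  have hℓ' : (ℓ : ℂ) ≠ 0 := by exact_mod_cast hℓ.ne'
  refine ⟨(κ * ℓ)⁻¹, inv_ne_zero (mul_ne_zero hκ hℓ'), ?_⟩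
  have hS : Tendsto (abelInt y₁ y₂) (𝓝[{z | 0 ≤ z.im} \ {(y₁ : ℂ)}] y₁) (𝓝[≠] 0) := by
    refine tendsto_nhdsWithin_iff.2 ⟨?_, eventually_mem_nhdsWithin.mono fun z hz =>
      abelInt_ne_zero h₂ h₁ hz.1 hz.2⟩
    have := (continuousOn_abelInt h₂ h₁ y₁ (by simp)).tendsto
    rw [abelInt_y₁] at this
    exact this.mono_left (nhdsWithin_mono _ Set.sdiff_subset)
  refine (((hκl.comp hS).mul hℓl).inv₀ (mul_ne_zero hκ hℓ')).congr' ?_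
  filter_upwards [eventually_mem_nhdsWithin] with z hz
  have := abelInt_ne_zero h₂ h₁ hz.1 hz.2
  simp only [Function.comp_apply]
  field_simp

/-- The zero of N at 1/2 is double and φ - 1/2 = O(‖z‖^{-1/2}), so N(φ) = O(‖z‖⁻¹). This compensates
the factor z - y₁. -/
lemma bounded_quotient (h₂ : 0 < y₂) (h₁ : y₂ < y₁) {N : ℂ → ℂ}
    (hN : SecondOrder (tau y₁ y₂) N) (h0 : N (1 / 2) = 0) : ∃ M R : ℝ, 2 * y₁ ≤ R ∧
    ∀ z : ℂ, 0 ≤ z.im → R ≤ ‖z‖ →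
      ‖N (abelInt y₁ y₂ z) * ((z - y₁) / sigmaSq (tau y₁ y₂) (abelInt y₁ y₂ z))‖ ≤ M := by
  have hy : 0 < y₁ := h₂.trans h₁
  obtain ⟨M, hM, hMb⟩ := hN.norm_le_of_half_eq_zero h0
  obtain ⟨K, hK, hKb⟩ := norm_abelInt_sub_half_le h₂ h₁
  have hD := secondOrder_sigmaSq (tau_im_pos h₂ h₁) (tau_re (y₁ := y₁) (y₂ := y₂))
  set m := ‖sigmaSq (tau y₁ y₂) (1 / 2)‖ with hm
  have hm0 : 0 < m := norm_pos_iff.2 (sigmaSq_half_ne_zero h₂ h₁)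
  have hnear : ∀ᶠ u in 𝓝 (1 / 2 : ℂ), m / 2 < ‖sigmaSq (tau y₁ y₂) u‖ :=
    (hD.differentiable.continuous.norm.tendsto _).eventually_const_lt (by linarith)
  obtain ⟨δ, hδ, hδb⟩ := Metric.eventually_nhds_iff.1 hnear
  have hlim : Tendsto (fun r : ℝ => K * (√r)⁻¹) atTop (𝓝 0) := by
    simpa using (tendsto_inv_atTop_zero.comp Real.tendsto_sqrt_atTop).const_mul K
  obtain ⟨R, hR⟩ := eventually_atTop.1
    ((hlim.eventually_lt_const hδ).and (hlim.eventually_lt_const one_pos))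
  refine ⟨M * K ^ 2 * 2 * (m / 2)⁻¹, max R (2 * y₁), le_max_right _ _, fun z hz hn => ?_⟩
  have hn1 : 2 * y₁ ≤ ‖z‖ := (le_max_right _ _).trans hn
  obtain ⟨r1, r2⟩ := hR ‖z‖ ((le_max_left _ _).trans hn)
  have hz0 : 0 < ‖z‖ := by linarith
  have hb := hKb z hz hn1
  have b1 := hMb _ (hb.trans r2.le)
  have b2 := hδb (y := abelInt y₁ y₂ z) (by rw [dist_eq_norm]; exact hb.trans_lt r1)
  have b3 : ‖z - y₁‖ ≤ 2 * ‖z‖ := by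
    have := norm_sub_le z y₁
    rw [norm_real, Real.norm_of_nonneg hy.le] at this
    linarith
  have b4 : ‖abelInt y₁ y₂ z - 1 / 2‖ ^ 2 ≤ K ^ 2 * ‖z‖⁻¹ := by
    calc _ ≤ (K * (√‖z‖)⁻¹) ^ 2 := by gcongr
      _ = _ := by rw [mul_pow, inv_pow, Real.sq_sqrt hz0.le]
  rw [norm_mul, norm_div, div_eq_mul_inv]
  calc _ ≤ M * (K ^ 2 * ‖z‖⁻¹) * (2 * ‖z‖ * (m / 2)⁻¹) := by
        gcongr
        exact b1.trans (by gcongr)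
    _ = _ := by field_simp

/-- Every second order theta function is, along `φ`, a combination of `1` and `1 / (z - y₁)`
times `σ²`. -/
theorem exists_forall_secondOrder_abelInt (h₂ : 0 < y₂) (h₁ : y₂ < y₁) : ∃ L : ℂ, L ≠ 0 ∧
    ∀ N : ℂ → ℂ, SecondOrder (tau y₁ y₂) N → ∀ z : ℂ, 0 ≤ z.im → z ≠ y₁ →
      N (abelInt y₁ y₂ z) * (z - y₁) = sigmaSq (tau y₁ y₂) (abelInt y₁ y₂ z) *
        (N (1 / 2) / sigmaSq (tau y₁ y₂) (1 / 2) * (z - y₁) + N 0 * L) := by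
  obtain ⟨L, hL, hLl⟩ := tendsto_sub_div_sigmaSq h₂ h₁
  refine ⟨L, hL, fun N hN z hz hne => ?_⟩
  have hD := secondOrder_sigmaSq (tau_im_pos h₂ h₁) (tau_re (y₁ := y₁) (y₂ := y₂))
  have hD0 : sigmaSq (tau y₁ y₂) 0 = 0 := by
    have hq := norm_nome_lt_one (tau_im_pos h₂ h₁)
    simp [sigmaSq, qProd_eq_mul hq 1]
  -- The multiple of σ² that must be subtracted for the difference to vanish at 1/2, the value of φ
  -- at infinity. It is real, so the difference is again of second order.
  set ν := N (1 / 2) / sigmaSq (tau y₁ y₂) (1 / 2) with hν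
  have hνc : starRingEnd ℂ ν = ν := by rw [hν, map_div₀, hN.conj_half, hD.conj_half]
  have hN' := hN.sub_const_mul hD hνc
  set N' : ℂ → ℂ := fun u => N u - ν * sigmaSq (tau y₁ y₂) u with hN'def
  have hN'0 : N' (1 / 2) = 0 := by
    simp only [hN'def, hν]
    rw [div_mul_cancel₀ _ (sigmaSq_half_ne_zero h₂ h₁), sub_self]
  set h : ℂ → ℂ := fun z => N' (abelInt y₁ y₂ z) *
    ((z - y₁) / sigmaSq (tau y₁ y₂) (abelInt y₁ y₂ z)) with hh
  -- At z = y₁ the raw quotient has the value 0 by the convention on division; it is replaced by the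
  -- limit.
  set H : ℂ → ℂ := Function.update h y₁ (N' 0 * L) with hH
  have hHne : ∀ w : ℂ, w ≠ y₁ → H w = h w := fun w hw => Function.update_of_ne hw _ _
  obtain ⟨M, R, hR, hb⟩ := bounded_quotient h₂ h₁ hN' hN'0
  have hcont : ContinuousOn h ({z | 0 ≤ z.im} \ {(y₁ : ℂ)}) := by
    have hS := (continuousOn_abelInt h₂ h₁).mono
      (Set.sdiff_subset : {z : ℂ | 0 ≤ z.im} \ {(y₁ : ℂ)} ⊆ {z | 0 ≤ z.im})
    refine (hN'.differentiable.continuous.comp_continuousOn hS).mul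
      (ContinuousOn.div (by fun_prop) (hD.differentiable.continuous.comp_continuousOn hS) ?_)
    exact fun w hw => sigmaSq_abelInt_ne_zero h₂ h₁ hw.1 hw.2
  have hlim : Tendsto h (𝓝[{z | 0 ≤ z.im} \ {(y₁ : ℂ)}] y₁) (𝓝 (N' 0 * L)) := by
    refine Tendsto.mul ?_ hLl
    have := (hN'.differentiable.continuous.tendsto _).comp
      (continuousOn_abelInt h₂ h₁ y₁ (by simp)).tendsto
    rw [abelInt_y₁] at this
    exact this.mono_left (nhdsWithin_mono _ Set.sdiff_subset)
  have hHc : ContinuousOn H {z | 0 ≤ z.im} := continuousOn_update_iff.2 ⟨hcont, fun _ => hlim⟩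
  have hHd : DifferentiableOn ℂ H {z | 0 < z.im} := by
    intro w hw
    have hS := (hasDerivAt_abelInt h₂ h₁ hw).differentiableAt
    have hwne : w ≠ y₁ := fun e => by simp [e] at hw
    have hdw : DifferentiableAt ℂ h w :=
      ((hN'.differentiable _).comp w hS).mul ((by fun_prop : DifferentiableAt ℂ (fun z : ℂ => z - y₁) w).div
        ((hD.differentiable _).comp w hS) (sigmaSq_abelInt_ne_zero h₂ h₁ (le_of_lt hw) hwne))
    refine (hdw.congr_of_eventuallyEq ?_).differentiableWithinAt
    filter_upwards [isOpen_ne.mem_nhds hwne] with v hv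
    exact hHne v hv
  have hreal : ∀ x : ℝ, x ≠ y₁ → (H x).im = 0 := by
    intro x hx
    have := hN'.div_abelInt_im h₂ h₁ hD x
    rw [hHne x (by exact_mod_cast hx), hh]
    simp only
    rw [show N' (abelInt y₁ y₂ x) * ((x - y₁) / sigmaSq (tau y₁ y₂) (abelInt y₁ y₂ x)) =
      N' (abelInt y₁ y₂ x) / sigmaSq (tau y₁ y₂) (abelInt y₁ y₂ x) * ((x - y₁ : ℝ) : ℂ) by
      push_cast; ring, im_mul_ofReal, this, zero_mul]
  have hreal' : ∀ x : ℝ, (H x).im = 0 := by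
    intro x
    rcases eq_or_ne x y₁ with rfl | hx
    · have h1 : Tendsto (fun t : ℝ => (H t).im) (𝓝[≠] x) (𝓝 (H x).im) := by
        refine (Complex.continuous_im.tendsto _).comp ((hHc x (by simp)).tendsto.comp ?_)
        refine tendsto_nhdsWithin_iff.2 ⟨?_, Eventually.of_forall fun t => by simp⟩
        exact (Complex.continuous_ofReal.tendsto x).mono_left nhdsWithin_le_nhds
      refine tendsto_nhds_unique h1 (tendsto_const_nhds.congr' ?_)
      filter_upwards [eventually_mem_nhdsWithin] with t ht
      exact (hreal t ht).symm
    · exact hreal x hx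
  -- The constant is then read off at y₁. It is N(0)L, because σ²(0) = 0.
  obtain ⟨c, hc⟩ := eq_const_of_real_of_bounded hHd hHc hreal' (M := M) (R := R)
    fun w hw hwn => by
      rw [hHne w]
      · exact hb w hw hwn
      · rintro rfl
        rw [norm_real, Real.norm_of_nonneg (by linarith)] at hwn
        linarith
  have e1 := hc z hz
  have e2 := hc y₁ (by simp)
  rw [hH, Function.update_self] at e2
  rw [hHne z hne, ← e2] at e1
  simp only [hh, hN'def, hD0, mul_zero, sub_zero] at e1
  have hs := sigmaSq_abelInt_ne_zero h₂ h₁ hz hne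
  field_simp at e1
  linear_combination e1

/-! ### Theta constants -/

section Constants

variable {τ : ℂ}

/-- Evenness and period 1 give θ(1/2 - τ/2) = θ(1/2 + τ/2), while quasi-periodicity gives the
opposite sign. -/
lemma jacobiTheta₂_half_add_half_tau : jacobiTheta₂ (1 / 2 + τ / 2) τ = 0 := by
  have h := jacobiTheta₂_add_half_tau (τ := τ) (1 / 2)
  rw [show -2 * π * I * (1 / 2) = -(π * I) by ring, exp_neg, exp_pi_mul_I,
    ← jacobiTheta₂_neg_left (1 / 2 - τ / 2), ← jacobiTheta₂_add_left (-(1 / 2 - τ / 2)),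
    show -(1 / 2 - τ / 2) + 1 = 1 / 2 + τ / 2 by ring] at h
  norm_num at h ⊢
  exact self_eq_neg.1 h

lemma jacobiTheta₂_pos_of_terms (hτ : 0 < τ.im) {u : ℂ} {f : ℤ → ℝ}
    (h : ∀ n, jacobiTheta₂_term n u τ = (Real.exp (f n) : ℝ)) :
    ∃ t : ℝ, 0 < t ∧ jacobiTheta₂ u τ = t := by
  have hs := (summable_jacobiTheta₂_term_iff u τ).2 hτ
  simp only [h] at hs
  have hs' : Summable fun n => Real.exp (f n) := by exact_mod_cast hs
  refine ⟨∑' n, Real.exp (f n), hs'.tsum_pos (fun n => (Real.exp_pos _).le) 0 (Real.exp_pos _), ?_⟩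
  rw [jacobiTheta₂, ofReal_tsum]
  exact tsum_congr h

lemma jacobiTheta₂_zero_pos (hτ : 0 < τ.im) (hre : τ.re = 0) :
    ∃ t : ℝ, 0 < t ∧ jacobiTheta₂ 0 τ = t := by
  refine jacobiTheta₂_pos_of_terms hτ (f := fun n => -(π * n ^ 2 * τ.im)) fun n => ?_
  have e : τ = τ.im * I := Complex.ext (by simp [hre]) (by simp)
  rw [jacobiTheta₂_term, ofReal_exp, e]
  congr 1
  simp
  linear_combination (π * n ^ 2 * τ.im : ℂ) * I_sq

lemma jacobiTheta₂_half_tau_pos (hτ : 0 < τ.im) (hre : τ.re = 0) :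
    ∃ t : ℝ, 0 < t ∧ jacobiTheta₂ (τ / 2) τ = t := by
  refine jacobiTheta₂_pos_of_terms hτ (f := fun n => -(π * (n ^ 2 + n) * τ.im)) fun n => ?_
  have e : τ = τ.im * I := Complex.ext (by simp [hre]) (by simp)
  rw [jacobiTheta₂_term, ofReal_exp, e]
  congr 1
  simp
  linear_combination (π * (n ^ 2 + n) * τ.im : ℂ) * I_sq

/-- The terms alternate in sign, so positivity is not visible here. Reality is enough, because only
θ(1/2)² enters; that it is nonzero follows later from the relation at z = 0. -/
lemma jacobiTheta₂_half_real (hre : τ.re = 0) : ∃ t : ℝ, jacobiTheta₂ (1 / 2) τ = t := by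
  refine ⟨(jacobiTheta₂ (1 / 2) τ).re, (Complex.conj_eq_iff_re.1 ?_).symm⟩
  rw [conj_jacobiTheta₂ hre, map_div₀, map_one, show starRingEnd ℂ 2 = 2 from conj_ofReal 2]

end Constants

/-! ### The numerators and their values at half periods -/

lemma secondOrder_theta (h₂ : 0 < y₂) (h₁ : y₂ < y₁) :
    SecondOrder (tau y₁ y₂) fun u => theta y₁ y₂ u ^ 2 :=
  secondOrder_theta_sq (tau_im_pos h₂ h₁) tau_re

lemma secondOrder_num₁ (h₂ : 0 < y₂) (h₁ : y₂ < y₁) : SecondOrder (tau y₁ y₂) (num₁ y₁ y₂) := by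
  have := secondOrder_exp_mul_sq (tau_im_pos h₂ h₁) tau_re (h := 0) (by simp) (by simp)
  simp only [ofReal_zero, zero_add] at this
  exact this

lemma secondOrder_num₂ (h₂ : 0 < y₂) (h₁ : y₂ < y₁) : SecondOrder (tau y₁ y₂) (num₂ y₁ y₂) := by
  have := secondOrder_exp_mul_sq (tau_im_pos h₂ h₁) tau_re (h := 1 / 2) jacobiTheta₂_sub_half
    exp_half_period
  have e : num₂ y₁ y₂ = fun u => exp (2 * π * I * u) *
      jacobiTheta₂ (u + (((1 / 2 : ℝ) : ℂ) + tau y₁ y₂ / 2)) (tau y₁ y₂) ^ 2 := by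
    funext u
    rw [num₂, theta, add_div]
    push_cast
    rfl
  rwa [e]

lemma secondOrder_num₃ (h₂ : 0 < y₂) (h₁ : y₂ < y₁) : SecondOrder (tau y₁ y₂) (num₃ y₁ y₂) := by
  have := secondOrder_sq (tau_im_pos h₂ h₁) tau_re (h := 1 / 2) jacobiTheta₂_sub_half
    exp_half_period
  have e : num₃ y₁ y₂ = fun u =>
      jacobiTheta₂ (u + ((1 / 2 : ℝ) : ℂ)) (tau y₁ y₂) ^ 2 := by
    funext u
    rw [num₃, theta]
    push_cast
    rfl
  rwa [e]

lemma theta_half_add_half_tau : theta y₁ y₂ (1 / 2 + tau y₁ y₂ / 2) = 0 :=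
  jacobiTheta₂_half_add_half_tau

lemma theta_one_add (u : ℂ) : theta y₁ y₂ (u + 1) = theta y₁ y₂ u := jacobiTheta₂_add_left _ _

lemma num₁_zero : num₁ y₁ y₂ 0 = theta y₁ y₂ (tau y₁ y₂ / 2) ^ 2 := by simp [num₁]

lemma num₁_half : num₁ y₁ y₂ (1 / 2) = 0 := by
  rw [num₁, theta_half_add_half_tau]; simp

lemma num₂_zero : num₂ y₁ y₂ 0 = 0 := by
  simp only [num₂, zero_add, add_div, theta_half_add_half_tau]
  simp

lemma num₂_half : num₂ y₁ y₂ (1 / 2) = -theta y₁ y₂ (tau y₁ y₂ / 2) ^ 2 := by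
  rw [num₂, show (1 / 2 : ℂ) + (1 + tau y₁ y₂) / 2 = tau y₁ y₂ / 2 + 1 by ring, theta_one_add,
    show 2 * π * I * (1 / 2) = π * I by ring, exp_pi_mul_I, neg_one_mul]

lemma num₃_zero : num₃ y₁ y₂ 0 = theta y₁ y₂ (1 / 2) ^ 2 := by simp [num₃]

lemma num₃_half : num₃ y₁ y₂ (1 / 2) = theta y₁ y₂ 0 ^ 2 := by
  rw [num₃, show (1 / 2 : ℂ) + 1 / 2 = 0 + 1 by norm_num, theta_one_add]

lemma num₁_half_tau : num₁ y₁ y₂ (tau y₁ y₂ / 2) =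
    exp (-(π * I * tau y₁ y₂)) * theta y₁ y₂ 0 ^ 2 := by
  rw [num₁, show tau y₁ y₂ / 2 + tau y₁ y₂ / 2 = 0 + tau y₁ y₂ by ring, theta,
    jacobiTheta₂_add_left', mul_pow, ← mul_assoc, ← exp_nat_mul, ← exp_add, theta]
  congr 2
  push_cast; ring

/-- The fourth powers of the theta constants are determined by the branch points. -/
lemma theta_constants (h₂ : 0 < y₂) (h₁ : y₂ < y₁) :
    theta y₁ y₂ 0 ≠ 0 ∧ theta y₁ y₂ (1 / 2) ≠ 0 ∧
    (theta y₁ y₂ (tau y₁ y₂ / 2) ^ 2) ^ 2 * y₁ =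
      exp (-(π * I * tau y₁ y₂)) * y₂ * (theta y₁ y₂ 0 ^ 2) ^ 2 ∧
    (theta y₁ y₂ (1 / 2) ^ 2) ^ 2 * y₁ = (theta y₁ y₂ 0 ^ 2) ^ 2 * (y₁ - y₂) ∧
    ∃ κ L : ℂ, κ ≠ 0 ∧ κ * y₁ = theta y₁ y₂ 0 ^ 2 * L ∧
      ∀ N : ℂ → ℂ, SecondOrder (tau y₁ y₂) N → ∀ z : ℂ, 0 ≤ z.im → z ≠ y₁ →
      N (abelInt y₁ y₂ z) * (z - y₁) * theta y₁ y₂ (1 / 2) ^ 2 =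
        sigmaSq (tau y₁ y₂) (abelInt y₁ y₂ z) *
          (N (1 / 2) * κ * (z - y₁) + N 0 * L * theta y₁ y₂ (1 / 2) ^ 2) := by
  obtain ⟨L, hL, key⟩ := exists_forall_secondOrder_abelInt h₂ h₁
  have hs := sigmaSq_half_ne_zero h₂ h₁
  have hy₁ : (y₁ : ℂ) ≠ 0 := by exact_mod_cast (h₂.trans h₁).ne'
  have hy₂ : (y₂ : ℂ) ≠ 0 := by exact_mod_cast h₂.ne'
  have hy : (y₂ : ℂ) - y₁ ≠ 0 := by exact_mod_cast (sub_neg.2 h₁).ne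
  have ht0 : theta y₁ y₂ 0 ≠ 0 := by
    obtain ⟨t, ht, he⟩ := jacobiTheta₂_zero_pos (tau_im_pos h₂ h₁) (tau_re (y₁ := y₁) (y₂ := y₂))
    rw [theta, he]; exact_mod_cast ht.ne'
  have ht1 : theta y₁ y₂ (tau y₁ y₂ / 2) ≠ 0 := by
    obtain ⟨t, ht, he⟩ := jacobiTheta₂_half_tau_pos (tau_im_pos h₂ h₁)
      (tau_re (y₁ := y₁) (y₂ := y₂))
    rw [theta, he]; exact_mod_cast ht.ne'
  -- At z = 0 the value of φ is a zero of θ, and at z = y₂ it is a zero of the third numerator;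
  -- these give E1 and E2. The values of θ² and the first numerator at y₂ then give E3.
  have a0 := key _ (secondOrder_theta h₂ h₁) 0 (by simp) hy₁.symm
  have s0 := sigmaSq_abelInt_ne_zero h₂ h₁ (z := 0) (by simp) hy₁.symm
  have a2 := key _ (secondOrder_theta h₂ h₁) y₂ (by simp) (sub_ne_zero.1 hy)
  have b2 := key _ (secondOrder_num₁ h₂ h₁) y₂ (by simp) (sub_ne_zero.1 hy)
  have d2 := key _ (secondOrder_num₃ h₂ h₁) y₂ (by simp) (sub_ne_zero.1 hy)
  have s2 := sigmaSq_abelInt_ne_zero h₂ h₁ (z := y₂) (by simp) (sub_ne_zero.1 hy)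
  rw [abelInt_zero h₂ h₁] at a0 s0
  rw [abelInt_y₂ h₂ h₁] at a2 b2 d2 s2
  simp only [theta_half_add_half_tau] at a0
  have hd : num₃ y₁ y₂ (tau y₁ y₂ / 2) = 0 := by
    rw [num₃, add_comm, theta_half_add_half_tau]; simp
  rw [hd, num₃_half, num₃_zero, zero_mul, eq_comm, mul_eq_zero, or_iff_right s2] at d2
  rw [eq_comm, zero_pow two_ne_zero, zero_mul, mul_eq_zero, or_iff_right s0] at a0
  rw [num₁_half_tau, num₁_half, num₁_zero, zero_div, zero_mul, zero_add] at b2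
  set s := sigmaSq (tau y₁ y₂) (1 / 2)
  set σ := sigmaSq (tau y₁ y₂) (tau y₁ y₂ / 2)
  set a := theta y₁ y₂ 0 ^ 2 with ha
  set b := theta y₁ y₂ (tau y₁ y₂ / 2) ^ 2 with hb
  set c := theta y₁ y₂ (1 / 2) ^ 2 with hc
  set e := exp (-(π * I * tau y₁ y₂))
  have ha0 : a ≠ 0 := pow_ne_zero _ ht0
  have hb0 : b ≠ 0 := pow_ne_zero _ ht1
  have E1 : a * (L * s) = c * y₁ := by
    field_simp at a0
    linear_combination a0
  have E2 : c * (L * s) = a * (y₁ - y₂) := by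
    field_simp at d2
    linear_combination d2
  have hc0 : c ≠ 0 := by
    intro h
    rw [h, zero_mul] at E1
    exact mul_ne_zero ha0 (mul_ne_zero hL hs) E1
  have E4 : c ^ 2 * y₁ = a ^ 2 * (y₁ - y₂) := by linear_combination -c * E1 + a * E2
  have E3 : b ^ 2 * y₁ = e * y₂ * a ^ 2 := by
    have A2 : b * (y₂ - y₁) * s = σ * c * y₂ := by
      field_simp at a2
      linear_combination a2 + σ * E1
    have h : (b ^ 2 * y₁ - e * y₂ * a ^ 2) * ((y₂ - y₁) * s) = 0 := by
      linear_combination b * y₁ * A2 - y₂ * a * s * b2 - σ * b * y₂ * E1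
    have := (mul_eq_zero.1 h).resolve_right (mul_ne_zero hy hs)
    linear_combination this
  -- With κ = c/s, relation E1 reads κy₁ = aL. The affine factor belonging to θ² then becomes cκz,
  -- so that θ² vanishes at z = 0 as it should.
  refine ⟨ht0, fun h => hc0 (by rw [hc, h]; simp), E3, E4, c / s, L, div_ne_zero hc0 hs, ?_, ?_⟩
  · field_simp
    linear_combination -E1
  · intro N hN z hz hne
    rw [key N hN z hz hne]
    field_simp

/-! ### The constants `D₁`, `D₂`, `D₃` -/

lemma rpow_quarter_sq_sq {x : ℝ} (hx : 0 ≤ x) : ((x ^ (1 / 4 : ℝ)) ^ 2) ^ 2 = x := by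
  rw [← pow_mul, ← Real.rpow_natCast, ← Real.rpow_mul hx]
  norm_num

lemma exp_neg_tau_quarter : exp (-(π * I * tau y₁ y₂ / 4)) =
    (Real.exp (π * (tau y₁ y₂).im / 4) : ℝ) := by
  conv_lhs => rw [tau_eq_I_mul]
  rw [ofReal_exp]
  congr 1
  push_cast
  linear_combination (-(π * (tau y₁ y₂).im / 4 : ℂ)) * I_sq

lemma exp_neg_tau : exp (-(π * I * tau y₁ y₂)) =
    (((Real.exp (π * (tau y₁ y₂).im / 4)) ^ 2) ^ 2 : ℝ) := by
  rw [ofReal_pow, ofReal_pow, ← exp_neg_tau_quarter, ← exp_nat_mul, ← exp_nat_mul]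
  congr 1
  push_cast; ring

/-- The relations for theta constants give these identities only after squaring. Apart from the
factor i² in D₂², all quantities are nonnegative reals, so the squares determine them. -/
lemma D_sq_mul_theta (h₂ : 0 < y₂) (h₁ : y₂ < y₁) :
    D₁ y₁ y₂ ^ 2 * theta y₁ y₂ 0 ^ 2 = y₁ * theta y₁ y₂ (tau y₁ y₂ / 2) ^ 2 ∧
    D₂ y₁ y₂ ^ 2 * theta y₁ y₂ (1 / 2) ^ 2 = -theta y₁ y₂ (tau y₁ y₂ / 2) ^ 2 ∧
    D₃ y₁ y₂ ^ 2 * theta y₁ y₂ (1 / 2) ^ 2 = theta y₁ y₂ 0 ^ 2 := by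
  obtain ⟨ht0, ht2, E3, E4, -⟩ := theta_constants h₂ h₁
  obtain ⟨t0, ht0', e0⟩ := jacobiTheta₂_zero_pos (tau_im_pos h₂ h₁) (tau_re (y₁ := y₁) (y₂ := y₂))
  obtain ⟨t1, ht1', e1⟩ := jacobiTheta₂_half_tau_pos (tau_im_pos h₂ h₁)
    (tau_re (y₁ := y₁) (y₂ := y₂))
  obtain ⟨t2, e2⟩ := jacobiTheta₂_half_real (tau_re (y₁ := y₁) (y₂ := y₂))
  change theta y₁ y₂ _ = _ at e0 e1 e2
  rw [e2] at ht2
  have ht2' : t2 ≠ 0 := by exact_mod_cast ht2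
  rw [e0, e1, exp_neg_tau] at E3
  rw [e0, e2] at E4
  rw [e0, e1, e2, D₁, D₂, D₃, exp_neg_tau_quarter]
  have hy1 : 0 < y₁ := h₂.trans h₁
  have hy : 0 < y₁ - y₂ := sub_pos.2 h₁
  set E := Real.exp (π * (tau y₁ y₂).im / 4)
  have hE : 0 < E := Real.exp_pos _
  have r3 : (t1 ^ 2) ^ 2 * y₁ = (E ^ 2) ^ 2 * y₂ * (t0 ^ 2) ^ 2 := by exact_mod_cast E3
  have r4 : (t2 ^ 2) ^ 2 * y₁ = (t0 ^ 2) ^ 2 * (y₁ - y₂) := by exact_mod_cast E4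
  have q1 := rpow_quarter_sq_sq hy1.le
  have q2 := rpow_quarter_sq_sq h₂.le
  have q3 := rpow_quarter_sq_sq hy.le
  have p1 : 0 < y₁ ^ (1 / 4 : ℝ) := by positivity
  have p2 : 0 < y₂ ^ (1 / 4 : ℝ) := by positivity
  have p3 : 0 < (y₁ - y₂) ^ (1 / 4 : ℝ) := by positivity
  rw [Real.mul_rpow hy1.le h₂.le]
  set x1 := y₁ ^ (1 / 4 : ℝ)
  set x2 := y₂ ^ (1 / 4 : ℝ)
  set x3 := (y₁ - y₂) ^ (1 / 4 : ℝ)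
  have c1 : (x1 * x2 * E) ^ 2 * t0 ^ 2 = y₁ * t1 ^ 2 := by
    rw [← sq_eq_sq₀ (by positivity) (by positivity)]
    calc _ = (x1 ^ 2) ^ 2 * (x2 ^ 2) ^ 2 * (E ^ 2) ^ 2 * (t0 ^ 2) ^ 2 := by ring
      _ = _ := by rw [q1, q2]; linear_combination -y₁ * r3
  have c2 : (x2 * E / x3) ^ 2 * t2 ^ 2 = t1 ^ 2 := by
    rw [← sq_eq_sq₀ (by positivity) (by positivity)]
    calc _ = (x2 ^ 2) ^ 2 * (E ^ 2) ^ 2 * (t2 ^ 2) ^ 2 / (x3 ^ 2) ^ 2 := by field_simp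
      _ = _ := by
        rw [q2, q3, div_eq_iff hy.ne']
        refine mul_right_cancel₀ hy1.ne' ?_
        linear_combination y₂ * (E ^ 2) ^ 2 * r4 - (y₁ - y₂) * r3
  have c3 : (x1 / x3) ^ 2 * t2 ^ 2 = t0 ^ 2 := by
    rw [← sq_eq_sq₀ (by positivity) (by positivity)]
    calc _ = (x1 ^ 2) ^ 2 * (t2 ^ 2) ^ 2 / (x3 ^ 2) ^ 2 := by field_simp
      _ = _ := by rw [q1, q3, div_eq_iff hy.ne']; linear_combination r4
  refine ⟨by exact_mod_cast c1, ?_, by exact_mod_cast c3⟩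
  rw [mul_pow, I_sq, neg_one_mul, neg_mul]
  congr 1
  exact_mod_cast c2

lemma D_ne_zero (h₂ : 0 < y₂) (h₁ : y₂ < y₁) :
    D₁ y₁ y₂ ≠ 0 ∧ D₂ y₁ y₂ ≠ 0 ∧ D₃ y₁ y₂ ≠ 0 := by
  have hy1 : 0 < y₁ := h₂.trans h₁
  have hy : 0 < y₁ - y₂ := sub_pos.2 h₁
  have p (x : ℝ) (hx : 0 < x) : (((x ^ (1 / 4 : ℝ) : ℝ)) : ℂ) ≠ 0 := by
    exact_mod_cast (Real.rpow_pos_of_pos hx _).ne'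
  exact ⟨mul_ne_zero (p _ (by positivity)) (exp_ne_zero _),
    mul_ne_zero I_ne_zero (div_ne_zero (mul_ne_zero (p _ h₂) (exp_ne_zero _)) (p _ hy)),
    div_ne_zero (p _ hy1) (p _ hy)⟩

lemma D_sq_conj : starRingEnd ℂ (D₁ y₁ y₂ ^ 2) = D₁ y₁ y₂ ^ 2 ∧
    starRingEnd ℂ (D₂ y₁ y₂ ^ 2) = D₂ y₁ y₂ ^ 2 ∧ starRingEnd ℂ (D₃ y₁ y₂ ^ 2) = D₃ y₁ y₂ ^ 2 := by
  rw [D₁, D₂, D₃, exp_neg_tau_quarter]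
  simp only [map_pow, map_mul, map_div₀, conj_ofReal, conj_I]
  refine ⟨trivial, by ring, trivial⟩

/-! ### The identities in homogeneous form -/

/-- The values of `θ²` and of the three numerators at `u` are those prescribed by the point
`p / q` of the Riemann sphere, up to a common nonzero factor. -/
def ThetaValues (y₁ y₂ : ℝ) (u p q : ℂ) : Prop :=
  ∃ ρ : ℂ, ρ ≠ 0 ∧ theta y₁ y₂ u ^ 2 = ρ * p ∧ num₁ y₁ y₂ u = ρ * (D₁ y₁ y₂ ^ 2 * q) ∧
    num₂ y₁ y₂ u = ρ * (D₂ y₁ y₂ ^ 2 * (p - y₁ * q)) ∧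
    num₃ y₁ y₂ u = ρ * (D₃ y₁ y₂ ^ 2 * (p - y₂ * q))

namespace ThetaValues

variable {u p q : ℂ}

lemma add_one (h₂ : 0 < y₂) (h₁ : y₂ < y₁) : ThetaValues y₁ y₂ (u + 1) p q ↔
    ThetaValues y₁ y₂ u p q := by
  have hA := (secondOrder_theta h₂ h₁).add_one u
  rw [ThetaValues, hA, (secondOrder_num₁ h₂ h₁).add_one, (secondOrder_num₂ h₂ h₁).add_one,
    (secondOrder_num₃ h₂ h₁).add_one, ThetaValues]

lemma neg (h₂ : 0 < y₂) (h₁ : y₂ < y₁) : ThetaValues y₁ y₂ (-u) p q ↔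
    ThetaValues y₁ y₂ u p q := by
  have hA := (secondOrder_theta h₂ h₁).even u
  rw [ThetaValues, hA, (secondOrder_num₁ h₂ h₁).even, (secondOrder_num₂ h₂ h₁).even,
    (secondOrder_num₃ h₂ h₁).even, ThetaValues]

/-- All four functions acquire the same automorphy factor, which is absorbed into ρ. -/
lemma add_tau (h₂ : 0 < y₂) (h₁ : y₂ < y₁) (h : ThetaValues y₁ y₂ u p q) :
    ThetaValues y₁ y₂ (u + tau y₁ y₂) p q := by
  obtain ⟨ρ, hρ, a, b, c, d⟩ := h
  have hA := (secondOrder_theta h₂ h₁).add_tau u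
  refine ⟨exp (-2 * π * I * (tau y₁ y₂ + 2 * u)) * ρ, mul_ne_zero (exp_ne_zero _) hρ, ?_⟩
  rw [hA, (secondOrder_num₁ h₂ h₁).add_tau, (secondOrder_num₂ h₂ h₁).add_tau,
    (secondOrder_num₃ h₂ h₁).add_tau, a, b, c, d]
  simp only [mul_assoc, and_self]

lemma conj (h₂ : 0 < y₂) (h₁ : y₂ < y₁) (h : ThetaValues y₁ y₂ u p q) :
    ThetaValues y₁ y₂ (starRingEnd ℂ u) (starRingEnd ℂ p) (starRingEnd ℂ q) := by
  obtain ⟨ρ, hρ, a, b, c, d⟩ := h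
  have hA := (secondOrder_theta h₂ h₁).conj u
  obtain ⟨c1, c2, c3⟩ := D_sq_conj (y₁ := y₁) (y₂ := y₂)
  refine ⟨starRingEnd ℂ ρ, by simpa using hρ, ?_⟩
  rw [← hA, ← (secondOrder_num₁ h₂ h₁).conj, ← (secondOrder_num₂ h₂ h₁).conj,
    ← (secondOrder_num₃ h₂ h₁).conj, a, b, c, d]
  simp only [map_mul, map_sub, conj_ofReal, c1, c2, c3, and_self]

lemma of_add_tau (h₂ : 0 < y₂) (h₁ : y₂ < y₁) (h : ThetaValues y₁ y₂ (u + tau y₁ y₂) p q) :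
    ThetaValues y₁ y₂ u p q := by
  have := ((neg h₂ h₁).2 h).add_tau h₂ h₁
  rw [show -(u + tau y₁ y₂) + tau y₁ y₂ = -u by ring] at this
  exact (neg h₂ h₁).1 this

lemma of_mk_eq (h₂ : 0 < y₂) (h₁ : y₂ < y₁) {v : ℂ} (h : ThetaValues y₁ y₂ u p q)
    (huv : (u : ℂ ⧸ lattice y₁ y₂) = v) : ThetaValues y₁ y₂ v p q := by
  have hmem := QuotientAddGroup.eq.1 huv
  have key : ∀ ω ∈ lattice y₁ y₂, ∀ u, ThetaValues y₁ y₂ u p q ↔ ThetaValues y₁ y₂ (u + ω) p q := by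
    intro ω hω
    induction hω using AddSubgroup.closure_induction with
    | mem x hx =>
      intro u
      rcases hx with rfl | rfl
      · exact (add_one h₂ h₁).symm
      · exact ⟨fun h => h.add_tau h₂ h₁, fun h => h.of_add_tau h₂ h₁⟩
    | zero => simp
    | add x y _ _ hx hy => intro u; rw [hx, hy, add_assoc]
    | neg x _ hx => intro u; rw [hx (u + -x), neg_add_cancel_right]
  have := (key _ hmem u).1 h
  rwa [add_neg_cancel_left] at this

end ThetaValues

lemma thetaValues_infty (h₂ : 0 < y₂) (h₁ : y₂ < y₁) : ThetaValues y₁ y₂ (1 / 2) 1 0 := by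
  obtain ⟨-, e2, e3⟩ := D_sq_mul_theta h₂ h₁
  refine ⟨theta y₁ y₂ (1 / 2) ^ 2, pow_ne_zero _ (theta_constants h₂ h₁).2.1, ?_⟩
  rw [num₁_half, num₂_half, num₃_half, ← e2, ← e3]
  exact ⟨by ring, by ring, by ring, by ring⟩

/-- The point y₁ is excluded from the affine formula because σ² vanishes there; its values come
directly from the theta constants. -/
lemma thetaValues_y₁ (h₂ : 0 < y₂) (h₁ : y₂ < y₁) : ThetaValues y₁ y₂ 0 y₁ 1 := by
  obtain ⟨ht0, ht2, -, E4, -⟩ := theta_constants h₂ h₁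
  obtain ⟨e1, -, e3⟩ := D_sq_mul_theta h₂ h₁
  have hy₁ : (y₁ : ℂ) ≠ 0 := by exact_mod_cast (h₂.trans h₁).ne'
  refine ⟨theta y₁ y₂ 0 ^ 2 / y₁, div_ne_zero (pow_ne_zero _ ht0) hy₁, ?_⟩
  rw [num₁_zero, num₂_zero, num₃_zero]
  refine ⟨by field_simp, ?_, by ring, ?_⟩
  · rw [div_mul_eq_mul_div, eq_div_iff hy₁]
    linear_combination -e1
  · rw [div_mul_eq_mul_div, eq_div_iff hy₁]
    refine mul_right_cancel₀ (pow_ne_zero 2 ht2) ?_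
    linear_combination E4 - theta y₁ y₂ 0 ^ 2 * (y₁ - y₂) * e3

lemma thetaValues_abelInt (h₂ : 0 < y₂) (h₁ : y₂ < y₁) {z : ℂ} (hz : 0 ≤ z.im) :
    ThetaValues y₁ y₂ (abelInt y₁ y₂ z) z 1 := by
  rcases eq_or_ne z y₁ with rfl | hne
  · rw [abelInt_y₁]; exact thetaValues_y₁ h₂ h₁
  obtain ⟨ht0, ht2, -, E4, κ, L, hκ, hκL, key⟩ := theta_constants h₂ h₁
  obtain ⟨e1, e2, e3⟩ := D_sq_mul_theta h₂ h₁
  have hs := sigmaSq_abelInt_ne_zero h₂ h₁ hz hne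
  have hzy : z - y₁ ≠ 0 := sub_ne_zero.2 hne
  have hA := key _ (secondOrder_theta h₂ h₁) z hz hne
  have hB := key _ (secondOrder_num₁ h₂ h₁) z hz hne
  have hC := key _ (secondOrder_num₂ h₂ h₁) z hz hne
  have hD := key _ (secondOrder_num₃ h₂ h₁) z hz hne
  rw [num₁_half, num₁_zero] at hB
  rw [num₂_half, num₂_zero] at hC
  rw [num₃_half, num₃_zero] at hD
  set σ := sigmaSq (tau y₁ y₂) (abelInt y₁ y₂ z)
  set a := theta y₁ y₂ 0 ^ 2
  set b := theta y₁ y₂ (tau y₁ y₂ / 2) ^ 2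
  set c := theta y₁ y₂ (1 / 2) ^ 2
  have ha0 : a ≠ 0 := pow_ne_zero _ ht0
  have hc0 : c ≠ 0 := pow_ne_zero _ ht2
  have hc : (z - y₁) * c ≠ 0 := mul_ne_zero hzy hc0
  -- The common factor is what remains of θ² after division by z, as the affine factor of θ² is
  -- proportional to z.
  refine ⟨σ * κ / (z - y₁), div_ne_zero (mul_ne_zero hs hκ) hzy, ?_, ?_, ?_, ?_⟩ <;>
    rw [div_mul_eq_mul_div, eq_div_iff hzy] <;> refine mul_right_cancel₀ hc0 ?_
  · linear_combination hA - σ * c * hκL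
  · refine mul_right_cancel₀ ha0 ?_
    linear_combination a * hB - σ * κ * c * e1 - σ * b * c * hκL
  · linear_combination hC - σ * κ * (z - y₁) * e2
  · have hy₁ : (y₁ : ℂ) ≠ 0 := by exact_mod_cast (h₂.trans h₁).ne'
    have E5 : c ^ 2 * L = a * κ * (y₁ - y₂) := by
      refine mul_right_cancel₀ (mul_ne_zero ha0 hy₁) ?_
      linear_combination a * L * E4 - a ^ 2 * (y₁ - y₂) * hκL
    linear_combination hD - σ * κ * (z - y₂) * e3 + σ * E5

/-! ### The lattice -/

lemma mem_lattice_iff {u : ℂ} : u ∈ lattice y₁ y₂ ↔ ∃ m n : ℤ, m + n * tau y₁ y₂ = u := by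
  rw [lattice, AddSubgroup.mem_closure_pair]
  simp

/-- Closedness makes the quotient ℂ/(ℤ + τℤ) Hausdorff, so that the limits defining the Abel map are
unique. -/
lemma isClosed_lattice (h₂ : 0 < y₂) (h₁ : y₂ < y₁) :
    IsClosed (lattice y₁ y₂ : Set ℂ) := by
  have hT := tau_im_pos h₂ h₁
  have hZ : IsClosed (Set.range ((↑) : ℤ → ℝ)) := Int.isClosedEmbedding_coe_real.isClosed_range
  have e : (lattice y₁ y₂ : Set ℂ) = {u : ℂ | u.re ∈ Set.range ((↑) : ℤ → ℝ)} ∩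
      {u : ℂ | u.im / (tau y₁ y₂).im ∈ Set.range ((↑) : ℤ → ℝ)} := by
    ext u
    rw [SetLike.mem_coe, mem_lattice_iff]
    constructor
    · rintro ⟨m, n, rfl⟩
      exact ⟨⟨m, by simp [tau_re]⟩, ⟨n, by simp [hT.ne']⟩⟩
    · rintro ⟨⟨m, hm⟩, ⟨n, hn⟩⟩
      rw [eq_div_iff hT.ne'] at hn
      exact ⟨m, n, Complex.ext (by simp [tau_re, hm]) (by simp [hn])⟩
  rw [e]
  exact (hZ.preimage Complex.continuous_re).inter (hZ.preimage (by fun_prop))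

lemma mk_eq_mk_iff {u v : ℂ} :
    (u : ℂ ⧸ lattice y₁ y₂) = v ↔ ∃ m n : ℤ, m + n * tau y₁ y₂ = v - u := by
  rw [QuotientAddGroup.eq, neg_add_eq_sub, mem_lattice_iff]

lemma continuous_mk_lattice : Continuous fun u : ℂ => (u : ℂ ⧸ lattice y₁ y₂) :=
  continuous_quot_mk

/-! ### The function `φ` on the two sheets -/

lemma abelInt_conj (h₂ : 0 < y₂) (h₁ : y₂ < y₁) {z : ℂ} (hz : z ∈ cutPlane y₁) :
    abelInt y₁ y₂ (starRingEnd ℂ z) = starRingEnd ℂ (abelInt y₁ y₂ z) := by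
  rw [abelInt, segInt, abelInt, segInt, intervalIntegral.integral_of_le zero_le_one,
    intervalIntegral.integral_of_le zero_le_one, ← integral_conj]
  refine setIntegral_congr_fun measurableSet_Ioc fun t ht => ?_
  have hm : (y₁ : ℂ) + t * (z - y₁) ∈ cutPlane y₁ := by
    rintro ⟨h1, h2⟩
    simp only [add_im, add_re, mul_im, mul_re, ofReal_im, ofReal_re, sub_im, sub_re, zero_mul,
      add_zero, zero_add, sub_zero] at h1 h2
    refine hz ⟨?_, ?_⟩
    · simpa [ht.1.ne'] using h1
    · nlinarith [ht.1]
  have := sqrtR_conj h₂ h₁ hm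
  simp only [map_add, map_mul, map_sub, conj_ofReal] at this
  simp only [map_mul, map_div₀, map_sub, conj_ofReal, this]

lemma phi_eq (p : affineCurve y₁ y₂) :
    ∃ ε : ℂ, (ε = 1 ∨ ε = -1) ∧ p.1.2 = ε * sqrtR y₁ y₂ p.1.1 ∧
      phi y₁ y₂ p = ε * abelInt y₁ y₂ p.1.1 := by
  have hw : p.1.2 ^ 2 = sqrtR y₁ y₂ p.1.1 ^ 2 := by rw [sqrtR_sq]; exact p.2
  have hε : ∀ ε : ℂ, (∫ t in (0 : ℝ)..1, ε * c₀ y₁ y₂ / sqrtR y₁ y₂ (y₁ + t * (p.1.1 - y₁)) *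
      (p.1.1 - y₁)) = ε * abelInt y₁ y₂ p.1.1 := fun ε => by
    rw [abelInt, segInt, ← intervalIntegral.integral_const_mul]
    simp only [mul_div_assoc, mul_assoc]
  by_cases h : p.1.2 = sqrtR y₁ y₂ p.1.1
  · refine ⟨1, Or.inl rfl, by rw [one_mul, h], ?_⟩
    rw [phi]
    simp only [if_pos h]
    exact hε 1
  · refine ⟨-1, Or.inr rfl, by rw [neg_one_mul]; exact (sq_eq_sq_iff_eq_or_eq_neg.1 hw).resolve_left h,
      ?_⟩
    rw [phi]
    simp only [if_neg h]
    exact hε (-1)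

/-- The sign of the sheet, defined by a case distinction, is rewritten as w/√R, which is visibly
continuous away from branch points. -/
lemma phi_eq_upper (h₂ : 0 < y₂) (h₁ : y₂ < y₁) {p : affineCurve y₁ y₂}
    (hp : p ∈ slitPart y₁ y₂) :
    phi y₁ y₂ p = p.1.2 / sqrtR y₁ y₂ p.1.1 * abelInt y₁ y₂ p.1.1 := by
  obtain ⟨ε, -, hw, h⟩ := phi_eq p
  rw [h, hw, mul_div_cancel_right₀ _ (sqrtR_ne_zero h₂ h₁ hp)]

/-- √R and the Abel integral extend continuously to the cut only from above; conjugation reduces the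
approach from below to that case. -/
lemma phi_eq_lower (h₂ : 0 < y₂) (h₁ : y₂ < y₁) {p : affineCurve y₁ y₂}
    (hp : p ∈ slitPart y₁ y₂) :
    phi y₁ y₂ p = p.1.2 / starRingEnd ℂ (sqrtR y₁ y₂ (starRingEnd ℂ p.1.1)) *
      starRingEnd ℂ (abelInt y₁ y₂ (starRingEnd ℂ p.1.1)) := by
  rw [phi_eq_upper h₂ h₁ hp, sqrtR_conj h₂ h₁ hp, abelInt_conj h₂ h₁ hp, conj_conj, conj_conj]

/-- The part of the slit sheets over the closed upper half plane. -/
def upperPart (y₁ y₂ : ℝ) : Set (affineCurve y₁ y₂) := slitPart y₁ y₂ ∩ {p | 0 ≤ p.1.1.im}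

/-- The part of the slit sheets over the closed lower half plane. -/
def lowerPart (y₁ y₂ : ℝ) : Set (affineCurve y₁ y₂) := slitPart y₁ y₂ ∩ {p | p.1.1.im ≤ 0}

lemma slitPart_eq : slitPart y₁ y₂ = upperPart y₁ y₂ ∪ lowerPart y₁ y₂ := by
  rw [upperPart, lowerPart, ← Set.inter_union_distrib_left, eq_comm, Set.inter_eq_left]
  exact fun p _ => le_total 0 p.1.1.im

lemma tendsto_slitPart {α : Type*} {l : Filter (affineCurve y₁ y₂)} {m : Filter α}
    {f : affineCurve y₁ y₂ → α} (hu : Tendsto f (l ⊓ 𝓟 (upperPart y₁ y₂)) m)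
    (hl : Tendsto f (l ⊓ 𝓟 (lowerPart y₁ y₂)) m) : Tendsto f (l ⊓ 𝓟 (slitPart y₁ y₂)) m := by
  rw [slitPart_eq, ← sup_principal, inf_sup_left]
  exact hu.sup hl

lemma tendsto_fst_upper {p₀ : affineCurve y₁ y₂} :
    Tendsto (fun p : affineCurve y₁ y₂ => p.1.1) (𝓝 p₀ ⊓ 𝓟 (upperPart y₁ y₂))
      (𝓝[{z | 0 ≤ z.im}] p₀.1.1) := by
  refine tendsto_nhdsWithin_iff.2 ⟨?_, ?_⟩
  · have : Continuous fun p : affineCurve y₁ y₂ => p.1.1 := by fun_prop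
    exact (this.tendsto p₀).mono_left inf_le_left
  · exact (eventually_principal.2 fun p hp => hp.2).filter_mono inf_le_right

lemma tendsto_conj_fst_lower {p₀ : affineCurve y₁ y₂} :
    Tendsto (fun p : affineCurve y₁ y₂ => starRingEnd ℂ p.1.1) (𝓝 p₀ ⊓ 𝓟 (lowerPart y₁ y₂))
      (𝓝[{z | 0 ≤ z.im}] (starRingEnd ℂ p₀.1.1)) := by
  refine tendsto_nhdsWithin_iff.2 ⟨?_, ?_⟩
  · have : Continuous fun p : affineCurve y₁ y₂ => starRingEnd ℂ p.1.1 :=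
      continuous_conj.comp (by fun_prop)
    exact (this.tendsto p₀).mono_left inf_le_left
  · refine (eventually_principal.2 fun p hp => ?_).filter_mono inf_le_right
    simpa using hp.2

lemma tendsto_snd {p₀ : affineCurve y₁ y₂} {s : Set (affineCurve y₁ y₂)} :
    Tendsto (fun p : affineCurve y₁ y₂ => p.1.2) (𝓝 p₀ ⊓ 𝓟 s) (𝓝 p₀.1.2) := by
  have : Continuous fun p : affineCurve y₁ y₂ => p.1.2 := by fun_prop
  exact (this.tendsto p₀).mono_left inf_le_left

lemma eventually_mem_inf {l : Filter (affineCurve y₁ y₂)} {s : Set (affineCurve y₁ y₂)} :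
    ∀ᶠ p in l ⊓ 𝓟 s, p ∈ s :=
  (eventually_principal.2 fun _ hp => hp).filter_mono inf_le_right

lemma tendsto_phi_upper (h₂ : 0 < y₂) (h₁ : y₂ < y₁) {p₀ : affineCurve y₁ y₂}
    (hz : 0 ≤ p₀.1.1.im) (hr : sqrtR y₁ y₂ p₀.1.1 ≠ 0) :
    Tendsto (phi y₁ y₂) (𝓝 p₀ ⊓ 𝓟 (upperPart y₁ y₂))
      (𝓝 (p₀.1.2 / sqrtR y₁ y₂ p₀.1.1 * abelInt y₁ y₂ p₀.1.1)) := by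
  refine Tendsto.congr' (eventually_mem_inf.mono fun p hp => (phi_eq_upper h₂ h₁ hp.1).symm) ?_
  exact (tendsto_snd.div ((continuousOn_sqrtR _ hz).tendsto.comp tendsto_fst_upper) hr).mul
    ((continuousOn_abelInt h₂ h₁ _ hz).tendsto.comp tendsto_fst_upper)

lemma tendsto_phi_lower (h₂ : 0 < y₂) (h₁ : y₂ < y₁) {p₀ : affineCurve y₁ y₂}
    (hz : p₀.1.1.im ≤ 0) (hr : sqrtR y₁ y₂ (starRingEnd ℂ p₀.1.1) ≠ 0) :
    Tendsto (phi y₁ y₂) (𝓝 p₀ ⊓ 𝓟 (lowerPart y₁ y₂))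
      (𝓝 (p₀.1.2 / starRingEnd ℂ (sqrtR y₁ y₂ (starRingEnd ℂ p₀.1.1)) *
        starRingEnd ℂ (abelInt y₁ y₂ (starRingEnd ℂ p₀.1.1)))) := by
  refine Tendsto.congr' (eventually_mem_inf.mono fun p hp => (phi_eq_lower h₂ h₁ hp.1).symm) ?_
  have hz' : 0 ≤ (starRingEnd ℂ p₀.1.1).im := by simpa using hz
  refine (tendsto_snd.div ((continuous_conj.tendsto _).comp
    ((continuousOn_sqrtR _ hz').tendsto.comp tendsto_conj_fst_lower)) (by simpa using hr)).mul
    ((continuous_conj.tendsto _).comp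
      ((continuousOn_abelInt h₂ h₁ _ hz').tendsto.comp tendsto_conj_fst_lower))

/-- Signs do not matter for convergence to a half period. -/
lemma tendsto_mk_of_half_period {α : Type*} {l : Filter α} {f g : α → ℂ} {s : ℂ} {m n : ℤ}
    (hs : 2 * s = m + n * tau y₁ y₂) (hg : Tendsto g l (𝓝 s))
    (hf : ∀ᶠ x in l, ∃ ε : ℂ, (ε = 1 ∨ ε = -1) ∧ f x = ε * g x) :
    Tendsto (fun x => (f x : ℂ ⧸ lattice y₁ y₂)) l (𝓝 (s : ℂ ⧸ lattice y₁ y₂)) := by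
  classical
  -- The deviation of f from whichever of s, -s it approaches. Since 2s lies in the lattice, s and
  -- -s have the same class, so f is congruent to k + s.
  set k : α → ℂ := fun x => if f x = g x then f x - s else f x + s with hk
  have hk0 : Tendsto k l (𝓝 0) := by
    refine squeeze_zero_norm' ?_ (tendsto_iff_norm_sub_tendsto_zero.1 hg)
    filter_upwards [hf] with x hx
    obtain ⟨ε, rfl | rfl, hx⟩ := hx
    · rw [one_mul] at hx
      simp [hk, hx]
    · rw [neg_one_mul] at hx
      by_cases h : f x = g x
      · simp only [hk, if_pos h]; rw [h]
      · simp only [hk, if_neg h, hx]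
        rw [← norm_neg, neg_add, neg_neg, sub_eq_add_neg]
  have h1 : Tendsto (fun x => ((k x + s : ℂ) : ℂ ⧸ lattice y₁ y₂)) l
      (𝓝 (s : ℂ ⧸ lattice y₁ y₂)) := by
    have := (continuous_mk_lattice (y₁ := y₁) (y₂ := y₂)).tendsto (0 + s)
    rw [zero_add] at this
    refine this.comp ?_
    simpa using hk0.add_const s
  refine h1.congr fun x => ?_
  rw [mk_eq_mk_iff]
  by_cases h : f x = g x
  · exact ⟨0, 0, by simp [hk, h]⟩
  · exact ⟨-m, -n, by simp only [hk, if_neg h]; push_cast; linear_combination hs⟩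

/-- At a branch point both sheets come together and w/√R is no longer available, but φ there is a
half period, so the undetermined sign disappears modulo the lattice. -/
lemma tendsto_phi_branch (h₂ : 0 < y₂) (h₁ : y₂ < y₁) {p₀ : affineCurve y₁ y₂}
    (hz : p₀.1.1.im = 0) {m n : ℤ} (hs : 2 * abelInt y₁ y₂ p₀.1.1 = m + n * tau y₁ y₂) :
    Tendsto (fun p => (phi y₁ y₂ p : ℂ ⧸ lattice y₁ y₂)) (𝓝 p₀ ⊓ 𝓟 (slitPart y₁ y₂))
      (𝓝 (abelInt y₁ y₂ p₀.1.1 : ℂ ⧸ lattice y₁ y₂)) := by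
  have hzc : starRingEnd ℂ p₀.1.1 = p₀.1.1 := Complex.conj_eq_iff_im.2 hz
  refine tendsto_slitPart ?_ ?_
  · refine tendsto_mk_of_half_period hs
      ((continuousOn_abelInt h₂ h₁ _ hz.ge).tendsto.comp tendsto_fst_upper) ?_
    filter_upwards [eventually_mem_inf] with p hp
    obtain ⟨ε, hε, -, h⟩ := phi_eq p
    exact ⟨ε, hε, h⟩
  · have hs' : 2 * starRingEnd ℂ (abelInt y₁ y₂ p₀.1.1) = m + (-n : ℤ) * tau y₁ y₂ := by
      have := congrArg (starRingEnd ℂ) hs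
      simp only [map_add, map_mul, conj_eq_neg_of_re_eq_zero tau_re, map_intCast,
        show starRingEnd ℂ 2 = 2 from conj_ofReal 2] at this
      rw [this]; push_cast; ring
    have hconv : Tendsto (fun p : affineCurve y₁ y₂ => starRingEnd ℂ (abelInt y₁ y₂
        (starRingEnd ℂ p.1.1))) (𝓝 p₀ ⊓ 𝓟 (lowerPart y₁ y₂))
        (𝓝 (starRingEnd ℂ (abelInt y₁ y₂ p₀.1.1))) := by
      refine (continuous_conj.tendsto _).comp ?_
      have := (continuousOn_abelInt h₂ h₁ p₀.1.1 hz.ge).tendsto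
      refine this.comp ?_
      simpa only [hzc] using tendsto_conj_fst_lower (p₀ := p₀)
    have h := tendsto_mk_of_half_period hs' hconv (f := phi y₁ y₂) ?_
    · have e : ((starRingEnd ℂ (abelInt y₁ y₂ p₀.1.1) : ℂ) : ℂ ⧸ lattice y₁ y₂) =
          (abelInt y₁ y₂ p₀.1.1 : ℂ ⧸ lattice y₁ y₂) := by
        refine mk_eq_mk_iff.2 ⟨0, n, ?_⟩
        push_cast at hs' ⊢
        linear_combination (hs' - hs) / 2
      rwa [e] at h
    · filter_upwards [eventually_mem_inf] with p hp
      obtain ⟨ε, hε, -, h⟩ := phi_eq p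
      exact ⟨ε, hε, by rw [h, abelInt_conj h₂ h₁ hp.1, conj_conj]⟩

/-! ### The Abel map -/

lemma thetaValues_sign_mul (h₂ : 0 < y₂) (h₁ : y₂ < y₁) {u p q ε : ℂ} (hε : ε ^ 2 = 1)
    (h : ThetaValues y₁ y₂ u p q) : ThetaValues y₁ y₂ (ε * u) p q := by
  have : ε = 1 ∨ ε = -1 := by rw [← sq_eq_sq_iff_eq_or_eq_neg, hε, one_pow]
  rcases this with rfl | rfl
  · rwa [one_mul]
  · rw [neg_one_mul]
    exact (ThetaValues.neg h₂ h₁).2 h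

lemma exists_tendsto_phi_of_im_pos (h₂ : 0 < y₂) (h₁ : y₂ < y₁) {p₀ : affineCurve y₁ y₂}
    (hz : 0 < p₀.1.1.im) : ∃ u : ℂ, ThetaValues y₁ y₂ u p₀.1.1 1 ∧
      Tendsto (fun p => (phi y₁ y₂ p : ℂ ⧸ lattice y₁ y₂)) (𝓝 p₀ ⊓ 𝓟 (slitPart y₁ y₂)) (𝓝 u) := by
  have hr := sqrtR_ne_zero h₂ h₁ (mem_cutPlane_of_im_pos hz)
  refine ⟨p₀.1.2 / sqrtR y₁ y₂ p₀.1.1 * abelInt y₁ y₂ p₀.1.1,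
    thetaValues_sign_mul h₂ h₁ ?_ (thetaValues_abelInt h₂ h₁ hz.le), ?_⟩
  · rw [div_pow, div_eq_one_iff_eq (pow_ne_zero _ hr), sqrtR_sq]; exact p₀.2
  · refine ((continuous_mk_lattice.tendsto _).comp (tendsto_phi_upper h₂ h₁ hz.le hr)).mono_left ?_
    refine le_inf inf_le_left (le_principal_iff.2 ?_)
    have : Continuous fun p : affineCurve y₁ y₂ => p.1.1.im := by fun_prop
    filter_upwards [eventually_mem_inf, ((this.tendsto p₀).eventually_const_lt hz).filter_mono
      inf_le_left] with p hp hp'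
    exact ⟨hp, hp'.le⟩

lemma exists_tendsto_phi_of_im_neg (h₂ : 0 < y₂) (h₁ : y₂ < y₁) {p₀ : affineCurve y₁ y₂}
    (hz : p₀.1.1.im < 0) : ∃ u : ℂ, ThetaValues y₁ y₂ u p₀.1.1 1 ∧
      Tendsto (fun p => (phi y₁ y₂ p : ℂ ⧸ lattice y₁ y₂)) (𝓝 p₀ ⊓ 𝓟 (slitPart y₁ y₂)) (𝓝 u) := by
  have hz' : 0 < (starRingEnd ℂ p₀.1.1).im := by simpa using hz
  have hr := sqrtR_ne_zero h₂ h₁ (mem_cutPlane_of_im_pos hz')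
  refine ⟨p₀.1.2 / starRingEnd ℂ (sqrtR y₁ y₂ (starRingEnd ℂ p₀.1.1)) *
    starRingEnd ℂ (abelInt y₁ y₂ (starRingEnd ℂ p₀.1.1)), thetaValues_sign_mul h₂ h₁ ?_ ?_, ?_⟩
  · rw [div_pow, div_eq_one_iff_eq (pow_ne_zero _ (by simpa using hr)), ← map_pow, sqrtR_sq]
    simp only [map_mul, map_sub, conj_conj, conj_ofReal]
    exact p₀.2
  · simpa using (thetaValues_abelInt h₂ h₁ hz'.le).conj h₂ h₁
  · refine ((continuous_mk_lattice.tendsto _).comp (tendsto_phi_lower h₂ h₁ hz.le hr)).mono_left ?_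
    refine le_inf inf_le_left (le_principal_iff.2 ?_)
    have : Continuous fun p : affineCurve y₁ y₂ => p.1.1.im := by fun_prop
    filter_upwards [eventually_mem_inf, ((this.tendsto p₀).eventually_lt_const hz).filter_mono
      inf_le_left] with p hp hp'
    exact ⟨hp, hp'.le⟩

/-- The boundary values of `φ` from both sides of the real line agree modulo the lattice. -/
lemma mk_boundary_eq (h₂ : 0 < y₂) (h₁ : y₂ < y₁) {x : ℝ} {w : ℂ}
    (hw : w ^ 2 = sqrtR y₁ y₂ x ^ 2) (hr : sqrtR y₁ y₂ x ≠ 0) :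
    ((w / sqrtR y₁ y₂ x * abelInt y₁ y₂ x : ℂ) : ℂ ⧸ lattice y₁ y₂) =
      ((w / starRingEnd ℂ (sqrtR y₁ y₂ x) * starRingEnd ℂ (abelInt y₁ y₂ x) : ℂ) :
        ℂ ⧸ lattice y₁ y₂) := by
  rw [mk_eq_mk_iff]
  obtain ⟨s, hs⟩ : ∃ s : ℤ, w = s * sqrtR y₁ y₂ x := by
    rcases sq_eq_sq_iff_eq_or_eq_neg.1 hw with h | h
    · exact ⟨1, by simpa using h⟩
    · exact ⟨-1, by simpa using h⟩
  have hr' : starRingEnd ℂ (sqrtR y₁ y₂ x) ≠ 0 := by simpa using hr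
  -- On the real line √R is real or purely imaginary, so the sign on reaching the point from below
  -- is kept or flipped. Going left through the four intervals, the two boundary values differ by 0,
  -- 0, -sτ, -s.
  have same (h : starRingEnd ℂ (sqrtR y₁ y₂ x) = sqrtR y₁ y₂ x) :
      w / starRingEnd ℂ (sqrtR y₁ y₂ x) = s ∧ w / sqrtR y₁ y₂ x = s := by
    rw [h, hs, mul_div_cancel_right₀ _ hr]; simp
  have opp (h : starRingEnd ℂ (sqrtR y₁ y₂ x) = -sqrtR y₁ y₂ x) :
      w / starRingEnd ℂ (sqrtR y₁ y₂ x) = -s ∧ w / sqrtR y₁ y₂ x = s := by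
    rw [h, hs, _root_.div_neg, mul_div_cancel_right₀ _ hr]; simp
  rcases le_total y₁ x with h | h
  · obtain ⟨e1, e2⟩ := same (by rw [sqrtR_of_ge h₂ h₁ h, conj_ofReal])
    exact ⟨0, 0, by rw [e1, e2, conj_abelInt_of_ge h₂ h₁ h]; simp⟩
  rcases le_total y₂ x with h' | h'
  · obtain ⟨e1, e2⟩ := opp (by rw [sqrtR_of_mid h₂ h' h, map_mul, conj_ofReal, conj_I, neg_mul])
    exact ⟨0, 0, by rw [e1, e2, conj_abelInt_of_mid h₂ h₁ h' h]; simp⟩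
  rcases le_total 0 x with h'' | h''
  · obtain ⟨e1, e2⟩ := same (by rw [sqrtR_of_low h₁ h'' h', map_neg, conj_ofReal])
    exact ⟨0, -s, by rw [e1, e2, conj_abelInt_of_low h₂ h₁ h'' h']; push_cast; ring⟩
  · obtain ⟨e1, e2⟩ := opp (by
      rw [sqrtR_of_neg h₂ h₁ h'', map_mul, conj_ofReal, map_neg, conj_I, neg_mul])
    exact ⟨-s, 0, by rw [e1, e2, conj_abelInt_of_neg h₂ h₁ h'']; push_cast; ring⟩

lemma exists_tendsto_phi_of_im_eq_zero (h₂ : 0 < y₂) (h₁ : y₂ < y₁) {p₀ : affineCurve y₁ y₂}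
    (hz : p₀.1.1.im = 0) : ∃ u : ℂ, ThetaValues y₁ y₂ u p₀.1.1 1 ∧
      Tendsto (fun p => (phi y₁ y₂ p : ℂ ⧸ lattice y₁ y₂)) (𝓝 p₀ ⊓ 𝓟 (slitPart y₁ y₂)) (𝓝 u) := by
  have hT := thetaValues_abelInt h₂ h₁ hz.ge
  by_cases hr : sqrtR y₁ y₂ p₀.1.1 = 0
  · obtain ⟨m, n, hmn⟩ : ∃ m n : ℤ, 2 * abelInt y₁ y₂ p₀.1.1 = m + n * tau y₁ y₂ := by
      rcases (sqrtR_eq_zero_iff _).1 hr with h | h | h <;> rw [h]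
      · exact ⟨1, 1, by rw [abelInt_zero h₂ h₁]; push_cast; ring⟩
      · exact ⟨0, 1, by rw [abelInt_y₂ h₂ h₁]; push_cast; ring⟩
      · exact ⟨0, 0, by rw [abelInt_y₁]; simp⟩
    exact ⟨_, hT, tendsto_phi_branch h₂ h₁ hz hmn⟩
  have hw : p₀.1.2 ^ 2 = sqrtR y₁ y₂ p₀.1.1 ^ 2 := by rw [sqrtR_sq]; exact p₀.2
  have hzc : starRingEnd ℂ p₀.1.1 = p₀.1.1 := Complex.conj_eq_iff_im.2 hz
  refine ⟨p₀.1.2 / sqrtR y₁ y₂ p₀.1.1 * abelInt y₁ y₂ p₀.1.1,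
    thetaValues_sign_mul h₂ h₁ ?_ hT, tendsto_slitPart ?_ ?_⟩
  · rw [div_pow, hw, div_self (pow_ne_zero _ hr)]
  · exact (continuous_mk_lattice.tendsto _).comp (tendsto_phi_upper h₂ h₁ hz.ge hr)
  · have e := mk_boundary_eq h₂ h₁ (x := p₀.1.1.re) (w := p₀.1.2)
    rw [Complex.conj_eq_iff_re.1 hzc] at e
    rw [e hw hr]
    have := tendsto_phi_lower h₂ h₁ hz.le (by rwa [hzc])
    rw [hzc] at this
    exact (continuous_mk_lattice.tendsto _).comp this

lemma exists_tendsto_phi (h₂ : 0 < y₂) (h₁ : y₂ < y₁) (p₀ : affineCurve y₁ y₂) :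
    ∃ u : ℂ, ThetaValues y₁ y₂ u p₀.1.1 1 ∧
      Tendsto (fun p => (phi y₁ y₂ p : ℂ ⧸ lattice y₁ y₂)) (𝓝 p₀ ⊓ 𝓟 (slitPart y₁ y₂)) (𝓝 u) := by
  rcases lt_trichotomy p₀.1.1.im 0 with h | h | h
  · exact exists_tendsto_phi_of_im_neg h₂ h₁ h
  · exact exists_tendsto_phi_of_im_eq_zero h₂ h₁ h
  · exact exists_tendsto_phi_of_im_pos h₂ h₁ h

/-- The slit sheets are dense in the affine curve. -/
lemma mem_closure_slitPart (p₀ : affineCurve y₁ y₂) : p₀ ∈ closure (slitPart y₁ y₂) := by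
  rcases lt_or_ge p₀.1.1.im 0 with h | h
  · exact subset_closure fun hp => h.ne hp.1
  obtain ⟨s, hs, hs'⟩ : ∃ s : ℂ, s ^ 2 = 1 ∧ p₀.1.2 = s * sqrtR y₁ y₂ p₀.1.1 := by
    have hw : p₀.1.2 ^ 2 = sqrtR y₁ y₂ p₀.1.1 ^ 2 := by rw [sqrtR_sq]; exact p₀.2
    rcases sq_eq_sq_iff_eq_or_eq_neg.1 hw with h | h
    · exact ⟨1, by simp, by simpa using h⟩
    · exact ⟨-1, by simp, by simpa using h⟩
  -- A lift of the vertical ray above the projection, on the sheet through the given point. Going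
  -- upwards keeps √R continuous even when starting on the cut.
  let f : ℝ → affineCurve y₁ y₂ := fun ε =>
    ⟨(p₀.1.1 + ε * I, s * sqrtR y₁ y₂ (p₀.1.1 + ε * I)), by
      show _ ^ 2 = _
      rw [mul_pow, hs, one_mul, sqrtR_sq]⟩
  have hpos : ∀ᶠ ε : ℝ in 𝓝[>] 0, 0 < ε := eventually_mem_nhdsWithin
  have hlim : Tendsto (fun ε : ℝ => p₀.1.1 + ε * I) (𝓝[>] 0) (𝓝 p₀.1.1) := by
    have : Continuous fun ε : ℝ => p₀.1.1 + ε * I := by fun_prop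
    simpa using (this.tendsto 0).mono_left nhdsWithin_le_nhds
  have hlim' : Tendsto (fun ε : ℝ => p₀.1.1 + ε * I) (𝓝[>] 0) (𝓝[{z | 0 ≤ z.im}] p₀.1.1) := by
    refine tendsto_nhdsWithin_iff.2 ⟨hlim, hpos.mono fun ε hε => ?_⟩
    simp only [Set.mem_ofPred_eq, add_im, mul_im, ofReal_re, I_im, ofReal_im, I_re]
    linarith
  refine mem_closure_of_tendsto (f := f) (b := 𝓝[>] (0 : ℝ)) ?_ (hpos.mono fun ε hε hp => ?_)
  · rw [tendsto_subtype_rng]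
    have h2 : Tendsto (fun ε : ℝ => s * sqrtR y₁ y₂ (p₀.1.1 + ε * I)) (𝓝[>] 0) (𝓝 p₀.1.2) := by
      rw [hs']
      exact ((continuousOn_sqrtR _ h).tendsto.comp hlim').const_mul s
    exact hlim.prodMk_nhds h2
  · have := hp.1
    simp only [f, add_im, mul_im, ofReal_re, I_im, ofReal_im, I_re] at this
    linarith

/-! ### The point at infinity -/

lemma continuous_projection : Continuous fun p : affineCurve y₁ y₂ => p.1.1 := by fun_prop

lemma isClosed_affineCurve : IsClosed (affineCurve y₁ y₂) :=
  isClosed_eq (by fun_prop) (by fun_prop)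

/-- The projection is proper: the equation of the curve bounds w once z is bounded. -/
lemma tendsto_norm_projection : Tendsto (fun p : affineCurve y₁ y₂ => ‖p.1.1‖)
    (coclosedCompact (affineCurve y₁ y₂)) atTop := by
  rw [coclosedCompact_eq_cocompact]
  have h : Tendsto (fun p : affineCurve y₁ y₂ => ‖p.1‖) (cocompact _) atTop :=
    tendsto_norm_cocompact_atTop.comp
      isClosed_affineCurve.isClosedEmbedding_subtypeVal.tendsto_cocompact
  rw [tendsto_atTop]
  intro M
  -- With B the bound for |w|², the estimate |w| ≤ 1 + B avoids a square root.
  filter_upwards [h.eventually_gt_atTop (max M (1 + M * (M + |y₂|) * (M + |y₁|)))] with p hp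
  by_contra! hlt
  have hM : 0 ≤ M := (norm_nonneg _).trans hlt.le
  have hw : ‖p.1.2‖ ^ 2 = ‖p.1.1‖ * ‖p.1.1 - y₂‖ * ‖p.1.1 - y₁‖ := by
    rw [← norm_pow, ← norm_mul, ← norm_mul]
    exact congrArg norm p.2
  have hb (a : ℝ) : ‖p.1.1 - a‖ ≤ M + |a| := by
    have := norm_sub_le p.1.1 a
    rw [norm_real, Real.norm_eq_abs] at this
    linarith
  have hB : ‖p.1.2‖ ^ 2 ≤ M * (M + |y₂|) * (M + |y₁|) := by
    rw [hw]
    gcongr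
    · exact hb _
    · exact hb _
  have hw' : ‖p.1.2‖ ≤ 1 + M * (M + |y₂|) * (M + |y₁|) := by nlinarith [norm_nonneg p.1.2]
  have : ‖p.1‖ ≤ max M (1 + M * (M + |y₂|) * (M + |y₁|)) := by
    rw [Prod.norm_def]
    exact max_le_max hlt.le hw'
  linarith

/-- Both sheets tend to the same class because 1/2 is a half period; the lower half plane is handled
by reflection. -/
lemma tendsto_phi_infty (h₂ : 0 < y₂) (h₁ : y₂ < y₁) :
    Tendsto (fun p => (phi y₁ y₂ p : ℂ ⧸ lattice y₁ y₂))
      (coclosedCompact (affineCurve y₁ y₂) ⊓ 𝓟 (slitPart y₁ y₂))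
      (𝓝 ((1 / 2 : ℂ) : ℂ ⧸ lattice y₁ y₂)) := by
  obtain ⟨K, hK, hb⟩ := norm_abelInt_sub_half_le h₂ h₁
  have hK0 : Tendsto (fun p : affineCurve y₁ y₂ => K * (√‖p.1.1‖)⁻¹)
      (coclosedCompact (affineCurve y₁ y₂) ⊓ 𝓟 (slitPart y₁ y₂)) (𝓝 0) := by
    have : Tendsto (fun r : ℝ => K * (√r)⁻¹) atTop (𝓝 0) := by
      simpa using (tendsto_inv_atTop_zero.comp Real.tendsto_sqrt_atTop).const_mul K
    exact (this.comp tendsto_norm_projection).mono_left inf_le_left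
  refine tendsto_mk_of_half_period (m := 1) (n := 0) (g := fun p => abelInt y₁ y₂ p.1.1)
    (by simp) ?_ ?_
  · rw [tendsto_iff_norm_sub_tendsto_zero]
    refine squeeze_zero' (Eventually.of_forall fun _ => norm_nonneg _) ?_ hK0
    filter_upwards [eventually_mem_inf, (tendsto_norm_projection.eventually_ge_atTop
      (2 * y₁)).filter_mono inf_le_left] with p hp hn
    rcases le_total 0 p.1.1.im with h | h
    · exact hb _ h hn
    · have := hb (starRingEnd ℂ p.1.1) (by simpa using h) (by simpa using hn)
      rw [abelInt_conj h₂ h₁ hp, RCLike.norm_conj, ← RCLike.norm_conj, map_sub, conj_conj,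
        map_div₀, map_one, show starRingEnd ℂ 2 = 2 from conj_ofReal 2] at this
      exact this
  · filter_upwards with p
    obtain ⟨ε, hε, -, h⟩ := phi_eq p
    exact ⟨ε, hε, h⟩

/-- The points (x, √R(x)) with x → +∞ lie in the slit part and leave every compact set, so the limit
at infinity is not taken along a trivial filter. -/
lemma neBot_infty : (coclosedCompact (affineCurve y₁ y₂) ⊓ 𝓟 (slitPart y₁ y₂)).NeBot := by
  let f : ℝ → affineCurve y₁ y₂ := fun x => ⟨((x : ℂ), sqrtR y₁ y₂ x), sqrtR_sq _⟩
  have h1 : Tendsto f atTop (cocompact (affineCurve y₁ y₂)) := by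
    refine Tendsto.mono_right (tendsto_comap_iff.2 ?_) (comap_cocompact_le continuous_projection)
    rw [← Metric.cobounded_eq_cocompact, ← tendsto_norm_atTop_iff_cobounded]
    refine tendsto_abs_atTop_atTop.congr fun x => ?_
    simp [f]
  rw [coclosedCompact_eq_cocompact]
  refine NeBot.mono (map_neBot (f := atTop) (m := f)) (le_inf h1 ?_)
  rw [le_principal_iff, mem_map]
  filter_upwards [eventually_gt_atTop y₁] with x hx hp
  have := hp.2
  simp only [f, ofReal_re] at this
  linarith

/-! ### Values of the Abel map and the final identities -/

lemma exists_abelMap_coe (h₂ : 0 < y₂) (h₁ : y₂ < y₁) (p : affineCurve y₁ y₂) :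
    ∃ u : ℂ, ThetaValues y₁ y₂ u p.1.1 1 ∧ abelMap y₁ y₂ p = u := by
  obtain ⟨u, hu, hlim⟩ := exists_tendsto_phi h₂ h₁ p
  have : IsClosed (lattice y₁ y₂ : Set ℂ) := isClosed_lattice h₂ h₁
  refine ⟨u, hu, ?_⟩
  have hne : (𝓝 p ⊓ 𝓟 (slitPart y₁ y₂)).NeBot := mem_closure_iff_clusterPt.1 (mem_closure_slitPart p)
  rw [abelMap, OnePoint.comap_coe_nhds]
  exact hlim.limUnder_eq

lemma abelMap_infty (h₂ : 0 < y₂) (h₁ : y₂ < y₁) :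
    abelMap y₁ y₂ OnePoint.infty = ((1 / 2 : ℂ) : ℂ ⧸ lattice y₁ y₂) := by
  have : IsClosed (lattice y₁ y₂ : Set ℂ) := isClosed_lattice h₂ h₁
  have := neBot_infty (y₁ := y₁) (y₂ := y₂)
  rw [abelMap, OnePoint.comap_coe_nhds_infty]
  exact (tendsto_phi_infty h₂ h₁).limUnder_eq

end AbelTheta

theorem mainTheorem4 (y₁ y₂ : ℝ) (hy₂ : 0 < y₂) (hy₁ : y₂ < y₁) :
    -- finite points `p = (z, w)` of the surface with `z ≠ 0`
    (∀ p : AbelTheta.affineCurve y₁ y₂, p.1.1 ≠ 0 →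
      ∀ u : ℂ, (u : ℂ ⧸ AbelTheta.lattice y₁ y₂) = AbelTheta.abelMap y₁ y₂ p →
        AbelTheta.theta y₁ y₂ u ≠ 0 ∧
        AbelTheta.num₁ y₁ y₂ u / AbelTheta.theta y₁ y₂ u ^ 2
          = AbelTheta.D₁ y₁ y₂ ^ 2 / p.1.1 ∧
        AbelTheta.num₂ y₁ y₂ u / AbelTheta.theta y₁ y₂ u ^ 2
          = AbelTheta.D₂ y₁ y₂ ^ 2 * (p.1.1 - y₁) / p.1.1 ∧
        AbelTheta.num₃ y₁ y₂ u / AbelTheta.theta y₁ y₂ u ^ 2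
          = AbelTheta.D₃ y₁ y₂ ^ 2 * (p.1.1 - y₂) / p.1.1) ∧
    -- the point at infinity, where the right-hand sides are `0`, `D₂²`, `D₃²`
    (∀ u : ℂ, (u : ℂ ⧸ AbelTheta.lattice y₁ y₂) = AbelTheta.abelMap y₁ y₂ OnePoint.infty →
        AbelTheta.theta y₁ y₂ u ≠ 0 ∧
        AbelTheta.num₁ y₁ y₂ u / AbelTheta.theta y₁ y₂ u ^ 2 = 0 ∧
        AbelTheta.num₂ y₁ y₂ u / AbelTheta.theta y₁ y₂ u ^ 2 = AbelTheta.D₂ y₁ y₂ ^ 2 ∧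
        AbelTheta.num₃ y₁ y₂ u / AbelTheta.theta y₁ y₂ u ^ 2 = AbelTheta.D₃ y₁ y₂ ^ 2) ∧
    -- the point over `z = 0`, where both sides of all three identities are infinite
    (∀ u : ℂ, (u : ℂ ⧸ AbelTheta.lattice y₁ y₂)
          = AbelTheta.abelMap y₁ y₂ (AbelTheta.origin y₁ y₂) →
        AbelTheta.theta y₁ y₂ u = 0 ∧
        AbelTheta.num₁ y₁ y₂ u ≠ 0 ∧ AbelTheta.num₂ y₁ y₂ u ≠ 0 ∧
        AbelTheta.num₃ y₁ y₂ u ≠ 0) := by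
  open AbelTheta in
  refine ⟨fun p hp u hu => ?_, fun u hu => ?_, fun u hu => ?_⟩
  · obtain ⟨v, hv, hpv⟩ := exists_abelMap_coe hy₂ hy₁ p
    obtain ⟨ρ, hρ, a, b, c, d⟩ := hv.of_mk_eq hy₂ hy₁ (hu.trans hpv).symm
    have hne : theta y₁ y₂ u ≠ 0 := by
      rw [← pow_ne_zero_iff two_ne_zero, a]
      exact mul_ne_zero hρ hp
    refine ⟨hne, ?_⟩
    -- The unknown common factor ρ cancels in each quotient.
    rw [a, b, c, d, mul_one, mul_one, mul_one, mul_div_mul_left _ _ hρ, mul_div_mul_left _ _ hρ,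
      mul_div_mul_left _ _ hρ]
    exact ⟨rfl, rfl, rfl⟩
  · obtain ⟨ρ, hρ, a, b, c, d⟩ := (thetaValues_infty hy₂ hy₁).of_mk_eq hy₂ hy₁
      (hu.trans (abelMap_infty hy₂ hy₁)).symm
    have hne : theta y₁ y₂ u ≠ 0 := by
      rw [← pow_ne_zero_iff two_ne_zero, a, mul_one]
      exact hρ
    refine ⟨hne, ?_⟩
    rw [a, b, c, d]
    simp [hρ]
  · obtain ⟨v, hv, hpv⟩ := exists_abelMap_coe hy₂ hy₁ (origin y₁ y₂)
    obtain ⟨ρ, hρ, a, b, c, d⟩ := hv.of_mk_eq hy₂ hy₁ (hu.trans hpv).symm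
    obtain ⟨d1, d2, d3⟩ := D_ne_zero hy₂ hy₁
    have e : (origin y₁ y₂).1.1 = 0 := rfl
    have n1 : (y₁ : ℂ) ≠ 0 := by exact_mod_cast (hy₂.trans hy₁).ne'
    have n2 : (y₂ : ℂ) ≠ 0 := by exact_mod_cast hy₂.ne'
    rw [e, mul_zero] at a
    rw [e] at c d
    refine ⟨pow_eq_zero_iff two_ne_zero |>.1 a, ?_, ?_, ?_⟩
    · rw [b]; simp [hρ, d1]
    · rw [c]; simp [hρ, d2, n1]
    · rw [d]; simp [hρ, d3, n2]
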